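/- **Setting.** Let $\hbar>0$, $s>0$ and $\vartheta,\mathcal B\in\mathbb R$ with $\hbar^2-\mathcal B\vartheta\neq0$. Points of $\mathbb R^4$ are written $(\mathbf q,\mathbf p)=(q_1,q_2,p_1,p_2)$. Put $\eta(\mathbf r)=\frac1{\sqrt\pi\,s}e^{-|\mathbf r|^2/2s^2}$ on $\mathbb R^2$, $$\eta_{\mathbf q,\mathbf p}(\mathbf r)=e^{\frac i\hbar(\mathbf r-\frac12\mathbf q)\cdot\mathbf p-\frac{i\vartheta}{2\hbar^2}p_1p_2+\frac{i\mathcal B}{\hbar^2}(q_2r_1-\frac12q_1q_2)}\,\eta\big(r_1-q_1,\;r_2-q_2-\tfrac\vartheta\hbar p_1\big),$$ $d\nu=\frac{|\hbar^2-\mathcal B\vartheta|}{4\pi^2\hbar^4}\,d\mathbf q\,d\mathbf p$, and let $\mathcal W\subset L^2(\mathbb R^4,d\nu)$ be the range of $W\phi(\mathbf q,\mathbf p)=\langle\eta_{\mathbf q,\mathbf p}|\phi\rangle$, $\phi\in L^2(\mathbb R^2)$; it is a closed subspace. For $F\in L^\infty(\mathbb R^4)$ let $\mathcal T_Fu=\mathcal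 P(Fu)$, $u\in\mathcal W$, where $\mathcal P$ is the orthogonal projection of $L^2(\mathbb R^4,d\nu)$ onto $\mathcal W$. Put $q_1^N=q_1$, $q_2^N=q_2+\frac\vartheta\hbar p_1$, $p_1^N=p_1+\frac{\mathcal B}\hbar q_2$, $p_2^N=p_2$, $z_k=\sqrt{\tfrac\hbar2}\,\frac{q_k^N}s-\frac{is\,p_k^N}{\sqrt{2\hbar}}$ $(k=1,2)$; this is a bijection of $\mathbb R^4$ onto $\mathbb C^2$, and $\iota:\mathbb C^2\to\mathbb R^4$ denotes its inverse. For smooth $f,g$ on $\mathbb C^2$ and $F,G$ on $\mathbb R^4$ let $$C_j(f,g)=(-1)^j\sum_{\alpha\in\mathbb N^2,\,|\alpha|=j}\frac1{\alpha!}\,\frac{\partial^\alpha f}{\partial z^\alpha}\,\frac{\partial^\alpha g}{\partial\bar z^\alpha},\qquad \mathcal C_j(F,G)=C_j(F\circ\iota,G\circ\iota)\circ\iota^{-1}.$$ Finally put $B=\mathcal B/\hbar$, $T=\vartheta/\hbar$, $S=s/\sqrt\hbar$ (so $BT\ne1$, $S>0$), and $\partial_{\pm k}=\frac{\partial}{\partial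 p_k}\pm i\frac{\partial}{\partial q_k}$. Then the following hold. 1. The map $\iota$ and all $\mathcal C_j$ depend on $\hbar,\vartheta,\mathcal B,s$ only through $B,T,S$; if $F,G\in C_c^\infty(\mathbb R^4)$ then $\mathcal C_j(F,G)\in C_c^\infty(\mathbb R^4)$. 2. For $F,G\in C_c^\infty(\mathbb R^4)$ one has, in operator norm on $\mathcal W$, $\mathcal T_F\mathcal T_G\approx\sum_{j\ge0}\hbar^j\mathcal T_{\mathcal C_j(F,G)}$ as $\hbar\searrow0$, locally uniformly in $(B,T,S)$: for every compact $K\subset\{(B,T,S):BT\ne1,\ S>0\}$ and every $N\ge0$ there is $C$ with $$\Big\|\mathcal T_F\mathcal T_G-\sum_{j<N}\hbar^j\mathcal T_{\mathcal C_j(F,G)}\Big\|\le C\hbar^N\qquad(0<\hbar\le1,\ (B,T,S)\in K).$$ 3. $F*G:=\sum_{j\ge0}\hbar^j\mathcal C_j(F,G)$ is a star product on $C^\infty(\mathbb R^4)$: the $\mathcal C_j$ are bidifferential operators, $\mathcal C_0(F,G)=FG$, the function $1$ is a unit, and $*$ is associative as a formal power series in $\hbar$. Moreover $\mathcal C_1(F,G)=(\nabla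 F)^{t}A\,\nabla G$ with $\nabla F=(\frac{\partial F}{\partial p_1},\frac{\partial F}{\partial p_2},\frac{\partial F}{\partial q_1},\frac{\partial F}{\partial q_2})^t$ and $$A=\begin{bmatrix} -\frac{1+B^2S^4}{2S^2(1-BT)^2}&-\frac{iB}{2(1-BT)}&-\frac i{2(1-BT)}&\frac{BS^4+T}{2S^2(1-BT)^2}\\ \frac{iB}{2(1-BT)}&-\frac1{2S^2}&0&-\frac i{2(1-BT)}\\ \frac i{2(1-BT)}&0&-\frac{S^2}2&-\frac{iT}{2(1-BT)}\\ \frac{BS^4+T}{2S^2(1-BT)^2}&\frac i{2(1-BT)}&\frac{iT}{2(1-BT)}&-\frac{S^4+T^2}{2S^2(1-BT)^2}\end{bmatrix},$$ that is, in the original parameters, $$A=\begin{bmatrix} -\frac{\hbar(\hbar^4+\mathcal B^2s^4)}{2s^2(\hbar^2-\mathcal B\vartheta)^2}&-\frac{i\mathcal B\hbar}{2(\hbar^2-\mathcal B\vartheta)}&-\frac{i\hbar^2}{2(\hbar^2-\mathcal B\vartheta)}&\frac{\hbar^2(\mathcal Bs^4+\hbar^2\vartheta)}{2s^2(\hbar^2-\mathcal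 B\vartheta)^2}\\ \frac{i\mathcal B\hbar}{2(\hbar^2-\mathcal B\vartheta)}&-\frac\hbar{2s^2}&0&-\frac{i\hbar^2}{2(\hbar^2-\mathcal B\vartheta)}\\ \frac{i\hbar^2}{2(\hbar^2-\mathcal B\vartheta)}&0&-\frac{s^2}{2\hbar}&-\frac{i\hbar\vartheta}{2(\hbar^2-\mathcal B\vartheta)}\\ \frac{\hbar^2(\mathcal Bs^4+\hbar^2\vartheta)}{2s^2(\hbar^2-\mathcal B\vartheta)^2}&\frac{i\hbar^2}{2(\hbar^2-\mathcal B\vartheta)}&\frac{i\hbar\vartheta}{2(\hbar^2-\mathcal B\vartheta)}&-\frac{\hbar^3(s^4+\vartheta^2)}{2s^2(\hbar^2-\mathcal B\vartheta)^2}\end{bmatrix}.$$ 4. Let $S=1$. Then each $\mathcal C_j(F,G)$ is a sum of terms $a_{\mu\nu}(B,T)\,\partial^\mu F\,\partial^\nu G$, $|\mu|=|\nu|=j$, where $(1-BT)^{2j}a_{\mu\nu}$ is a polynomial in $B,T$. There are bidifferential operators $D_{jkl}$ with constant coefficients, of order $j$ in each argument and not depending on $F,G,\hbar,B,T$, such that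 for all $F,G\in C_c^\infty(\mathbb R^4)$ and all $M\ge N\ge0$, as $(\hbar,B,T)\to(0,0,0)$ with $\hbar>0$, $$\sum_{j<M}\hbar^j\mathcal C_j(F,G)=\sum_{j+k+l<N}\hbar^jB^kT^lD_{jkl}(F,G)+O\big((\hbar+|B|+|T|)^N\big)$$ uniformly on $\mathbb R^4$, and $$\mathcal T_F\mathcal T_G=\sum_{j+k+l<N}\hbar^jB^kT^l\,\mathcal T_{D_{jkl}(F,G)}+O\big((\hbar+|B|+|T|)^N\big)$$ in operator norm. The part with $j+k+l\le2$ of the first sum is $$FG-\frac\hbar2\sum_{k=1}^2\partial_{-k}F\,\partial_{+k}G+\frac{B\hbar}2\Big[i\frac{\partial G}{\partial p_1}\partial_{-2}F-i\frac{\partial F}{\partial p_1}\partial_{+2}G\Big]+\frac{T\hbar}2\Big[\frac{\partial F}{\partial q_2}\partial_{+1}G+\frac{\partial G}{\partial q_2}\partial_{-1}F\Big]$$ $$+\frac{\hbar^2}8\Big[\sum_{k=1}^2(\partial_{+k}^2G)(\partial_{-k}^2F)+2(\partial_{+1}\partial_{+2}G)(\partial_{-1}\partial_{-2}F)\Big].$$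 5. Let $S=1$ and $F,G\in C_c^\infty(\mathbb R^4)$. As $(\hbar,B,T)\to(0,0,0)$ with $\hbar>0$, uniformly on $\mathbb R^4$ and for every $M\ge3$, with $\{F,G\}=\sum_k\big(\frac{\partial F}{\partial q_k}\frac{\partial G}{\partial p_k}-\frac{\partial F}{\partial p_k}\frac{\partial G}{\partial q_k}\big)$, $$\sum_{j<M}\hbar^j\big(\mathcal C_j(F,G)-\mathcal C_j(G,F)\big)=i\hbar\{F,G\}+i\hbar B\Big(\frac{\partial F}{\partial p_2}\frac{\partial G}{\partial p_1}-\frac{\partial F}{\partial p_1}\frac{\partial G}{\partial p_2}\Big)+i\hbar T\Big(\frac{\partial F}{\partial q_2}\frac{\partial G}{\partial q_1}-\frac{\partial F}{\partial q_1}\frac{\partial G}{\partial q_2}\Big)$$ $$+\frac{\hbar^2}8\Big[2(\partial_{+1}\partial_{+2}G)(\partial_{-1}\partial_{-2}F)-2(\partial_{+1}\partial_{+2}F)(\partial_{-1}\partial_{-2}G)+\sum_{k=1}^2\big((\partial_{+k}^2G)(\partial_{-k}^2F)-(\partial_{+k}^2F)(\partial_{-k}^2G)\big)\Big]+O\big((\hbar+|B|+|T|)^3\big).$$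 Moreover $\big\|\mathcal T_F\mathcal T_G-\mathcal T_G\mathcal T_F-i\hbar\,\mathcal T_{\{F,G\}}\big\|=O\big(\hbar(\hbar+|B|+|T|)\big)$. -/

import Mathlib

open MeasureTheory Complex
open scoped ContDiff ENNReal ComplexConjugate

namespace NCToeplitz

noncomputable section

/-- The configuration plane `ℝ²`. -/
abbrev Plane := Fin 2 → ℝ

/-- The phase space `ℝ⁴`; a point is `(q, p)` with `q, p ∈ ℝ²`. -/
abbrev Phase := Plane × Plane

/-- `ℂ²`. -/
abbrev C2 := Fin 2 → ℂ

/-! ### Coherent states and the space `𝒲`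

The parameters are always listed in the order `ħ`, `ϑ`, `𝓑`, `s`. -/

/-- The normalized Gaussian `η(r) = (√π s)⁻¹ exp(-|r|² / (2 s²))`. -/
def ground (s : ℝ) (r : Plane) : ℝ :=
  1 / (√Real.pi * s) * Real.exp (-(1 / (2 * s ^ 2)) * (r 0 ^ 2 + r 1 ^ 2))

/-- The noncommutative coherent state `η_{q,p}` at the phase space point `x = (q, p)`. -/
def cohState (ħ ϑ 𝓑 s : ℝ) (x : Phase) (r : Plane) : ℂ :=
  Complex.exp (I * ((((r 0 - x.1 0 / 2) * x.2 0 + (r 1 - x.1 1 / 2) * x.2 1) / ħ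
      - ϑ / (2 * ħ ^ 2) * (x.2 0 * x.2 1)
      + 𝓑 / ħ ^ 2 * (x.1 1 * r 0 - x.1 0 * x.1 1 / 2) : ℝ) : ℂ))
    * (ground s ![r 0 - x.1 0, r 1 - x.1 1 - ϑ / ħ * x.2 0] : ℂ)

/-- The measure `dν = |ħ² - 𝓑ϑ| / (4π²ħ⁴) dq dp` on the phase space. -/
def nu (ħ ϑ 𝓑 : ℝ) : Measure Phase :=
  ENNReal.ofReal (|ħ ^ 2 - 𝓑 * ϑ| / (4 * Real.pi ^ 2 * ħ ^ 4)) • volume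

/-- `(Wφ)(q,p) = ⟨η_{q,p} | φ⟩`. -/
def cohTransform (ħ ϑ 𝓑 s : ℝ) (φ : Lp ℂ 2 (volume : Measure Plane)) (x : Phase) : ℂ :=
  ∫ r, conj (cohState ħ ϑ 𝓑 s x r) * φ r

theorem memLp_cohState (ħ ϑ 𝓑 s : ℝ) (hs : s ≠ 0) (x : Phase) :
    MemLp (cohState ħ ϑ 𝓑 s x) 2 (volume : Measure Plane) := by
  have hcont : Continuous (cohState ħ ϑ 𝓑 s x) := by
    unfold cohState ground
    simp only [Matrix.cons_val_zero, Matrix.cons_val_one]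
    fun_prop
  rw [memLp_two_iff_integrable_sq_norm hcont.aestronglyMeasurable]
  have hb : 0 < 1 / s ^ 2 := by positivity
  have h1 : Integrable (fun r : Plane => ∏ i, Real.exp (-(1 / s ^ 2) * (r i) ^ 2)) :=
    Integrable.fintype_prod (f := fun (_ : Fin 2) (t : ℝ) => Real.exp (-(1 / s ^ 2) * t ^ 2))
      (fun _ => integrable_exp_neg_mul_sq hb)
  have h2 := (h1.comp_sub_right (![x.1 0, x.1 1 + ϑ / ħ * x.2 0] : Plane)).const_mul
    ((1 / (√Real.pi * s)) ^ 2)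
  refine h2.congr (Filter.Eventually.of_forall fun r => ?_)
  have e1 : ‖cohState ħ ϑ 𝓑 s x r‖
      = |ground s ![r 0 - x.1 0, r 1 - x.1 1 - ϑ / ħ * x.2 0]| := by
    unfold cohState
    rw [norm_mul, mul_comm I, Complex.norm_exp_ofReal_mul_I, one_mul, Complex.norm_real,
      Real.norm_eq_abs]
  simp only [e1, sq_abs, ground, Fin.prod_univ_two, Pi.sub_apply, Matrix.cons_val_zero,
    Matrix.cons_val_one]
  rw [mul_pow, ← Real.exp_add, ← Real.exp_nat_mul]
  congr 2
  push_cast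
  field_simp
  ring

theorem integrable_cohState_mul (ħ ϑ 𝓑 s : ℝ) (hs : s ≠ 0) (x : Phase)
    (φ : Lp ℂ 2 (volume : Measure Plane)) :
    Integrable (fun r => conj (cohState ħ ϑ 𝓑 s x r) * φ r) (volume : Measure Plane) :=
  (memLp_cohState ħ ϑ 𝓑 s hs x).star.integrable_mul (Lp.memLp φ)

theorem cohState_zero (ħ ϑ 𝓑 : ℝ) (x : Phase) (r : Plane) : cohState ħ ϑ 𝓑 0 x r = 0 := by
  simp [cohState, ground]

theorem integrable_cohState_mul' (ħ ϑ 𝓑 s : ℝ) (x : Phase)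
    (φ : Lp ℂ 2 (volume : Measure Plane)) :
    Integrable (fun r => conj (cohState ħ ϑ 𝓑 s x r) * φ r) (volume : Measure Plane) := by
  by_cases hs : s = 0
  · subst hs
    simp [cohState_zero]
  · exact integrable_cohState_mul ħ ϑ 𝓑 s hs x φ

/-- The range `𝒲` of `W` in `L²(ℝ⁴, dν)`. -/
def cohRange (ħ ϑ 𝓑 s : ℝ) : Submodule ℂ (Lp ℂ 2 (nu ħ ϑ 𝓑)) where
  carrier := {u | ∃ φ : Lp ℂ 2 (volume : Measure Plane),
    u =ᵐ[nu ħ ϑ 𝓑] cohTransform ħ ϑ 𝓑 s φ}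
  zero_mem' := by
    refine ⟨0, ?_⟩
    have h : cohTransform ħ ϑ 𝓑 s 0 = 0 := by
      funext x
      unfold cohTransform
      rw [integral_congr_ae (g := fun _ => (0 : ℂ)), integral_zero]
      · rfl
      · filter_upwards [Lp.coeFn_zero ℂ 2 (volume : Measure Plane)] with r hr
        rw [hr, Pi.zero_apply, mul_zero]
    rw [h]
    exact Lp.coeFn_zero ℂ 2 _
  add_mem' := by
    rintro u v ⟨φ, hφ⟩ ⟨ψ, hψ⟩
    refine ⟨φ + ψ, ?_⟩
    have h : cohTransform ħ ϑ 𝓑 s (φ + ψ)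
        = cohTransform ħ ϑ 𝓑 s φ + cohTransform ħ ϑ 𝓑 s ψ := by
      funext x
      unfold cohTransform
      rw [Pi.add_apply, ← integral_add (integrable_cohState_mul' ħ ϑ 𝓑 s x φ)
        (integrable_cohState_mul' ħ ϑ 𝓑 s x ψ)]
      refine integral_congr_ae ?_
      filter_upwards [Lp.coeFn_add φ ψ] with r hr
      rw [hr, Pi.add_apply, mul_add]
    rw [h]
    filter_upwards [Lp.coeFn_add u v, hφ, hψ] with x h1 h2 h3
    rw [h1, Pi.add_apply, Pi.add_apply, h2, h3]
  smul_mem' := by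
    rintro c u ⟨φ, hφ⟩
    refine ⟨c • φ, ?_⟩
    have h : cohTransform ħ ϑ 𝓑 s (c • φ) = c • cohTransform ħ ϑ 𝓑 s φ := by
      funext x
      unfold cohTransform
      rw [Pi.smul_apply, ← integral_smul]
      refine integral_congr_ae ?_
      filter_upwards [Lp.coeFn_smul c φ] with r hr
      simp only [hr, Pi.smul_apply, smul_eq_mul]
      ring
    rw [h]
    filter_upwards [Lp.coeFn_smul c u, hφ] with x h1 h2
    rw [h1, Pi.smul_apply, Pi.smul_apply, h2]

/-- `𝒲` as a Hilbert space. For `ħ, s > 0`, `ħ² ≠ 𝓑ϑ` the range is already closed (this is part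
of the theorem), so that taking the closure only serves to have the orthogonal projection
available for all values of the parameters. -/
abbrev cohSpace (ħ ϑ 𝓑 s : ℝ) : Submodule ℂ (Lp ℂ 2 (nu ħ ϑ 𝓑)) :=
  (cohRange ħ ϑ 𝓑 s).topologicalClosure

/-- Multiplication by `F ∈ L^∞` on `L²(ℝ⁴, dν)` (and `0` if `F` is not in `L^∞`). -/
def mulOp (ħ ϑ 𝓑 : ℝ) (F : Phase → ℂ) : Lp ℂ 2 (nu ħ ϑ 𝓑) →L[ℂ] Lp ℂ 2 (nu ħ ϑ 𝓑) :=
  open Classical in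
  if h : MemLp F ∞ (nu ħ ϑ 𝓑) then
    (ContinuousLinearMap.mul ℂ ℂ).holderL (nu ħ ϑ 𝓑) ∞ 2 2 (h.toLp F)
  else 0

/-- The Toeplitz operator `𝒯_F u = 𝒫(F u)` on `𝒲`, `𝒫` the orthogonal projection onto `𝒲`. -/
def toeplitz (ħ ϑ 𝓑 s : ℝ) (F : Phase → ℂ) : cohSpace ħ ϑ 𝓑 s →L[ℂ] cohSpace ħ ϑ 𝓑 s :=
  (cohSpace ħ ϑ 𝓑 s).orthogonalProjectionOnto ∘L mulOp ħ ϑ 𝓑 F ∘L (cohSpace ħ ϑ 𝓑 s).subtypeL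

/-! ### The coefficients `C_j` and `𝒞_j` -/

/-- `∂/∂z_k` on functions on `ℂ²`. -/
def dz (k : Fin 2) (f : C2 → ℂ) (z : C2) : ℂ :=
  (fderiv ℝ f z (Pi.single k 1) - I * fderiv ℝ f z (Pi.single k I)) / 2

/-- `∂/∂z̄_k` on functions on `ℂ²`. -/
def dzbar (k : Fin 2) (f : C2 → ℂ) (z : C2) : ℂ :=
  (fderiv ℝ f z (Pi.single k 1) + I * fderiv ℝ f z (Pi.single k I)) / 2

/-- `C_j(f,g) = (-1)^j ∑_{|α| = j} (1/α!) ∂^α f/∂z^α · ∂^α g/∂z̄^α`. -/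
def flatCoeff (j : ℕ) (f g : C2 → ℂ) (z : C2) : ℂ :=
  (-1) ^ j * ∑ α ∈ Finset.HasAntidiagonal.antidiagonal j, 1 / ((α.1.factorial : ℂ) * (α.2.factorial : ℂ))
    * ((dz 0)^[α.1] ((dz 1)^[α.2] f) z * (dzbar 0)^[α.1] ((dzbar 1)^[α.2] g) z)

/-- `q^NC` as a function of `(q,p)`. -/
def qNC (ħ ϑ : ℝ) (x : Phase) : Plane := ![x.1 0, x.1 1 + ϑ / ħ * x.2 0]

/-- `p^NC` as a function of `(q,p)`. -/
def pNC (ħ 𝓑 : ℝ) (x : Phase) : Plane := ![x.2 0 + 𝓑 / ħ * x.1 1, x.2 1]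

/-- The coordinates `z^NC_k = √(ħ/2) q^NC_k / s - i s p^NC_k / √(2ħ)`. -/
def zNC (ħ ϑ 𝓑 s : ℝ) (x : Phase) : C2 := fun k =>
  ((√(ħ / 2) * qNC ħ ϑ x k / s : ℝ) : ℂ) - I * ((s * pNC ħ 𝓑 x k / √(2 * ħ) : ℝ) : ℂ)

/-- The inverse `ι : ℂ² → ℝ⁴` of the coordinate map `zNC`, where
`q^NC = s/√(2ħ) (z + z̄)` and `p^NC = √(ħ/2)/(is) (z̄ - z)`. -/
def iota (ħ ϑ 𝓑 s : ℝ) (z : C2) : Phase :=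
  let q : Plane := fun k => s / √(2 * ħ) * (2 * (z k).re)
  let p : Plane := fun k => -(√(ħ / 2) / s * (2 * (z k).im))
  (![q 0, (ħ ^ 2 * q 1 - ħ * ϑ * p 0) / (ħ ^ 2 - 𝓑 * ϑ)],
   ![(ħ ^ 2 * p 0 - ħ * 𝓑 * q 1) / (ħ ^ 2 - 𝓑 * ϑ), p 1])

/-- `𝒞_j(F,G) = C_j(F∘ι, G∘ι) ∘ ι⁻¹`. -/
def starCoeff (ħ ϑ 𝓑 s : ℝ) (j : ℕ) (F G : Phase → ℂ) : Phase → ℂ :=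
  flatCoeff j (F ∘ iota ħ ϑ 𝓑 s) (G ∘ iota ħ ϑ 𝓑 s) ∘ zNC ħ ϑ 𝓑 s

/-! ### Derivatives on the phase space -/

/-- `∂F/∂q_k`. -/
def dQ (k : Fin 2) (F : Phase → ℂ) (x : Phase) : ℂ := fderiv ℝ F x (Pi.single k 1, 0)

/-- `∂F/∂p_k`. -/
def dP (k : Fin 2) (F : Phase → ℂ) (x : Phase) : ℂ := fderiv ℝ F x (0, Pi.single k 1)

/-- `∂_{+k} = ∂/∂p_k + i ∂/∂q_k`. -/
def dPlus (k : Fin 2) (F : Phase → ℂ) (x : Phase) : ℂ := dP k F x + I * dQ k F x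

/-- `∂_{-k} = ∂/∂p_k - i ∂/∂q_k`. -/
def dMinus (k : Fin 2) (F : Phase → ℂ) (x : Phase) : ℂ := dP k F x - I * dQ k F x

/-- The vector `(∂F/∂p₁, ∂F/∂p₂, ∂F/∂q₁, ∂F/∂q₂)`. -/
def grad (F : Phase → ℂ) (x : Phase) : Fin 4 → ℂ :=
  ![dP 0 F x, dP 1 F x, dQ 0 F x, dQ 1 F x]

/-- `∂^μ F` for a multiindex `μ`, the variables being ordered as `p₁, p₂, q₁, q₂`. -/
def partialD (μ : Fin 4 → ℕ) (F : Phase → ℂ) : Phase → ℂ :=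
  (dP 0)^[μ 0] ((dP 1)^[μ 1] ((dQ 0)^[μ 2] ((dQ 1)^[μ 3] F)))

/-- The multiindices of length `j`. -/
def multiIdx (j : ℕ) : Finset (Fin 4 → ℕ) := Finset.piAntidiag Finset.univ j

/-- The Poisson bracket `{F,G} = ∑_k (∂F/∂q_k ∂G/∂p_k - ∂F/∂p_k ∂G/∂q_k)`. -/
def poisson (F G : Phase → ℂ) (x : Phase) : ℂ :=
  ∑ k, (dQ k F x * dP k G x - dP k F x * dQ k G x)

/-- Test symbols: smooth functions with compact support. -/
def IsSymbol (F : Phase → ℂ) : Prop := ContDiff ℝ ∞ F ∧ HasCompactSupport F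

/-! ### The matrix of `𝒞₁` -/

/-- The matrix `A` in terms of `ħ, ϑ, 𝓑, s`. -/
def matA (ħ ϑ 𝓑 s : ℂ) : Matrix (Fin 4) (Fin 4) ℂ :=
  !![-(ħ * (ħ ^ 4 + 𝓑 ^ 2 * s ^ 4)) / (2 * s ^ 2 * (ħ ^ 2 - 𝓑 * ϑ) ^ 2),
      -(I * 𝓑 * ħ) / (2 * (ħ ^ 2 - 𝓑 * ϑ)),
      -(I * ħ ^ 2) / (2 * (ħ ^ 2 - 𝓑 * ϑ)),
      ħ ^ 2 * (𝓑 * s ^ 4 + ħ ^ 2 * ϑ) / (2 * s ^ 2 * (ħ ^ 2 - 𝓑 * ϑ) ^ 2);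
    I * 𝓑 * ħ / (2 * (ħ ^ 2 - 𝓑 * ϑ)),
      -ħ / (2 * s ^ 2),
      0,
      -(I * ħ ^ 2) / (2 * (ħ ^ 2 - 𝓑 * ϑ));
    I * ħ ^ 2 / (2 * (ħ ^ 2 - 𝓑 * ϑ)),
      0,
      -s ^ 2 / (2 * ħ),
      -(I * ħ * ϑ) / (2 * (ħ ^ 2 - 𝓑 * ϑ));
    ħ ^ 2 * (𝓑 * s ^ 4 + ħ ^ 2 * ϑ) / (2 * s ^ 2 * (ħ ^ 2 - 𝓑 * ϑ) ^ 2),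
      I * ħ ^ 2 / (2 * (ħ ^ 2 - 𝓑 * ϑ)),
      I * ħ * ϑ / (2 * (ħ ^ 2 - 𝓑 * ϑ)),
      -(ħ ^ 3 * (s ^ 4 + ϑ ^ 2)) / (2 * s ^ 2 * (ħ ^ 2 - 𝓑 * ϑ) ^ 2)]

/-- The matrix `A` in terms of `B, T, S`. -/
def matRen (B T S : ℂ) : Matrix (Fin 4) (Fin 4) ℂ :=
  !![-(1 + B ^ 2 * S ^ 4) / (2 * S ^ 2 * (1 - B * T) ^ 2),
      -(I * B) / (2 * (1 - B * T)),
      -I / (2 * (1 - B * T)),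
      (B * S ^ 4 + T) / (2 * S ^ 2 * (1 - B * T) ^ 2);
    I * B / (2 * (1 - B * T)),
      -1 / (2 * S ^ 2),
      0,
      -I / (2 * (1 - B * T));
    I / (2 * (1 - B * T)),
      0,
      -S ^ 2 / 2,
      -(I * T) / (2 * (1 - B * T));
    (B * S ^ 4 + T) / (2 * S ^ 2 * (1 - B * T) ^ 2),
      I / (2 * (1 - B * T)),
      I * T / (2 * (1 - B * T)),
      -(S ^ 4 + T ^ 2) / (2 * S ^ 2 * (1 - B * T) ^ 2)]

/-! ### Star products -/

/-- Bidifferential operators (with smooth coefficients) on the phase space. -/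
def IsBidifferential (D : (Phase → ℂ) → (Phase → ℂ) → Phase → ℂ) : Prop :=
  ∃ (m : ℕ) (a : (Fin 4 → ℕ) → (Fin 4 → ℕ) → Phase → ℂ),
    (∀ μ ν, ContDiff ℝ ∞ (a μ ν)) ∧
    ∀ F G : Phase → ℂ, ContDiff ℝ ∞ F → ContDiff ℝ ∞ G → ∀ x,
      D F G x = ∑ i ∈ Finset.range (m + 1), ∑ μ ∈ multiIdx i,
        ∑ j ∈ Finset.range (m + 1), ∑ ν ∈ multiIdx j,
          a μ ν x * partialD μ F x * partialD ν G x

/-- `F * G = ∑_j ħ^j C_j(F,G)` is a (differential) star product on `C^∞(ℝ⁴)`: the `C_j` are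
bidifferential operators, `C₀` is the pointwise product, the constant function `1` is the unit,
and the `ℂ[[ħ]]`-bilinear extension to `C^∞(ℝ⁴)[[ħ]]` is associative. -/
structure IsStarProduct (C : ℕ → (Phase → ℂ) → (Phase → ℂ) → Phase → ℂ) : Prop where
  bidifferential : ∀ j, IsBidifferential (C j)
  zero : ∀ F G : Phase → ℂ, ContDiff ℝ ∞ F → ContDiff ℝ ∞ G → C 0 F G = F * G
  one_left : ∀ j, 0 < j → ∀ G : Phase → ℂ, ContDiff ℝ ∞ G → C j 1 G = 0
  one_right : ∀ j, 0 < j → ∀ F : Phase → ℂ, ContDiff ℝ ∞ F → C j F 1 = 0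
  assoc : ∀ F G H : Phase → ℂ, ContDiff ℝ ∞ F → ContDiff ℝ ∞ G → ContDiff ℝ ∞ H → ∀ n : ℕ,
    ∑ a ∈ Finset.HasAntidiagonal.antidiagonal n, C a.1 (C a.2 F G) H
      = ∑ a ∈ Finset.HasAntidiagonal.antidiagonal n, C a.1 F (C a.2 G H)

/-! ### Joint expansions in `(ħ, B, T)`, with `S = 1` -/

/-- `𝒞_j(F,G)` in terms of the renormalized parameters, i.e. for `𝓑 = ħB`, `ϑ = ħT`, `s = √ħ S`. -/
def renCoeff (ħ B T S : ℝ) (j : ℕ) (F G : Phase → ℂ) : Phase → ℂ :=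
  starCoeff ħ (ħ * T) (ħ * B) (√ħ * S) j F G

/-- `𝒲` in terms of the renormalized parameters. -/
abbrev renSpace (ħ B T S : ℝ) : Submodule ℂ (Lp ℂ 2 (nu ħ (ħ * T) (ħ * B))) :=
  cohSpace ħ (ħ * T) (ħ * B) (√ħ * S)

/-- `𝒯_F` in terms of the renormalized parameters. -/
def renToeplitz (ħ B T S : ℝ) (F : Phase → ℂ) :
    renSpace ħ B T S →L[ℂ] renSpace ħ B T S :=
  toeplitz ħ (ħ * T) (ħ * B) (√ħ * S) F

/-- The triples `(j,k,l)` with `j + k + l < N`. -/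
def tripleIdx (N : ℕ) : Finset (ℕ × ℕ × ℕ) :=
  (Finset.range N ×ˢ Finset.range N ×ˢ Finset.range N).filter
    (fun a => a.1 + a.2.1 + a.2.2 < N)

/-- The bidifferential operator with constant coefficients `c`, of order `j` in both arguments. -/
def bidiff (j : ℕ) (c : (Fin 4 → ℕ) → (Fin 4 → ℕ) → ℂ) (F G : Phase → ℂ) (x : Phase) : ℂ :=
  ∑ μ ∈ multiIdx j, ∑ ν ∈ multiIdx j, c μ ν * partialD μ F x * partialD ν G x

/-- The terms of total order at most two in `(ħ, B, T)` in the expansion of `F * G`. -/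
def starSecond (ħ B T : ℂ) (F G : Phase → ℂ) (x : Phase) : ℂ :=
  F x * G x - ħ / 2 * ∑ k, dMinus k F x * dPlus k G x
    + B * ħ / 2 * (I * dP 0 G x * dMinus 1 F x - I * dP 0 F x * dPlus 1 G x)
    + T * ħ / 2 * (dQ 1 F x * dPlus 0 G x + dQ 1 G x * dMinus 0 F x)
    + ħ ^ 2 / 8 * ((∑ k, dPlus k (dPlus k G) x * dMinus k (dMinus k F) x)
      + 2 * (dPlus 0 (dPlus 1 G) x * dMinus 0 (dMinus 1 F) x))

/-- The terms of total order at most two in `(ħ, B, T)` in the expansion of `F * G - G * F`. -/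
def commSecond (ħ B T : ℂ) (F G : Phase → ℂ) (x : Phase) : ℂ :=
  I * ħ * poisson F G x
    + I * ħ * B * (dP 1 F x * dP 0 G x - dP 0 F x * dP 1 G x)
    + I * ħ * T * (dQ 1 F x * dQ 0 G x - dQ 0 F x * dQ 1 G x)
    + ħ ^ 2 / 8 * (2 * (dPlus 0 (dPlus 1 G) x * dMinus 0 (dMinus 1 F) x)
      - 2 * (dPlus 0 (dPlus 1 F) x * dMinus 0 (dMinus 1 G) x)
      + ∑ k, (dPlus k (dPlus k G) x * dMinus k (dMinus k F) x
        - dPlus k (dPlus k F) x * dMinus k (dMinus k G) x))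

end

end NCToeplitz

open NCToeplitz

namespace NCToeplitz

noncomputable section

/-! ### Partial derivatives and multilinear operators with polynomial symbols -/

/-! The whole theorem is a computation on plane waves. In the coordinates (q^NC, p^NC) the transform
W is an ordinary Gaussian-windowed Fourier transform, whatever ϑ and 𝓑 are, and the Jacobian of this
linear change of coordinates cancels against the density of ν. Plancherel in p and a Gaussian
integral in q (`integral_phase_wstd`, `integral_echar_cohVec`) show that compressing multiplication
by exp(iθ·x) to 𝒲 gives a Weyl operator times a Gaussian factor. The case θ = 0 says that W is an
isometry, so its range is closed. By the Weyl relations the product of the Toeplitz operators of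
exp(iθ·x) and exp(iθ'·x) is e^{ħτ} times the one of exp(i(θ+θ')·x), where τ is a bilinear form in
the frequencies (`toeplitz_echar_comp`, `twist_eq_symVal`).

On the other side ι is linear, so ∂/∂z_k and ∂/∂z̄_k are constant complex vector fields on the phase
space and 𝒞_j is the bidifferential operator with polynomial symbol τ^j/j! (`starCoeff_eq_mop`).
Fourier inversion of F and G therefore writes 𝒯_F 𝒯_G with the kernel e^{ħτ} and the partial sums of
the expansion with the Taylor polynomials of e^{ħτ}.

The remainder needs care: τ is quadratic and its real part has no sign, so e^{ħτ} alone is not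
controlled by the decay of the Fourier transforms. But e^{ħτ} times the Toeplitz operator of
exp(i(θ+θ')·x) is a product of two contractions, and without the factor it is a contraction as well.
Since the remainder of the exponential series is at most |z|^N max(1, |e^z|)
(`norm_exp_sub_sum_le`), the integrand is bounded by |ħτ|^N times the two Fourier transforms, and
|τ| ≤ L‖w‖‖w'‖ with L continuous in (B, T, S). This is `norm_renToeplitz_comp_sub_le`.

The star product is algebra of symbols: composing operators substitutes a sum of variables for one
variable, and associativity becomes τ(ξ₀+ξ₁, ξ₂) + τ(ξ₀, ξ₁) = τ(ξ₀, ξ₁+ξ₂) + τ(ξ₁, ξ₂). For S = 1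
the coefficients of 𝒞_j are rational in (B, T), analytic at the origin, and their Taylor expansions
give the joint expansion; operator versions follow from ‖𝒯_H‖ ≤ sup |H|. -/

/-- The coordinate vectors of the phase space, in the order `p₁, p₂, q₁, q₂`. -/
def bvec : Fin 4 → Phase :=
  ![(0, Pi.single 0 1), (0, Pi.single 1 1), (Pi.single 0 1, 0), (Pi.single 1 1, 0)]

/-- The partial derivatives, in the order `p₁, p₂, q₁, q₂`. -/
def pd (k : Fin 4) (F : Phase → ℂ) (x : Phase) : ℂ := fderiv ℝ F x (bvec k)

theorem dP_zero_eq_pd : dP 0 = pd 0 := rfl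
theorem dP_one_eq_pd : dP 1 = pd 1 := rfl
theorem dQ_zero_eq_pd : dQ 0 = pd 2 := rfl
theorem dQ_one_eq_pd : dQ 1 = pd 3 := rfl

theorem contDiff_pd {F : Phase → ℂ} (hF : ContDiff ℝ ∞ F) (k : Fin 4) : ContDiff ℝ ∞ (pd k F) :=
  (hF.fderiv_right (m := ∞) (by simp)).clm_apply contDiff_const

theorem contDiff_pd_iterate {F : Phase → ℂ} (hF : ContDiff ℝ ∞ F) (k : Fin 4) (n : ℕ) :
    ContDiff ℝ ∞ ((pd k)^[n] F) := by
  induction n generalizing F with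
  | zero => exact hF
  | succ n ih => exact ih (contDiff_pd hF k)

/-- Symmetry of the second derivative. It is what allows differential operators to be encoded by
commutative polynomials. -/
theorem pd_comm {F : Phase → ℂ} (hF : ContDiff ℝ ∞ F) (k l : Fin 4) :
    pd k (pd l F) = pd l (pd k F) := by
  funext x
  have h1 : ∀ m n : Fin 4, pd m (pd n F) x = fderiv ℝ (fderiv ℝ F) x (bvec m) (bvec n) := by
    intro m n
    have hd : DifferentiableAt ℝ (fderiv ℝ F) x :=
      ((hF.fderiv_right (m := ∞) (by simp)).differentiable (by simp)) x
    change fderiv ℝ (fun y => fderiv ℝ F y (bvec n)) x (bvec m) = _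
    rw [fderiv_clm_apply hd (differentiableAt_const _)]
    simp
  rw [h1, h1]
  exact (hF.contDiffAt.isSymmSndFDerivAt (by simpa using ENat.LEInfty.out)) _ _

theorem pd_iterate_comm {F : Phase → ℂ} (hF : ContDiff ℝ ∞ F) (k l : Fin 4) (n : ℕ) :
    pd k ((pd l)^[n] F) = (pd l)^[n] (pd k F) := by
  induction n generalizing F with
  | zero => rfl
  | succ n ih => rw [Function.iterate_succ_apply, Function.iterate_succ_apply,
      ih (contDiff_pd hF l), pd_comm hF]

theorem partialD_eq (μ : Fin 4 → ℕ) (F : Phase → ℂ) :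
    partialD μ F = (pd 0)^[μ 0] ((pd 1)^[μ 1] ((pd 2)^[μ 2] ((pd 3)^[μ 3] F))) := rfl

theorem partialD_zero (F : Phase → ℂ) : partialD (fun _ => 0) F = F := rfl

theorem contDiff_partialD {F : Phase → ℂ} (hF : ContDiff ℝ ∞ F) (μ : Fin 4 → ℕ) :
    ContDiff ℝ ∞ (partialD μ F) := by
  rw [partialD_eq]
  exact contDiff_pd_iterate (contDiff_pd_iterate (contDiff_pd_iterate
    (contDiff_pd_iterate hF _ _) _ _) _ _) _ _

/-- The additional derivative is moved inward through the blocks of iterated derivatives. This is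
the monomial case of the rule that multiplying a symbol by a variable differentiates the argument.
-/
theorem partialD_add_single {F : Phase → ℂ} (hF : ContDiff ℝ ∞ F) (μ : Fin 4 → ℕ) (k : Fin 4) :
    partialD (μ + Pi.single k 1) F = partialD μ (pd k F) := by
  have h3 := contDiff_pd_iterate hF 3 (μ 3)
  have h2 := contDiff_pd_iterate h3 2 (μ 2)
  have h1 := contDiff_pd_iterate h2 1 (μ 1)
  simp only [partialD_eq]
  fin_cases k
  · simp [Function.iterate_succ_apply, pd_iterate_comm h2, pd_iterate_comm h3,
      pd_iterate_comm hF]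
  · simp [Function.iterate_succ_apply, pd_iterate_comm h3,
      pd_iterate_comm hF]
  · simp [Function.iterate_succ_apply,
      pd_iterate_comm hF]
  · simp [Function.iterate_succ_apply]

theorem pd_partialD {F : Phase → ℂ} (hF : ContDiff ℝ ∞ F) (μ : Fin 4 → ℕ) (k : Fin 4) :
    pd k (partialD μ F) = partialD μ (pd k F) := by
  have h3 := contDiff_pd_iterate hF 3 (μ 3)
  have h2 := contDiff_pd_iterate h3 2 (μ 2)
  have h1 := contDiff_pd_iterate h2 1 (μ 1)
  simp only [partialD_eq]
  rw [pd_iterate_comm h1, pd_iterate_comm h2, pd_iterate_comm h3, pd_iterate_comm hF]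

section Mop

variable {ι : Type*} [Fintype ι]

/-- The multilinear differential operator with constant coefficients and symbol `p`, where the
variable `(i, k)` stands for the derivative `∂_k` of the `i`-th argument, evaluated at `x`. -/
def mop (F : ι → Phase → ℂ) (x : Phase) : MvPolynomial (ι × Fin 4) ℂ →ₗ[ℂ] ℂ :=
  (MvPolynomial.basisMonomials (ι × Fin 4) ℂ).constr ℂ
    (fun m => ∏ i, partialD (fun k => m (i, k)) (F i) x)

theorem mop_monomial (F : ι → Phase → ℂ) (x : Phase) (m : ι × Fin 4 →₀ ℕ) (c : ℂ) :
    mop F x (MvPolynomial.monomial m c) = c * ∏ i, partialD (fun k => m (i, k)) (F i) x := by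
  have h := (MvPolynomial.basisMonomials (ι × Fin 4) ℂ).constr_basis ℂ
    (fun m => ∏ i, partialD (fun k => m (i, k)) (F i) x) m
  rw [MvPolynomial.coe_basisMonomials] at h
  have h2 : MvPolynomial.monomial m c = c • MvPolynomial.monomial m (1 : ℂ) := by
    rw [MvPolynomial.smul_monomial, smul_eq_mul, mul_one]
  rw [h2, map_smul, smul_eq_mul]
  congr 1

theorem mop_C (F : ι → Phase → ℂ) (x : Phase) (c : ℂ) :
    mop F x (MvPolynomial.C c) = c * ∏ i, F i x := by
  rw [← MvPolynomial.monomial_zero', mop_monomial]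
  rfl

theorem mop_one (F : ι → Phase → ℂ) (x : Phase) : mop F x 1 = ∏ i, F i x := by
  rw [← MvPolynomial.C_1, mop_C, one_mul]

theorem mop_eq_sum (F : ι → Phase → ℂ) (x : Phase) (p : MvPolynomial (ι × Fin 4) ℂ) :
    mop F x p = ∑ m ∈ p.support, p.coeff m * ∏ i, partialD (fun k => m (i, k)) (F i) x := by
  conv_lhs => rw [p.as_sum, map_sum]
  simp_rw [mop_monomial]

theorem contDiff_mop {F : ι → Phase → ℂ} (hF : ∀ i, ContDiff ℝ ∞ (F i))
    (p : MvPolynomial (ι × Fin 4) ℂ) : ContDiff ℝ ∞ (fun x => mop F x p) := by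
  simp_rw [mop_eq_sum]
  exact ContDiff.sum fun m _ => contDiff_const.mul
    (contDiff_prod fun i _ => contDiff_partialD (hF i) _)

theorem mop_C_mul (F : ι → Phase → ℂ) (x : Phase) (c : ℂ) (p : MvPolynomial (ι × Fin 4) ℂ) :
    mop F x (MvPolynomial.C c * p) = c * mop F x p := by
  rw [← MvPolynomial.smul_eq_C_mul, map_smul, smul_eq_mul]

/-- Makes `mop` a representation of the polynomial ring: variables act by differentiating one
argument. Identities between operators then follow by induction on the symbol. -/
theorem mop_X_mul [DecidableEq ι] {F : ι → Phase → ℂ} (hF : ∀ i, ContDiff ℝ ∞ (F i)) (x : Phase)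
    (i : ι) (k : Fin 4) (p : MvPolynomial (ι × Fin 4) ℂ) :
    mop F x (MvPolynomial.X (i, k) * p) = mop (Function.update F i (pd k (F i))) x p := by
  induction p using MvPolynomial.induction_on' with
  | monomial m c =>
    rw [MvPolynomial.X, MvPolynomial.monomial_mul, one_mul, mop_monomial, mop_monomial]
    congr 1
    refine Finset.prod_congr rfl fun i' _ => ?_
    by_cases h : i' = i
    · subst h
      rw [Function.update_self, ← partialD_add_single (hF i')]
      congr 1
      funext k'
      simp [Finsupp.single_apply, Pi.single_apply, add_comm, eq_comm]
    · rw [Function.update_of_ne h]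
      congr 1
      funext k'
      simp [Ne.symm h]
  | add p q hp hq => rw [mul_add, map_add, map_add, hp, hq]

theorem pd_sum {κ : Type*} (s : Finset κ) (c : κ → ℂ) {G : κ → Phase → ℂ}
    (hG : ∀ l, ContDiff ℝ ∞ (G l)) (k : Fin 4) :
    pd k (fun x => ∑ l ∈ s, c l * G l x) = fun x => ∑ l ∈ s, c l * pd k (G l) x := by
  funext x
  have hd : ∀ l, DifferentiableAt ℝ (G l) x := fun l => (hG l).differentiable (by simp) x
  unfold pd
  rw [fderiv_fun_sum fun l _ => (hd l).const_mul (c l)]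
  simp only [sum_apply]
  refine Finset.sum_congr rfl fun l _ => ?_
  rw [fderiv_const_mul (hd l)]
  rfl

theorem pd_iterate_sum {κ : Type*} (s : Finset κ) (c : κ → ℂ) {G : κ → Phase → ℂ}
    (hG : ∀ l, ContDiff ℝ ∞ (G l)) (k : Fin 4) (n : ℕ) :
    (pd k)^[n] (fun x => ∑ l ∈ s, c l * G l x) = fun x => ∑ l ∈ s, c l * (pd k)^[n] (G l) x := by
  induction n generalizing G with
  | zero => rfl
  | succ n ih =>
    rw [Function.iterate_succ_apply, pd_sum s c hG, ih fun l => contDiff_pd (hG l) k]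
    rfl

theorem partialD_sum {κ : Type*} (s : Finset κ) (c : κ → ℂ) {G : κ → Phase → ℂ}
    (hG : ∀ l, ContDiff ℝ ∞ (G l)) (μ : Fin 4 → ℕ) :
    partialD μ (fun x => ∑ l ∈ s, c l * G l x) = fun x => ∑ l ∈ s, c l * partialD μ (G l) x := by
  have h3 := fun l => contDiff_pd_iterate (hG l) 3 (μ 3)
  have h2 := fun l => contDiff_pd_iterate (h3 l) 2 (μ 2)
  have h1 := fun l => contDiff_pd_iterate (h2 l) 1 (μ 1)
  simp only [partialD_eq]
  rw [pd_iterate_sum s c hG, pd_iterate_sum s c h3, pd_iterate_sum s c h2, pd_iterate_sum s c h1]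

/-- The first order operator `∑ₖ vₖ ∂ₖ`. -/
def dir (v : Fin 4 → ℂ) (F : Phase → ℂ) (x : Phase) : ℂ := ∑ k, v k * pd k F x

theorem contDiff_dir {F : Phase → ℂ} (hF : ContDiff ℝ ∞ F) (v : Fin 4 → ℂ) :
    ContDiff ℝ ∞ (dir v F) :=
  ContDiff.sum fun k _ => contDiff_const.mul (contDiff_pd hF k)

theorem contDiff_dir_iterate {F : Phase → ℂ} (hF : ContDiff ℝ ∞ F) (v : Fin 4 → ℂ) (n : ℕ) :
    ContDiff ℝ ∞ ((dir v)^[n] F) := by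
  induction n generalizing F with
  | zero => exact hF
  | succ n ih => exact ih (contDiff_dir hF v)

/-- The linear form `∑ₖ vₖ X_(i,k)`, the symbol of `dir v` acting on the `i`-th argument. -/
def linForm {R : Type*} [CommRing R] (i : ι) (v : Fin 4 → R) : MvPolynomial (ι × Fin 4) R :=
  ∑ k, MvPolynomial.C (v k) * MvPolynomial.X (i, k)

theorem mop_linForm_mul [DecidableEq ι] {F : ι → Phase → ℂ} (hF : ∀ i, ContDiff ℝ ∞ (F i))
    (x : Phase) (i : ι) (v : Fin 4 → ℂ) (p : MvPolynomial (ι × Fin 4) ℂ) :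
    mop F x (linForm i v * p) = mop (Function.update F i (dir v (F i))) x p := by
  unfold linForm
  simp_rw [Finset.sum_mul, map_sum, mul_assoc, mop_C_mul, mop_X_mul hF]
  induction p using MvPolynomial.induction_on' with
  | monomial m c =>
    simp_rw [mop_monomial]
    -- Only the i-th factor sees the new argument; once it is isolated, linearity of `partialD`
    -- finishes the monomial case.
    have hprod : ∀ (G : Phase → ℂ), ∏ i', partialD (fun k => m (i', k)) (Function.update F i G i') x
        = partialD (fun k => m (i, k)) G x
          * ∏ i' ∈ Finset.univ.erase i, partialD (fun k => m (i', k)) (F i') x := by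
      intro G
      rw [← Finset.mul_prod_erase _ _ (Finset.mem_univ i), Function.update_self]
      congr 1
      refine Finset.prod_congr rfl fun i' hi' => ?_
      rw [Function.update_of_ne (Finset.ne_of_mem_erase hi')]
    simp_rw [hprod]
    have h2 := congrFun (partialD_sum Finset.univ v (fun k => contDiff_pd (hF i) k)
      (fun k => m (i, k))) x
    rw [show dir v (F i) = fun x => ∑ k, v k * pd k (F i) x from rfl, h2, Finset.sum_mul,
      Finset.mul_sum]
    refine Finset.sum_congr rfl fun k _ => ?_
    ring
  | add p q hp hq =>
    simp_rw [map_add, mul_add, Finset.sum_add_distrib]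
    rw [hp, hq]

end Mop

/-! ### Operators in two and three arguments -/

theorem contDiff_pair {F G : Phase → ℂ} (hF : ContDiff ℝ ∞ F) (hG : ContDiff ℝ ∞ G) :
    ∀ i, ContDiff ℝ ∞ ((![F, G] : Fin 2 → Phase → ℂ) i) := by
  intro i
  fin_cases i
  exacts [hF, hG]

theorem contDiff_triple {F G H : Phase → ℂ} (hF : ContDiff ℝ ∞ F) (hG : ContDiff ℝ ∞ G)
    (hH : ContDiff ℝ ∞ H) : ∀ i, ContDiff ℝ ∞ ((![F, G, H] : Fin 3 → Phase → ℂ) i) := by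
  intro i
  fin_cases i
  exacts [hF, hG, hH]

theorem update_pair_zero (F G F' : Phase → ℂ) :
    Function.update (![F, G] : Fin 2 → Phase → ℂ) 0 F' = ![F', G] := by
  funext i; fin_cases i <;> rfl

theorem update_pair_one (F G G' : Phase → ℂ) :
    Function.update (![F, G] : Fin 2 → Phase → ℂ) 1 G' = ![F, G'] := by
  funext i; fin_cases i <;> rfl

theorem mop_X_zero_mul {F G : Phase → ℂ} (hF : ContDiff ℝ ∞ F) (hG : ContDiff ℝ ∞ G) (x : Phase)
    (k : Fin 4) (p : MvPolynomial (Fin 2 × Fin 4) ℂ) :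
    mop ![F, G] x (MvPolynomial.X (0, k) * p) = mop ![pd k F, G] x p := by
  rw [mop_X_mul (contDiff_pair hF hG), update_pair_zero]
  rfl

theorem mop_X_one_mul {F G : Phase → ℂ} (hF : ContDiff ℝ ∞ F) (hG : ContDiff ℝ ∞ G) (x : Phase)
    (k : Fin 4) (p : MvPolynomial (Fin 2 × Fin 4) ℂ) :
    mop ![F, G] x (MvPolynomial.X (1, k) * p) = mop ![F, pd k G] x p := by
  rw [mop_X_mul (contDiff_pair hF hG), update_pair_one]
  rfl

theorem pd_mul {F G : Phase → ℂ} (hF : ContDiff ℝ ∞ F) (hG : ContDiff ℝ ∞ G) (k : Fin 4)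
    (x : Phase) : pd k (fun y => F y * G y) x = pd k F x * G x + F x * pd k G x := by
  unfold pd
  rw [fderiv_fun_mul (hF.differentiable (by simp) x) (hG.differentiable (by simp) x)]
  simp
  ring

/-- The Leibniz rule in terms of symbols. It is the origin of the substitutions `mergeLeft` and
`mergeRight`. -/
theorem pd_mop {F G : Phase → ℂ} (hF : ContDiff ℝ ∞ F) (hG : ContDiff ℝ ∞ G) (k : Fin 4)
    (p : MvPolynomial (Fin 2 × Fin 4) ℂ) :
    pd k (fun x => mop ![F, G] x p) = fun x => mop ![F, G] x
      ((MvPolynomial.X (0, k) + MvPolynomial.X (1, k)) * p) := by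
  funext x
  rw [add_mul, map_add, mop_X_zero_mul hF hG, mop_X_one_mul hF hG]
  simp_rw [mop_eq_sum, Fin.prod_univ_two, Matrix.cons_val_zero, Matrix.cons_val_one,
    Matrix.cons_val_fin_one]
  rw [pd_sum (G := fun m x => partialD (fun k => m (0, k)) F x * partialD (fun k => m (1, k)) G x)
      p.support _ (fun m => (contDiff_partialD hF _).mul (contDiff_partialD hG _)),
    ← Finset.sum_add_distrib]
  refine Finset.sum_congr rfl fun m _ => ?_
  rw [pd_mul (contDiff_partialD hF _) (contDiff_partialD hG _), pd_partialD hF, pd_partialD hG]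
  ring

/-- The substitution `ξ₀ ↦ ξ₀ + ξ₁`, `ξ₁ ↦ ξ₂` of symbols. -/
def mergeLeft (p : MvPolynomial (Fin 2 × Fin 4) ℂ) : MvPolynomial (Fin 3 × Fin 4) ℂ :=
  MvPolynomial.aeval (fun a : Fin 2 × Fin 4 =>
    (![MvPolynomial.X (0, a.2) + MvPolynomial.X (1, a.2), MvPolynomial.X (2, a.2)] :
      Fin 2 → MvPolynomial (Fin 3 × Fin 4) ℂ) a.1) p

/-- The substitution `ξ₀ ↦ ξ₀`, `ξ₁ ↦ ξ₁ + ξ₂` of symbols. -/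
def mergeRight (p : MvPolynomial (Fin 2 × Fin 4) ℂ) : MvPolynomial (Fin 3 × Fin 4) ℂ :=
  MvPolynomial.aeval (fun a : Fin 2 × Fin 4 =>
    (![MvPolynomial.X (0, a.2), MvPolynomial.X (1, a.2) + MvPolynomial.X (2, a.2)] :
      Fin 2 → MvPolynomial (Fin 3 × Fin 4) ℂ) a.1) p

/-- A symbol in two arguments, acting on the first two of three. -/
def liftLeft (p : MvPolynomial (Fin 2 × Fin 4) ℂ) : MvPolynomial (Fin 3 × Fin 4) ℂ :=
  MvPolynomial.rename (fun a => (a.1.castSucc, a.2)) p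

/-- A symbol in two arguments, acting on the last two of three. -/
def liftRight (p : MvPolynomial (Fin 2 × Fin 4) ℂ) : MvPolynomial (Fin 3 × Fin 4) ℂ :=
  MvPolynomial.rename (fun a => (a.1.succ, a.2)) p

/-- The renamed monomials have exponent zero in every variable of the third slot, so H is not
differentiated. -/
theorem mop_liftLeft (F G H : Phase → ℂ) (x : Phase) (q : MvPolynomial (Fin 2 × Fin 4) ℂ) :
    mop ![F, G, H] x (liftLeft q) = mop ![F, G] x q * H x := by
  unfold liftLeft
  induction q using MvPolynomial.induction_on' with
  | monomial m c =>
    have hinj : Function.Injective (fun a : Fin 2 × Fin 4 => (a.1.castSucc, a.2)) := by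
      rintro ⟨a, b⟩ ⟨c, d⟩ h
      simpa using h
    have e0 : ∀ k, m.mapDomain (fun a : Fin 2 × Fin 4 => (a.1.castSucc, a.2)) (0, k) = m (0, k) :=
      fun k => Finsupp.mapDomain_apply hinj m (0, k)
    have e1 : ∀ k, m.mapDomain (fun a : Fin 2 × Fin 4 => (a.1.castSucc, a.2)) (1, k) = m (1, k) :=
      fun k => Finsupp.mapDomain_apply hinj m (1, k)
    have e2 : ∀ k, m.mapDomain (fun a : Fin 2 × Fin 4 => (a.1.castSucc, a.2)) (2, k) = 0 := by
      intro k
      refine Finsupp.mapDomain_of_notMem_range m _ ?_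
      rintro ⟨⟨a, b⟩, h⟩
      fin_cases a <;> simp at h
    rw [MvPolynomial.rename_monomial, mop_monomial, mop_monomial, Fin.prod_univ_three,
      Fin.prod_univ_two]
    simp_rw [e0, e1, e2]
    simp only [Matrix.cons_val_zero, Matrix.cons_val_one, Matrix.cons_val, partialD_zero]
    ring
  | add p q hp hq => rw [map_add, map_add, map_add, hp, hq, add_mul]

theorem mop_liftRight (F G H : Phase → ℂ) (x : Phase) (q : MvPolynomial (Fin 2 × Fin 4) ℂ) :
    mop ![F, G, H] x (liftRight q) = F x * mop ![G, H] x q := by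
  unfold liftRight
  induction q using MvPolynomial.induction_on' with
  | monomial m c =>
    have hinj : Function.Injective (fun a : Fin 2 × Fin 4 => (a.1.succ, a.2)) := by
      rintro ⟨a, b⟩ ⟨c, d⟩ h
      simpa using h
    have e0 : ∀ k, m.mapDomain (fun a : Fin 2 × Fin 4 => (a.1.succ, a.2)) (1, k) = m (0, k) :=
      fun k => Finsupp.mapDomain_apply hinj m (0, k)
    have e1 : ∀ k, m.mapDomain (fun a : Fin 2 × Fin 4 => (a.1.succ, a.2)) (2, k) = m (1, k) :=
      fun k => Finsupp.mapDomain_apply hinj m (1, k)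
    have e2 : ∀ k, m.mapDomain (fun a : Fin 2 × Fin 4 => (a.1.succ, a.2)) (0, k) = 0 := by
      intro k
      refine Finsupp.mapDomain_of_notMem_range m _ ?_
      rintro ⟨⟨a, b⟩, h⟩
      fin_cases a <;> simp at h
    rw [MvPolynomial.rename_monomial, mop_monomial, mop_monomial, Fin.prod_univ_three,
      Fin.prod_univ_two]
    simp_rw [e0, e1, e2]
    simp only [Matrix.cons_val_zero, Matrix.cons_val_one, Matrix.cons_val, partialD_zero]
    ring
  | add p q hp hq => rw [map_add, map_add, map_add, hp, hq, mul_add]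

theorem mergeLeft_add (p q : MvPolynomial (Fin 2 × Fin 4) ℂ) :
    mergeLeft (p + q) = mergeLeft p + mergeLeft q := map_add _ _ _

theorem mergeLeft_mul (p q : MvPolynomial (Fin 2 × Fin 4) ℂ) :
    mergeLeft (p * q) = mergeLeft p * mergeLeft q := map_mul _ _ _

theorem mergeLeft_C (a : ℂ) : mergeLeft (MvPolynomial.C a) = MvPolynomial.C a :=
  MvPolynomial.algHom_C _ _

theorem mergeLeft_X_zero (k : Fin 4) : mergeLeft (MvPolynomial.X (0, k))
    = MvPolynomial.X (0, k) + MvPolynomial.X (1, k) := MvPolynomial.aeval_X _ _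

theorem mergeLeft_X_one (k : Fin 4) : mergeLeft (MvPolynomial.X (1, k))
    = MvPolynomial.X (2, k) := MvPolynomial.aeval_X _ _

theorem mergeRight_add (p q : MvPolynomial (Fin 2 × Fin 4) ℂ) :
    mergeRight (p + q) = mergeRight p + mergeRight q := map_add _ _ _

theorem mergeRight_mul (p q : MvPolynomial (Fin 2 × Fin 4) ℂ) :
    mergeRight (p * q) = mergeRight p * mergeRight q := map_mul _ _ _

theorem mergeRight_C (a : ℂ) : mergeRight (MvPolynomial.C a) = MvPolynomial.C a :=
  MvPolynomial.algHom_C _ _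

theorem mergeRight_X_zero (k : Fin 4) : mergeRight (MvPolynomial.X (0, k))
    = MvPolynomial.X (0, k) := MvPolynomial.aeval_X _ _

theorem mergeRight_X_one (k : Fin 4) : mergeRight (MvPolynomial.X (1, k))
    = MvPolynomial.X (1, k) + MvPolynomial.X (2, k) := MvPolynomial.aeval_X _ _

theorem liftLeft_mul (p q : MvPolynomial (Fin 2 × Fin 4) ℂ) :
    liftLeft (p * q) = liftLeft p * liftLeft q := map_mul _ _ _

theorem liftLeft_add (p q : MvPolynomial (Fin 2 × Fin 4) ℂ) :
    liftLeft (p + q) = liftLeft p + liftLeft q := map_add _ _ _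

theorem liftLeft_X_zero (k : Fin 4) : liftLeft (MvPolynomial.X (0, k)) = MvPolynomial.X (0, k) :=
  MvPolynomial.rename_X _ _

theorem liftLeft_X_one (k : Fin 4) : liftLeft (MvPolynomial.X (1, k)) = MvPolynomial.X (1, k) :=
  MvPolynomial.rename_X _ _

theorem liftRight_mul (p q : MvPolynomial (Fin 2 × Fin 4) ℂ) :
    liftRight (p * q) = liftRight p * liftRight q := map_mul _ _ _

theorem liftRight_add (p q : MvPolynomial (Fin 2 × Fin 4) ℂ) :
    liftRight (p + q) = liftRight p + liftRight q := map_add _ _ _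

theorem liftRight_X_zero (k : Fin 4) : liftRight (MvPolynomial.X (0, k)) = MvPolynomial.X (1, k) :=
  MvPolynomial.rename_X _ _

theorem liftRight_X_one (k : Fin 4) : liftRight (MvPolynomial.X (1, k)) = MvPolynomial.X (2, k) :=
  MvPolynomial.rename_X _ _

/-- Induction on the outer symbol, with H and the inner symbol free: a variable of the first slot
falls on both F and G by `pd_mop` and is absorbed into the inner symbol, a variable of the second
slot falls on H. -/
theorem mop_mop_left {F G H : Phase → ℂ} (hF : ContDiff ℝ ∞ F) (hG : ContDiff ℝ ∞ G)
    (hH : ContDiff ℝ ∞ H) (x : Phase) (p q : MvPolynomial (Fin 2 × Fin 4) ℂ) :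
    mop ![fun y => mop ![F, G] y q, H] x p = mop ![F, G, H] x (mergeLeft p * liftLeft q) := by
  have hmop : ∀ q, ContDiff ℝ ∞ (fun y => mop ![F, G] y q) :=
    fun q => contDiff_mop (contDiff_pair hF hG) q
  induction p using MvPolynomial.induction_on generalizing q H with
  | C a =>
    rw [mop_C, mergeLeft_C, mop_C_mul, mop_liftLeft, Fin.prod_univ_two]
    rfl
  | add p p' hp hp' =>
    rw [map_add, hp hH, hp' hH, ← map_add, ← add_mul, mergeLeft_add]
  | mul_X p a ih =>
    obtain ⟨i, k⟩ := a
    obtain rfl | rfl : i = 0 ∨ i = 1 := by fin_cases i <;> simp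
    · rw [mul_comm, mop_X_zero_mul (hmop q) hH, pd_mop hF hG, ih hH, mergeLeft_mul, liftLeft_mul,
        mergeLeft_X_zero, liftLeft_add, liftLeft_X_zero, liftLeft_X_one]
      congr 1
      ring
    · rw [mul_comm, mop_X_one_mul (hmop q) hH, ih (contDiff_pd hH k), mergeLeft_mul,
        mergeLeft_X_one, mul_assoc, mop_X_mul (contDiff_triple hF hG hH)]
      congr 1

theorem mop_mop_right {F G H : Phase → ℂ} (hF : ContDiff ℝ ∞ F) (hG : ContDiff ℝ ∞ G)
    (hH : ContDiff ℝ ∞ H) (x : Phase) (p q : MvPolynomial (Fin 2 × Fin 4) ℂ) :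
    mop ![F, fun y => mop ![G, H] y q] x p = mop ![F, G, H] x (mergeRight p * liftRight q) := by
  have hmop : ∀ q, ContDiff ℝ ∞ (fun y => mop ![G, H] y q) :=
    fun q => contDiff_mop (contDiff_pair hG hH) q
  induction p using MvPolynomial.induction_on generalizing q F with
  | C a =>
    rw [mop_C, mergeRight_C, mop_C_mul, mop_liftRight, Fin.prod_univ_two]
    rfl
  | add p p' hp hp' =>
    rw [map_add, hp hF, hp' hF, ← map_add, ← add_mul, mergeRight_add]
  | mul_X p a ih =>
    obtain ⟨i, k⟩ := a
    obtain rfl | rfl : i = 0 ∨ i = 1 := by fin_cases i <;> simp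
    · rw [mul_comm, mop_X_zero_mul hF (hmop q), ih (contDiff_pd hF k), mergeRight_mul,
        mergeRight_X_zero, mul_assoc, mop_X_mul (contDiff_triple hF hG hH)]
      congr 1
    · rw [mul_comm, mop_X_one_mul hF (hmop q), pd_mop hG hH, ih hF, mergeRight_mul, liftRight_mul,
        mergeRight_X_one, liftRight_add, liftRight_X_zero, liftRight_X_one]
      congr 1
      ring

end

end NCToeplitz

namespace NCToeplitz

noncomputable section

/-! ### The symbol of the star product -/

section Symbol

variable {R : Type*} [CommRing R]

/-- The symbol `-∑ₖ vₖ(ξ) wₖ(η)`. -/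
def tauP (v w : Fin 2 → Fin 4 → R) : MvPolynomial (Fin 2 × Fin 4) R :=
  -∑ k, linForm 0 (v k) * linForm 1 (w k)

/-- The multiindex in two arguments with components `μ` and `ν`. -/
def pairIdx (μ ν : Fin 4 → ℕ) : Fin 2 × Fin 4 →₀ ℕ :=
  Finsupp.equivFunOnFinite.symm fun a => (![μ, ν] : Fin 2 → Fin 4 → ℕ) a.1 a.2

theorem pairIdx_surj (m : Fin 2 × Fin 4 →₀ ℕ) :
    pairIdx (fun k => m (0, k)) (fun k => m (1, k)) = m := by
  ext ⟨i, k⟩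
  obtain rfl | rfl : i = 0 ∨ i = 1 := by fin_cases i <;> simp
  · rfl
  · rfl

/-- The weight counting the degrees in the two arguments separately. -/
def biWeight (a : Fin 2 × Fin 4) : ℕ × ℕ := if a.1 = 0 then (1, 0) else (0, 1)

theorem linForm_isWeightedHomogeneous_zero (v : Fin 4 → R) :
    (linForm (0 : Fin 2) v).IsWeightedHomogeneous biWeight (1, 0) := by
  refine MvPolynomial.IsWeightedHomogeneous.sum _ _ _ fun k _ => ?_
  have h := (MvPolynomial.isWeightedHomogeneous_C biWeight (v k)).mul
    (MvPolynomial.isWeightedHomogeneous_X R biWeight (0, k))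
  simpa [biWeight] using h

theorem linForm_isWeightedHomogeneous_one (v : Fin 4 → R) :
    (linForm (1 : Fin 2) v).IsWeightedHomogeneous biWeight (0, 1) := by
  refine MvPolynomial.IsWeightedHomogeneous.sum _ _ _ fun k _ => ?_
  have h := (MvPolynomial.isWeightedHomogeneous_C biWeight (v k)).mul
    (MvPolynomial.isWeightedHomogeneous_X R biWeight (1, k))
  simpa [biWeight] using h

theorem tauP_isWeightedHomogeneous (v w : Fin 2 → Fin 4 → R) :
    (tauP v w).IsWeightedHomogeneous biWeight (1, 1) := by
  unfold tauP
  rw [← Finset.sum_neg_distrib]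
  refine MvPolynomial.IsWeightedHomogeneous.sum _ _ _ fun k _ => ?_
  have h := (MvPolynomial.isWeightedHomogeneous_C biWeight (-1 : R)).mul
    ((linForm_isWeightedHomogeneous_zero (v k)).mul (linForm_isWeightedHomogeneous_one (w k)))
  simpa using h

theorem weight_biWeight (m : Fin 2 × Fin 4 →₀ ℕ) :
    Finsupp.weight biWeight m = (∑ k, m (0, k), ∑ k, m (1, k)) := by
  rw [Finsupp.weight_apply, Finsupp.sum_fintype _ _ (by simp), Fintype.sum_prod_type,
    Fin.sum_univ_two]
  simp [biWeight, Prod.ext_iff, Prod.fst_sum, Prod.snd_sum]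

end Symbol

theorem mem_multiIdx {j : ℕ} {μ : Fin 4 → ℕ} : μ ∈ multiIdx j ↔ ∑ k, μ k = j := by
  simp [multiIdx]

/-- An operator whose symbol is homogeneous of degree `j` in both arguments. -/
theorem mop_eq_bidiff {j : ℕ} {p : MvPolynomial (Fin 2 × Fin 4) ℂ}
    (hp : p.IsWeightedHomogeneous biWeight (j, j)) (F G : Phase → ℂ) (x : Phase) :
    mop ![F, G] x p = bidiff j (fun μ ν => p.coeff (pairIdx μ ν)) F G x := by
  rw [mop_eq_sum, bidiff, ← Finset.sum_product']
  symm
  -- Only nonzero terms are matched. A pair with vanishing coefficient is absent from the support,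
  -- while homogeneity forces every monomial of the support to come from two multiindices of length
  -- j.
  refine Finset.sum_bij_ne_zero (fun a _ _ => pairIdx a.1 a.2) ?_ ?_ ?_ ?_
  · rintro ⟨μ, ν⟩ _ h
    rw [MvPolynomial.mem_support_iff]
    intro h0
    exact h (by simp [h0])
  · rintro ⟨μ, ν⟩ _ _ ⟨μ', ν'⟩ _ _ h
    refine Prod.ext (funext fun k => ?_) (funext fun k => ?_)
    · exact DFunLike.congr_fun h (0, k)
    · exact DFunLike.congr_fun h (1, k)
  · intro m hm h
    have hw := hp (MvPolynomial.mem_support_iff.1 hm)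
    rw [weight_biWeight, Prod.mk.injEq] at hw
    refine ⟨(fun k => m (0, k), fun k => m (1, k)), ?_, ?_, pairIdx_surj m⟩
    · simp [mem_multiIdx, hw.1, hw.2]
    · rw [pairIdx_surj, mul_assoc]
      rw [Fin.prod_univ_two] at h
      exact h
  · rintro ⟨μ, ν⟩ _ _
    rw [Fin.prod_univ_two, mul_assoc]
    rfl

/-- The symbol `τʲ / j!`. -/
def starSym (v w : Fin 2 → Fin 4 → ℂ) (j : ℕ) : MvPolynomial (Fin 2 × Fin 4) ℂ :=
  MvPolynomial.C (1 / (j.factorial : ℂ)) * tauP v w ^ j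

theorem starSym_isWeightedHomogeneous (v w : Fin 2 → Fin 4 → ℂ) (j : ℕ) :
    (starSym v w j).IsWeightedHomogeneous biWeight (j, j) := by
  have h := (MvPolynomial.isWeightedHomogeneous_C biWeight (1 / (j.factorial : ℂ))).mul
    ((tauP_isWeightedHomogeneous v w).pow j)
  simpa [starSym] using h

/-- The divided powers of a sum. -/
theorem sum_antidiagonal_divided_pow {A : Type*} [CommRing A] [Algebra ℂ A] (x y : A) (n : ℕ) :
    ∑ a ∈ Finset.HasAntidiagonal.antidiagonal n,
      algebraMap ℂ A (1 / (a.1.factorial : ℂ)) * x ^ a.1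
        * (algebraMap ℂ A (1 / (a.2.factorial : ℂ)) * y ^ a.2)
      = algebraMap ℂ A (1 / (n.factorial : ℂ)) * (x + y) ^ n := by
  rw [(Commute.all x y).add_pow', Finset.mul_sum]
  refine Finset.sum_congr rfl fun a ha => ?_
  have han : a.1 + a.2 = n := Finset.HasAntidiagonal.mem_antidiagonal.1 ha
  have h : (n.choose a.1 : ℂ) * (1 / (n.factorial : ℂ))
      = 1 / (a.1.factorial : ℂ) * (1 / (a.2.factorial : ℂ)) := by
    have h1 := Nat.add_choose_mul_factorial_mul_factorial a.2 a.1
    rw [add_comm, han, mul_right_comm] at h1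
    have h2 : (n.choose a.1 : ℂ) * a.1.factorial * a.2.factorial = n.factorial := by
      exact_mod_cast h1
    have e0 : (n.factorial : ℂ) ≠ 0 := by exact_mod_cast n.factorial_ne_zero
    have e1 : (a.1.factorial : ℂ) ≠ 0 := by exact_mod_cast a.1.factorial_ne_zero
    have e2 : (a.2.factorial : ℂ) ≠ 0 := by exact_mod_cast a.2.factorial_ne_zero
    field_simp
    rw [← h2]
  have h' : (n.choose a.1 : A) * algebraMap ℂ A (1 / (n.factorial : ℂ))
      = algebraMap ℂ A (1 / (a.1.factorial : ℂ)) * algebraMap ℂ A (1 / (a.2.factorial : ℂ)) := by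
    rw [← map_mul, ← h, map_mul, map_natCast]
  rw [nsmul_eq_mul]
  linear_combination -(x ^ a.1 * y ^ a.2) * h'

/-- The symbol of `dir v` in the `i`-th and `dir w` in the `j`-th of three arguments. -/
def tauIJ (v w : Fin 2 → Fin 4 → ℂ) (i j : Fin 3) : MvPolynomial (Fin 3 × Fin 4) ℂ :=
  -∑ k, linForm i (v k) * linForm j (w k)

/-- Linearity of τ in its first argument. With linearity in the second one this is the only property
of τ behind associativity. -/
theorem mergeLeft_tauP (v w : Fin 2 → Fin 4 → ℂ) :
    mergeLeft (tauP v w) = tauIJ v w 0 2 + tauIJ v w 1 2 := by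
  simp only [mergeLeft, tauP, tauIJ, linForm, map_neg, map_sum, map_mul, MvPolynomial.aeval_X,
    MvPolynomial.algHom_C, MvPolynomial.algebraMap_eq]
  simp only [Matrix.cons_val_zero, Matrix.cons_val_one, Matrix.cons_val_fin_one, mul_add,
    Finset.sum_add_distrib, add_mul]
  ring

theorem mergeRight_tauP (v w : Fin 2 → Fin 4 → ℂ) :
    mergeRight (tauP v w) = tauIJ v w 0 1 + tauIJ v w 0 2 := by
  simp only [mergeRight, tauP, tauIJ, linForm, map_neg, map_sum, map_mul, MvPolynomial.aeval_X,
    MvPolynomial.algHom_C, MvPolynomial.algebraMap_eq]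
  simp only [Matrix.cons_val_zero, Matrix.cons_val_one, Matrix.cons_val_fin_one, mul_add,
    Finset.sum_add_distrib]
  ring

theorem liftLeft_tauP (v w : Fin 2 → Fin 4 → ℂ) : liftLeft (tauP v w) = tauIJ v w 0 1 := by
  simp only [liftLeft, tauP, tauIJ, linForm, map_neg, map_sum, map_mul, MvPolynomial.rename_X,
    MvPolynomial.rename_C]
  rfl

theorem liftRight_tauP (v w : Fin 2 → Fin 4 → ℂ) : liftRight (tauP v w) = tauIJ v w 1 2 := by
  simp only [liftRight, tauP, tauIJ, linForm, map_neg, map_sum, map_mul, MvPolynomial.rename_X,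
    MvPolynomial.rename_C]
  rfl

/-- Both sides have the symbol (τ₀₁ + τ₀₂ + τ₁₂)^n / n!: by bilinearity of τ each sum is a
convolution of divided powers, and only the grouping of the three terms differs. -/
theorem mop_starSym_assoc (v w : Fin 2 → Fin 4 → ℂ) {F G H : Phase → ℂ} (hF : ContDiff ℝ ∞ F)
    (hG : ContDiff ℝ ∞ G) (hH : ContDiff ℝ ∞ H) (x : Phase) (n : ℕ) :
    ∑ a ∈ Finset.HasAntidiagonal.antidiagonal n,
        mop ![fun y => mop ![F, G] y (starSym v w a.2), H] x (starSym v w a.1)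
      = ∑ a ∈ Finset.HasAntidiagonal.antidiagonal n,
        mop ![F, fun y => mop ![G, H] y (starSym v w a.2)] x (starSym v w a.1) := by
  have h1 := sum_antidiagonal_divided_pow (tauIJ v w 0 2 + tauIJ v w 1 2) (tauIJ v w 0 1) n
  have h2 := sum_antidiagonal_divided_pow (tauIJ v w 0 1 + tauIJ v w 0 2) (tauIJ v w 1 2) n
  simp_rw [mop_mop_left hF hG hH, mop_mop_right hF hG hH]
  rw [← map_sum, ← map_sum]
  refine congrArg (mop ![F, G, H] x) ?_
  have e1 : ∀ j, mergeLeft (starSym v w j) = MvPolynomial.C (1 / (j.factorial : ℂ))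
      * (tauIJ v w 0 2 + tauIJ v w 1 2) ^ j := by
    intro j
    rw [starSym, mergeLeft_mul, mergeLeft_C, ← mergeLeft_tauP]
    congr 1
    exact map_pow _ _ _
  have e2 : ∀ j, mergeRight (starSym v w j) = MvPolynomial.C (1 / (j.factorial : ℂ))
      * (tauIJ v w 0 1 + tauIJ v w 0 2) ^ j := by
    intro j
    rw [starSym, mergeRight_mul, mergeRight_C, ← mergeRight_tauP]
    congr 1
    exact map_pow _ _ _
  have e3 : ∀ j, liftLeft (starSym v w j) = MvPolynomial.C (1 / (j.factorial : ℂ))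
      * tauIJ v w 0 1 ^ j := by
    intro j
    rw [← liftLeft_tauP, starSym, liftLeft_mul]
    congr 1
    · exact MvPolynomial.rename_C _ _
    · exact map_pow _ _ _
  have e4 : ∀ j, liftRight (starSym v w j) = MvPolynomial.C (1 / (j.factorial : ℂ))
      * tauIJ v w 1 2 ^ j := by
    intro j
    rw [← liftRight_tauP, starSym, liftRight_mul]
    congr 1
    · exact MvPolynomial.rename_C _ _
    · exact map_pow _ _ _
  simp_rw [e1, e2, e3, e4]
  simp only [MvPolynomial.algebraMap_eq] at h1 h2
  rw [h1, h2]
  ring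

/-! ### Coordinates -/

/-- The inverse coordinate map in terms of `B, T, S`. -/
def iotaR (B T S : ℝ) : C2 →ₗ[ℝ] Phase where
  toFun z := (![√2 * S * (z 0).re, (√2 * S * (z 1).re + T * (√2 / S * (z 0).im)) / (1 - B * T)],
    ![-(√2 / S * (z 0).im + B * (√2 * S * (z 1).re)) / (1 - B * T), -(√2 / S * (z 1).im)])
  map_add' z w := by
    refine Prod.ext (funext fun k => ?_) (funext fun k => ?_) <;> fin_cases k <;> simp <;> ring
  map_smul' c z := by
    refine Prod.ext (funext fun k => ?_) (funext fun k => ?_) <;> fin_cases k <;> simp <;> ring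

theorem sqrt_two_mul_div {ħ s : ℝ} (hħ : 0 < ħ) : s / √(2 * ħ) * 2 = √2 * (s / √ħ) := by
  rw [Real.sqrt_mul (by norm_num)]
  have h2 : √2 * √2 = (2 : ℝ) := Real.mul_self_sqrt (by norm_num)
  have h0 : √2 ≠ (0 : ℝ) := by positivity
  have h1 : √ħ ≠ 0 := by positivity
  field_simp
  grind

theorem sqrt_half_div {ħ s : ℝ} (hħ : 0 < ħ) (hs : 0 < s) :
    √(ħ / 2) / s * 2 = √2 / (s / √ħ) := by
  rw [Real.sqrt_div hħ.le]
  have h2 : √2 * √2 = (2 : ℝ) := Real.mul_self_sqrt (by norm_num)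
  have h0 : √2 ≠ (0 : ℝ) := by positivity
  have h1 : √ħ ≠ 0 := by positivity
  field_simp
  nlinarith

theorem one_sub_ne_zero {ħ ϑ 𝓑 : ℝ} (hħ : 0 < ħ) (h : ħ ^ 2 - 𝓑 * ϑ ≠ 0) :
    1 - 𝓑 / ħ * (ϑ / ħ) ≠ 0 := by
  intro h0
  apply h
  field_simp at h0
  linarith

/-- All powers of ħ combine into 𝓑/ħ, ϑ/ħ and s/√ħ. The right side is moreover a linear map, which
makes the derivatives in z constant vector fields. -/
theorem iota_eq {ħ ϑ 𝓑 s : ℝ} (hħ : 0 < ħ) (hs : 0 < s) (h : ħ ^ 2 - 𝓑 * ϑ ≠ 0) :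
    iota ħ ϑ 𝓑 s = iotaR (𝓑 / ħ) (ϑ / ħ) (s / √ħ) := by
  have h' := one_sub_ne_zero hħ h
  have e1 : ∀ t, s / √(2 * ħ) * (2 * t) = √2 * (s / √ħ) * t := fun t => by
    rw [← sqrt_two_mul_div hħ]; ring
  have e2 : ∀ t, √(ħ / 2) / s * (2 * t) = √2 / (s / √ħ) * t := fun t => by
    rw [← sqrt_half_div hħ hs]; ring
  have e3 : ∀ a b : ℝ, (ħ ^ 2 * a - ħ * ϑ * b) / (ħ ^ 2 - 𝓑 * ϑ)
      = (a - ϑ / ħ * b) / (1 - 𝓑 / ħ * (ϑ / ħ)) := by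
    intro a b
    rw [div_eq_div_iff h h']
    field_simp
  have e4 : ∀ a b : ℝ, (ħ ^ 2 * a - ħ * 𝓑 * b) / (ħ ^ 2 - 𝓑 * ϑ)
      = (a - 𝓑 / ħ * b) / (1 - 𝓑 / ħ * (ϑ / ħ)) := by
    intro a b
    rw [div_eq_div_iff h h']
    field_simp
  funext z
  simp only [iota, e1, e2, e3, e4, iotaR, LinearMap.coe_mk, AddHom.coe_mk]
  refine Prod.ext (funext fun k => ?_) (funext fun k => ?_) <;> fin_cases k <;> (simp; try ring)

theorem leftInverse_iota {ħ ϑ 𝓑 s : ℝ} (hħ : 0 < ħ) (hs : 0 < s) (h : ħ ^ 2 - 𝓑 * ϑ ≠ 0) :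
    Function.LeftInverse (iota ħ ϑ 𝓑 s) (zNC ħ ϑ 𝓑 s) := by
  intro x
  have h2 : √2 * √2 = (2 : ℝ) := Real.mul_self_sqrt (by norm_num)
  have h0 : √2 ≠ (0 : ℝ) := by positivity
  have h1 : √ħ ≠ 0 := by positivity
  have h3 : √ħ * √ħ = ħ := Real.mul_self_sqrt hħ.le
  have h4 : ħ ^ 2 - ϑ * 𝓑 ≠ 0 := by rwa [mul_comm ϑ]
  have e1 : ∀ t, s / √(2 * ħ) * (2 * (√(ħ / 2) * t / s)) = t := fun t => by
    rw [Real.sqrt_div hħ.le, Real.sqrt_mul (by norm_num)]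
    field_simp
    grind
  have e2 : ∀ t, √(ħ / 2) / s * (2 * -(s * t / √(2 * ħ))) = -t := fun t => by
    rw [Real.sqrt_div hħ.le, Real.sqrt_mul (by norm_num)]
    field_simp
    grind
  have er : ∀ k, (zNC ħ ϑ 𝓑 s x k).re = √(ħ / 2) * qNC ħ ϑ x k / s := fun k => by
    simp only [zNC, sub_re, ofReal_re, I_re, mul_re, I_im, ofReal_im]
    ring
  have ei : ∀ k, (zNC ħ ϑ 𝓑 s x k).im = -(s * pNC ħ 𝓑 x k / √(2 * ħ)) := fun k => by
    simp only [zNC, sub_im, ofReal_re, I_re, mul_im, I_im, ofReal_im]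
    ring
  simp only [iota, er, ei, e1, e2, neg_neg]
  refine Prod.ext (funext fun k => ?_) (funext fun k => ?_) <;> fin_cases k <;>
    simp [qNC, pNC] <;> field_simp <;> ring

theorem rightInverse_iota {ħ ϑ 𝓑 s : ℝ} (hħ : 0 < ħ) (hs : 0 < s) (h : ħ ^ 2 - 𝓑 * ϑ ≠ 0) :
    Function.RightInverse (iota ħ ϑ 𝓑 s) (zNC ħ ϑ 𝓑 s) := by
  intro z
  have h2 : √2 * √2 = (2 : ℝ) := Real.mul_self_sqrt (by norm_num)
  have h0 : √2 ≠ (0 : ℝ) := by positivity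
  have h1 : √ħ ≠ 0 := by positivity
  have h3 : √ħ * √ħ = ħ := Real.mul_self_sqrt hħ.le
  have h4 : ħ ^ 2 - ϑ * 𝓑 ≠ 0 := by rwa [mul_comm ϑ]
  have e1 : ∀ t, √(ħ / 2) * (s / √(2 * ħ) * (2 * t)) / s = t := fun t => by
    rw [Real.sqrt_div hħ.le, Real.sqrt_mul (by norm_num)]
    field_simp
    grind
  have e2 : ∀ t, s * (-(√(ħ / 2) / s * (2 * t))) / √(2 * ħ) = -t := fun t => by
    rw [Real.sqrt_div hħ.le, Real.sqrt_mul (by norm_num)]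
    field_simp
    grind
  have eq : ∀ k, qNC ħ ϑ (iota ħ ϑ 𝓑 s z) k = s / √(2 * ħ) * (2 * (z k).re) := fun k => by
    fin_cases k
    · simp [qNC, iota]
    · simp [qNC, iota]
      field_simp
      ring
  have ep : ∀ k, pNC ħ 𝓑 (iota ħ ϑ 𝓑 s z) k = -(√(ħ / 2) / s * (2 * (z k).im)) := fun k => by
    fin_cases k
    · simp [pNC, iota]
      field_simp
      ring
    · simp [pNC, iota]
  funext k
  simp only [zNC, eq, ep, e1, e2]
  apply Complex.ext <;> simp

end

end NCToeplitz

namespace NCToeplitz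

noncomputable section

/-! ### The coefficients `𝒞_j` as operators with polynomial symbols -/

/-- The coefficients of `∂/∂z_k` in the coordinates `p₁, p₂, q₁, q₂`. -/
def vv (B T S : ℝ) : Fin 2 → Fin 4 → ℂ :=
  ![![(√2 / 2 : ℝ) * I / S / (1 - B * T), 0, (√2 / 2 : ℝ) * S,
      -((√2 / 2 : ℝ) * I * T) / S / (1 - B * T)],
    ![-((√2 / 2 : ℝ) * S * B) / (1 - B * T), (√2 / 2 : ℝ) * I / S, 0,
      (√2 / 2 : ℝ) * S / (1 - B * T)]]

/-- The coefficients of `∂/∂z̄_k` in the coordinates `p₁, p₂, q₁, q₂`. -/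
def ww (B T S : ℝ) : Fin 2 → Fin 4 → ℂ :=
  ![![-((√2 / 2 : ℝ) * I) / S / (1 - B * T), 0, (√2 / 2 : ℝ) * S,
      (√2 / 2 : ℝ) * I * T / S / (1 - B * T)],
    ![-((√2 / 2 : ℝ) * S * B) / (1 - B * T), -((√2 / 2 : ℝ) * I) / S, 0,
      (√2 / 2 : ℝ) * S / (1 - B * T)]]

/-- Needed only for the norms: one bound then serves for both factors of τ. -/
theorem ww_eq_conj (B T S : ℝ) (k : Fin 2) (i : Fin 4) : ww B T S k i = conj (vv B T S k i) := by
  fin_cases k <;> fin_cases i <;> simp [vv, ww, map_ofNat]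

theorem fderiv_comp_iotaR {F : Phase → ℂ} (hF : ContDiff ℝ ∞ F) (B T S : ℝ) (z e : C2) :
    fderiv ℝ (F ∘ iotaR B T S) z e = fderiv ℝ F (iotaR B T S z) (iotaR B T S e) := by
  have h := (hF.differentiable (by simp) (iotaR B T S z)).hasFDerivAt.comp z
    ((iotaR B T S).toContinuousLinearMap.hasFDerivAt (x := z))
  have h2 := h.fderiv
  have h3 : fderiv ℝ (F ∘ iotaR B T S) z
      = (fderiv ℝ F (iotaR B T S z)).comp (iotaR B T S).toContinuousLinearMap := h2
  rw [h3]
  rfl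

theorem fderiv_eq_sum (F : Phase → ℂ) (x e : Phase) :
    fderiv ℝ F x e = e.2 0 * pd 0 F x + e.2 1 * pd 1 F x + e.1 0 * pd 2 F x + e.1 1 * pd 3 F x := by
  have he : e = e.2 0 • bvec 0 + e.2 1 • bvec 1 + e.1 0 • bvec 2 + e.1 1 • bvec 3 := by
    refine Prod.ext (funext fun k => ?_) (funext fun k => ?_) <;> fin_cases k <;> simp [bvec]
  conv_lhs => rw [he]
  simp only [map_add, map_smul, real_smul]
  rfl

theorem dz_comp_iotaR {F : Phase → ℂ} (hF : ContDiff ℝ ∞ F) (B T S : ℝ) (k : Fin 2) :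
    dz k (F ∘ iotaR B T S) = dir (vv B T S k) F ∘ iotaR B T S := by
  funext z
  simp only [dz, fderiv_comp_iotaR hF, fderiv_eq_sum F (iotaR B T S z), dir, Fin.sum_univ_four,
    Function.comp_apply]
  -- With the derivatives as indeterminates, the claim is a comparison of the coefficients of ι with
  -- the entries of `vv`.
  generalize pd 0 F (iotaR B T S z) = a0
  generalize pd 1 F (iotaR B T S z) = a1
  generalize pd 2 F (iotaR B T S z) = a2
  generalize pd 3 F (iotaR B T S z) = a3
  fin_cases k <;> simp [iotaR, vv] <;> ring

theorem dzbar_comp_iotaR {F : Phase → ℂ} (hF : ContDiff ℝ ∞ F) (B T S : ℝ) (k : Fin 2) :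
    dzbar k (F ∘ iotaR B T S) = dir (ww B T S k) F ∘ iotaR B T S := by
  funext z
  simp only [dzbar, fderiv_comp_iotaR hF, fderiv_eq_sum F (iotaR B T S z), dir, Fin.sum_univ_four,
    Function.comp_apply]
  generalize pd 0 F (iotaR B T S z) = a0
  generalize pd 1 F (iotaR B T S z) = a1
  generalize pd 2 F (iotaR B T S z) = a2
  generalize pd 3 F (iotaR B T S z) = a3
  fin_cases k <;> simp [iotaR, ww] <;> ring

theorem dz_iterate_comp_iotaR {F : Phase → ℂ} (hF : ContDiff ℝ ∞ F) (B T S : ℝ) (k : Fin 2)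
    (n : ℕ) :
    (dz k)^[n] (F ∘ iotaR B T S) = (dir (vv B T S k))^[n] F ∘ iotaR B T S := by
  induction n generalizing F with
  | zero => rfl
  | succ n ih => rw [Function.iterate_succ_apply, dz_comp_iotaR hF, ih (contDiff_dir hF _),
      Function.iterate_succ_apply]

theorem dzbar_iterate_comp_iotaR {F : Phase → ℂ} (hF : ContDiff ℝ ∞ F) (B T S : ℝ) (k : Fin 2)
    (n : ℕ) :
    (dzbar k)^[n] (F ∘ iotaR B T S) = (dir (ww B T S k))^[n] F ∘ iotaR B T S := by
  induction n generalizing F with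
  | zero => rfl
  | succ n ih => rw [Function.iterate_succ_apply, dzbar_comp_iotaR hF, ih (contDiff_dir hF _),
      Function.iterate_succ_apply]

theorem mop_linForm_zero_pow_mul {F G : Phase → ℂ} (hF : ContDiff ℝ ∞ F) (hG : ContDiff ℝ ∞ G)
    (x : Phase) (v : Fin 4 → ℂ) (n : ℕ) (p : MvPolynomial (Fin 2 × Fin 4) ℂ) :
    mop ![F, G] x (linForm 0 v ^ n * p) = mop ![(dir v)^[n] F, G] x p := by
  induction n generalizing F with
  | zero => simp
  | succ n ih =>
    rw [pow_succ', mul_assoc, mop_linForm_mul (contDiff_pair hF hG), update_pair_zero]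
    exact ih (contDiff_dir hF v)

theorem mop_linForm_one_pow_mul {F G : Phase → ℂ} (hF : ContDiff ℝ ∞ F) (hG : ContDiff ℝ ∞ G)
    (x : Phase) (v : Fin 4 → ℂ) (n : ℕ) (p : MvPolynomial (Fin 2 × Fin 4) ℂ) :
    mop ![F, G] x (linForm 1 v ^ n * p) = mop ![F, (dir v)^[n] G] x p := by
  induction n generalizing G with
  | zero => simp
  | succ n ih =>
    rw [pow_succ', mul_assoc, mop_linForm_mul (contDiff_pair hF hG), update_pair_one]
    exact ih (contDiff_dir hG v)

/-- The binomial theorem for τ = -(v₀w₀ + v₁w₁): the factor 1/α! comes from the divided powers of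
the two summands, the sign from τ^j. -/
theorem sum_dir_eq_mop {F G : Phase → ℂ} (hF : ContDiff ℝ ∞ F) (hG : ContDiff ℝ ∞ G) (x : Phase)
    (v w : Fin 2 → Fin 4 → ℂ) (j : ℕ) :
    (-1) ^ j * ∑ α ∈ Finset.HasAntidiagonal.antidiagonal j,
      1 / ((α.1.factorial : ℂ) * (α.2.factorial : ℂ))
        * ((dir (v 0))^[α.1] ((dir (v 1))^[α.2] F) x * (dir (w 0))^[α.1] ((dir (w 1))^[α.2] G) x)
      = mop ![F, G] x (starSym v w j) := by
  have h1 : starSym v w j = MvPolynomial.C ((-1) ^ j) * (MvPolynomial.C (1 / (j.factorial : ℂ)) *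
      (linForm 0 (v 0) * linForm 1 (w 0) + linForm 0 (v 1) * linForm 1 (w 1)) ^ j) := by
    rw [starSym, tauP, Fin.sum_univ_two, neg_pow, map_pow, map_neg, MvPolynomial.C_1]
    ring
  have h2 := sum_antidiagonal_divided_pow (linForm 0 (v 0) * linForm (1 : Fin 2) (w 0))
    (linForm 0 (v 1) * linForm 1 (w 1)) j
  simp only [MvPolynomial.algebraMap_eq] at h2
  rw [h1, ← h2, mop_C_mul, map_sum]
  congr 1
  refine Finset.sum_congr rfl fun a _ => ?_
  -- The factors are ordered as they will be peeled off: the first one acts first and so becomes the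
  -- innermost operator, as in the definition of `flatCoeff`.
  have h3 : MvPolynomial.C (1 / (a.1.factorial : ℂ))
        * (linForm 0 (v 0) * linForm (1 : Fin 2) (w 0)) ^ a.1
      * (MvPolynomial.C (1 / (a.2.factorial : ℂ)) * (linForm 0 (v 1) * linForm 1 (w 1)) ^ a.2)
      = MvPolynomial.C (1 / ((a.1.factorial : ℂ) * (a.2.factorial : ℂ)))
        * (linForm 0 (v 1) ^ a.2 * (linForm 0 (v 0) ^ a.1 * (linForm 1 (w 1) ^ a.2
          * (linForm 1 (w 0) ^ a.1 * 1)))) := by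
    rw [show 1 / ((a.1.factorial : ℂ) * (a.2.factorial : ℂ))
      = 1 / (a.1.factorial : ℂ) * (1 / (a.2.factorial : ℂ)) by ring, map_mul]
    ring
  have hF' := contDiff_dir_iterate hF (v 1) a.2
  have hF'' := contDiff_dir_iterate hF' (v 0) a.1
  rw [h3, mop_C_mul, mop_linForm_zero_pow_mul hF hG, mop_linForm_zero_pow_mul hF' hG,
    mop_linForm_one_pow_mul hF'' hG, mop_linForm_one_pow_mul hF'' (contDiff_dir_iterate hG _ _),
    mop_one, Fin.prod_univ_two]
  rfl

/-- The symbol of `𝒞_j` in terms of `B, T, S`. -/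
def cSym (B T S : ℝ) (j : ℕ) : MvPolynomial (Fin 2 × Fin 4) ℂ :=
  starSym (vv B T S) (ww B T S) j

/-- Iterated derivatives of F ∘ ι in z and z̄ are derivatives of F along constant vectors, composed
with ι, and ι undoes the coordinate map at the end. From here on 𝒞_j enters only through its symbol
τ^j/j!. -/
theorem starCoeff_eq_mop {ħ ϑ 𝓑 s : ℝ} (hħ : 0 < ħ) (hs : 0 < s) (h : ħ ^ 2 - 𝓑 * ϑ ≠ 0) (j : ℕ)
    {F G : Phase → ℂ} (hF : ContDiff ℝ ∞ F) (hG : ContDiff ℝ ∞ G) (x : Phase) :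
    starCoeff ħ ϑ 𝓑 s j F G x = mop ![F, G] x (cSym (𝓑 / ħ) (ϑ / ħ) (s / √ħ) j) := by
  have hx : iotaR (𝓑 / ħ) (ϑ / ħ) (s / √ħ) (zNC ħ ϑ 𝓑 s x) = x := by
    rw [← iota_eq hħ hs h]
    exact leftInverse_iota hħ hs h x
  unfold starCoeff flatCoeff cSym
  rw [Function.comp_apply, iota_eq hħ hs h, ← sum_dir_eq_mop hF hG]
  congr 1
  refine Finset.sum_congr rfl fun a _ => ?_
  rw [dz_iterate_comp_iotaR hF, dz_iterate_comp_iotaR (contDiff_dir_iterate hF _ _),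
    dzbar_iterate_comp_iotaR hG, dzbar_iterate_comp_iotaR (contDiff_dir_iterate hG _ _),
    Function.comp_apply, Function.comp_apply, hx]

theorem mop_cSym_eq_bidiff (B T S : ℝ) (j : ℕ) (F G : Phase → ℂ) (x : Phase) :
    mop ![F, G] x (cSym B T S j)
      = bidiff j (fun μ ν => (cSym B T S j).coeff (pairIdx μ ν)) F G x :=
  mop_eq_bidiff (starSym_isWeightedHomogeneous _ _ j) F G x

/-! ### Stability of test symbols under differential operators -/

theorem isSymbol_pd {F : Phase → ℂ} (hF : IsSymbol F) (k : Fin 4) : IsSymbol (pd k F) :=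
  ⟨contDiff_pd hF.1 k, hF.2.fderiv_apply (𝕜 := ℝ) (bvec k)⟩

theorem isSymbol_pd_iterate {F : Phase → ℂ} (hF : IsSymbol F) (k : Fin 4) (n : ℕ) :
    IsSymbol ((pd k)^[n] F) := by
  induction n generalizing F with
  | zero => exact hF
  | succ n ih => exact ih (isSymbol_pd hF k)

theorem isSymbol_partialD {F : Phase → ℂ} (hF : IsSymbol F) (μ : Fin 4 → ℕ) :
    IsSymbol (partialD μ F) := by
  rw [partialD_eq]
  exact isSymbol_pd_iterate (isSymbol_pd_iterate (isSymbol_pd_iterate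
    (isSymbol_pd_iterate hF _ _) _ _) _ _) _ _

theorem isSymbol_sum {κ : Type*} (s : Finset κ) {F : κ → Phase → ℂ} (hF : ∀ i ∈ s, IsSymbol (F i)) :
    IsSymbol (fun x => ∑ i ∈ s, F i x) := by
  classical
  refine ⟨ContDiff.sum fun i hi => (hF i hi).1, ?_⟩
  induction s using Finset.induction_on with
  | empty => simpa using! (HasCompactSupport.zero (α := Phase) (β := ℂ))
  | insert a s ha ih =>
    simp_rw [Finset.sum_insert ha]
    exact (hF a (by simp)).2.add (ih fun i hi => hF i (Finset.mem_insert_of_mem hi))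

theorem isSymbol_const_mul {F : Phase → ℂ} (hF : IsSymbol F) (c : ℂ) :
    IsSymbol (fun x => c * F x) :=
  ⟨contDiff_const.mul hF.1, hF.2.mul_left⟩

theorem isSymbol_bidiff {F G : Phase → ℂ} (hF : IsSymbol F) (hG : IsSymbol G) (j : ℕ)
    (c : (Fin 4 → ℕ) → (Fin 4 → ℕ) → ℂ) : IsSymbol (bidiff j c F G) := by
  refine isSymbol_sum _ fun μ _ => isSymbol_sum _ fun ν _ => ?_
  exact ⟨(contDiff_const.mul (isSymbol_partialD hF μ).1).mul (isSymbol_partialD hG ν).1,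
    (isSymbol_partialD hG ν).2.mul_left⟩

theorem isSymbol_mop_cSym {F G : Phase → ℂ} (hF : IsSymbol F) (hG : IsSymbol G) (B T S : ℝ)
    (j : ℕ) : IsSymbol (fun x => mop ![F, G] x (cSym B T S j)) := by
  simp_rw [mop_cSym_eq_bidiff]
  exact isSymbol_bidiff hF hG _ _

theorem isSymbol_starCoeff {ħ ϑ 𝓑 s : ℝ} (hħ : 0 < ħ) (hs : 0 < s) (h : ħ ^ 2 - 𝓑 * ϑ ≠ 0) (j : ℕ)
    {F G : Phase → ℂ} (hF : IsSymbol F) (hG : IsSymbol G) :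
    IsSymbol (starCoeff ħ ϑ 𝓑 s j F G) := by
  rw [show starCoeff ħ ϑ 𝓑 s j F G = _ from
    funext fun x => starCoeff_eq_mop hħ hs h j hF.1 hG.1 x]
  exact isSymbol_mop_cSym hF hG _ _ _ j

/-! ### The axioms of a star product and the first coefficient -/

theorem pd_one (k : Fin 4) : pd k 1 = 0 := by
  funext x
  change fderiv ℝ (fun _ => (1 : ℂ)) x (bvec k) = 0
  simp

theorem dir_one (v : Fin 4 → ℂ) : dir v 1 = 0 := by
  funext x
  simp [dir, pd_one]

theorem dir_zero (v : Fin 4 → ℂ) : dir v 0 = 0 := by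
  funext x
  have : ∀ k, pd k 0 x = 0 := fun k => by
    change fderiv ℝ (fun _ => (0 : ℂ)) x (bvec k) = 0
    simp
  simp [dir, this]

theorem dir_iterate_iterate_one (v w : Fin 4 → ℂ) {a b : ℕ} (h : 0 < a + b) :
    (dir v)^[a] ((dir w)^[b] 1) = 0 := by
  have h0 : ∀ (u : Fin 4 → ℂ) (n : ℕ), (dir u)^[n] 0 = 0 := fun u n =>
    Function.iterate_fixed (dir_zero u) n
  cases b with
  | zero =>
    obtain ⟨a, rfl⟩ : ∃ n, a = n + 1 := ⟨a - 1, by omega⟩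
    rw [Function.iterate_zero_apply, Function.iterate_succ_apply, dir_one, h0]
  | succ b => rw [Function.iterate_succ_apply, dir_one, h0, h0]

theorem isStarProduct_starCoeff {ħ ϑ 𝓑 s : ℝ} (hħ : 0 < ħ) (hs : 0 < s) (h : ħ ^ 2 - 𝓑 * ϑ ≠ 0) :
    IsStarProduct (starCoeff ħ ϑ 𝓑 s) where
  bidifferential j := by
    classical
    -- A bidifferential operator sums over all orders up to m, so with m = j the constant
    -- coefficients are cut off outside bidegree (j, j). The other blocks vanish because a
    -- multiindex has only one length.
    refine ⟨j, fun μ ν _ => if μ ∈ multiIdx j ∧ ν ∈ multiIdx j then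
      (cSym (𝓑 / ħ) (ϑ / ħ) (s / √ħ) j).coeff (pairIdx μ ν) else 0,
      fun _ _ => contDiff_const, fun F G hF hG x => ?_⟩
    rw [starCoeff_eq_mop hħ hs h j hF hG, mop_cSym_eq_bidiff, bidiff]
    have hne : ∀ i ∈ Finset.range (j + 1), i ≠ j → ∀ μ ∈ multiIdx i, μ ∉ multiIdx j := by
      intro i _ hij μ hμ hμ'
      rw [mem_multiIdx] at hμ hμ'
      exact hij (hμ.symm.trans hμ')
    rw [Finset.sum_eq_single j]
    · refine Finset.sum_congr rfl fun μ hμ => ?_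
      rw [Finset.sum_eq_single j]
      · refine Finset.sum_congr rfl fun ν hν => ?_
        simp only [if_pos (And.intro hμ hν)]
      · intro i hi hij
        refine Finset.sum_eq_zero fun ν hν => ?_
        simp [hne i hi hij ν hν]
      · intro hj
        exact absurd (Finset.self_mem_range_succ j) hj
    · intro i hi hij
      refine Finset.sum_eq_zero fun μ hμ => Finset.sum_eq_zero fun i' _ =>
        Finset.sum_eq_zero fun ν _ => ?_
      simp [hne i hi hij μ hμ]
    · intro hj
      exact absurd (Finset.self_mem_range_succ j) hj
  zero F G hF hG := by
    funext x
    rw [starCoeff_eq_mop hħ hs h 0 hF hG, cSym, starSym, pow_zero, mul_one, mop_C]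
    simp
  one_left j hj G hG := by
    funext x
    have h1 : ContDiff ℝ ∞ (1 : Phase → ℂ) := contDiff_const
    rw [starCoeff_eq_mop hħ hs h j h1 hG, cSym, ← sum_dir_eq_mop h1 hG]
    rw [Finset.sum_eq_zero, mul_zero]
    · rfl
    intro a ha
    rw [dir_iterate_iterate_one]
    · simp
    · rwa [Finset.HasAntidiagonal.mem_antidiagonal.1 ha]
  one_right j hj F hF := by
    funext x
    have h1 : ContDiff ℝ ∞ (1 : Phase → ℂ) := contDiff_const
    rw [starCoeff_eq_mop hħ hs h j hF h1, cSym, ← sum_dir_eq_mop hF h1]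
    rw [Finset.sum_eq_zero, mul_zero]
    · rfl
    intro a ha
    rw [dir_iterate_iterate_one]
    · simp
    · rwa [Finset.HasAntidiagonal.mem_antidiagonal.1 ha]
  assoc F G H hF hG hH n := by
    have hc : ∀ j {F G : Phase → ℂ}, ContDiff ℝ ∞ F → ContDiff ℝ ∞ G → starCoeff ħ ϑ 𝓑 s j F G
        = fun x => mop ![F, G] x (cSym (𝓑 / ħ) (ϑ / ħ) (s / √ħ) j) := fun j F G hF hG =>
      funext fun x => starCoeff_eq_mop hħ hs h j hF hG x
    have hm : ∀ j {F G : Phase → ℂ}, ContDiff ℝ ∞ F → ContDiff ℝ ∞ G →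
        ContDiff ℝ ∞ (fun x => mop ![F, G] x (cSym (𝓑 / ħ) (ϑ / ħ) (s / √ħ) j)) :=
      fun j F G hF hG => contDiff_mop (contDiff_pair hF hG) _
    funext x
    rw [Finset.sum_apply, Finset.sum_apply]
    simp_rw [hc _ hF hG, hc _ hG hH, hc _ (hm _ hF hG) hH, hc _ hF (hm _ hG hH)]
    exact mop_starSym_assoc _ _ hF hG hH x n

theorem mop_cSym_zero (B T S : ℝ) (F G : Phase → ℂ) (x : Phase) :
    mop ![F, G] x (cSym B T S 0) = F x * G x := by
  rw [cSym, starSym, pow_zero, mul_one, mop_C]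
  simp

/-- Only α = (1,0) and α = (0,1) contribute, and the claim is a bilinear identity in the first
derivatives of F and G, valid modulo (√2)² = 2 and I² = -1. -/
theorem mop_cSym_one {B T S : ℝ} (hS : S ≠ 0) (h : 1 - B * T ≠ 0)
    {F G : Phase → ℂ} (hF : ContDiff ℝ ∞ F) (hG : ContDiff ℝ ∞ G) (x : Phase) :
    mop ![F, G] x (cSym B T S 1)
      = dotProduct (grad F x) (Matrix.mulVec (matRen B T S) (grad G x)) := by
  have hS' : (S : ℂ) ≠ 0 := by exact_mod_cast hS
  have h' : 1 - (B : ℂ) * T ≠ 0 := by exact_mod_cast h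
  have h2 : (√2 : ℂ) ^ 2 = 2 := by
    exact_mod_cast Real.sq_sqrt (show (0 : ℝ) ≤ 2 by norm_num)
  have hI : I ^ 2 = -1 := I_sq
  rw [cSym, ← sum_dir_eq_mop hF hG]
  simp only [Finset.Nat.antidiagonal_succ, Finset.Nat.antidiagonal_zero, Finset.map_singleton,
    Finset.sum_cons, Finset.sum_singleton, Function.Embedding.coe_prodMap,
    Function.Embedding.coeFn_mk, Function.Embedding.refl_apply, Prod.map, Function.iterate_zero_apply,
    Nat.factorial, Function.iterate_succ_apply, dir, Fin.sum_univ_four]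
  simp only [grad, dP_zero_eq_pd, dP_one_eq_pd, dQ_zero_eq_pd, dQ_one_eq_pd, matRen,
    Matrix.mulVec, dotProduct, Fin.sum_univ_four, vv, ww]
  generalize pd 0 F x = a0
  generalize pd 1 F x = a1
  generalize pd 2 F x = a2
  generalize pd 3 F x = a3
  generalize pd 0 G x = b0
  generalize pd 1 G x = b1
  generalize pd 2 G x = b2
  generalize pd 3 G x = b3
  simp
  field_simp
  grind

theorem matA_eq_matRen {ħ ϑ 𝓑 s : ℝ} (hħ : 0 < ħ) (hs : 0 < s) (h : ħ ^ 2 - 𝓑 * ϑ ≠ 0) :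
    matA ħ ϑ 𝓑 s = matRen (𝓑 / ħ : ℝ) (ϑ / ħ : ℝ) (s / √ħ : ℝ) := by
  have h1 : (√ħ : ℂ) ≠ 0 := by
    have : √ħ ≠ 0 := by positivity
    exact_mod_cast this
  have h2 : (ħ : ℂ) = (√ħ : ℂ) ^ 2 := by
    exact_mod_cast (Real.sq_sqrt hħ.le).symm
  have h0 : (ħ : ℂ) ≠ 0 := by exact_mod_cast hħ.ne'
  have hs' : (s : ℂ) ≠ 0 := by exact_mod_cast hs.ne'
  have h' : (ħ : ℂ) ^ 2 - 𝓑 * ϑ ≠ 0 := by exact_mod_cast h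
  have h3 : 1 - (𝓑 : ℂ) / ħ * (ϑ / ħ) = (ħ ^ 2 - 𝓑 * ϑ) / ħ ^ 2 := by
    field_simp
  have h4 : ((s : ℂ) / √ħ) ^ 2 = s ^ 2 / ħ := by rw [div_pow, ← h2]
  have h5 : ((s : ℂ) / √ħ) ^ 4 = s ^ 4 / ħ ^ 2 := by
    rw [show 4 = 2 * 2 from rfl, pow_mul, h4]; ring
  unfold matA matRen
  push_cast
  rw [h3, h4, h5]
  ext i j
  fin_cases i <;> fin_cases j <;> simp <;> field_simp <;> ring

end

end NCToeplitz

namespace NCToeplitz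

noncomputable section

/-! ### Dependence of the coefficients on `B` and `T` -/

theorem sq_sub_ne_zero {ħ B T : ℝ} (hħ : 0 < ħ) (h : B * T ≠ 1) :
    ħ ^ 2 - ħ * B * (ħ * T) ≠ 0 := by
  rw [show ħ ^ 2 - ħ * B * (ħ * T) = ħ ^ 2 * (1 - B * T) by ring]
  exact mul_ne_zero (by positivity) (sub_ne_zero.2 h.symm)

theorem renCoeff_eq_mop {ħ B T S : ℝ} (hħ : 0 < ħ) (hS : 0 < S) (h : B * T ≠ 1) (j : ℕ)
    {F G : Phase → ℂ} (hF : ContDiff ℝ ∞ F) (hG : ContDiff ℝ ∞ G) (x : Phase) :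
    renCoeff ħ B T S j F G x = mop ![F, G] x (cSym B T S j) := by
  have h1 : √ħ ≠ 0 := by positivity
  rw [renCoeff, starCoeff_eq_mop hħ (by positivity) (sq_sub_ne_zero hħ h) j hF hG,
    mul_div_cancel_left₀ _ hħ.ne', mul_div_cancel_left₀ _ hħ.ne', mul_div_cancel_left₀ _ h1]

section Poly

open MvPolynomial

/-- The polynomial entries of `(1 - BT) ∂/∂z_k` for `S = 1`. -/
def vPoly : Fin 2 → Fin 4 → MvPolynomial (Fin 2) ℂ :=
  ![![C ((√2 / 2 : ℝ) * I), 0, C ((√2 / 2 : ℝ) : ℂ) * (1 - X 0 * X 1),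
      -(C ((√2 / 2 : ℝ) * I) * X 1)],
    ![-(C ((√2 / 2 : ℝ) : ℂ) * X 0), C ((√2 / 2 : ℝ) * I) * (1 - X 0 * X 1), 0,
      C ((√2 / 2 : ℝ) : ℂ)]]

/-- The polynomial entries of `(1 - BT) ∂/∂z̄_k` for `S = 1`. -/
def wPoly : Fin 2 → Fin 4 → MvPolynomial (Fin 2) ℂ :=
  ![![-C ((√2 / 2 : ℝ) * I), 0, C ((√2 / 2 : ℝ) : ℂ) * (1 - X 0 * X 1),
      C ((√2 / 2 : ℝ) * I) * X 1],
    ![-(C ((√2 / 2 : ℝ) : ℂ) * X 0), -(C ((√2 / 2 : ℝ) * I) * (1 - X 0 * X 1)), 0,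
      C ((√2 / 2 : ℝ) : ℂ)]]

theorem eval_vPoly {B T : ℝ} (h : B * T ≠ 1) (k : Fin 2) (i : Fin 4) :
    eval ![(B : ℂ), (T : ℂ)] (vPoly k i) = (1 - B * T) * vv B T 1 k i := by
  have h' : 1 - (B : ℂ) * T ≠ 0 := by
    exact_mod_cast sub_ne_zero.2 h.symm
  have h'' : 1 - (T : ℂ) * B ≠ 0 := by rwa [mul_comm (T : ℂ)]
  fin_cases k <;> fin_cases i <;> simp [vPoly, vv] <;> field_simp

theorem eval_wPoly {B T : ℝ} (h : B * T ≠ 1) (k : Fin 2) (i : Fin 4) :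
    eval ![(B : ℂ), (T : ℂ)] (wPoly k i) = (1 - B * T) * ww B T 1 k i := by
  have h' : 1 - (B : ℂ) * T ≠ 0 := by
    exact_mod_cast sub_ne_zero.2 h.symm
  have h'' : 1 - (T : ℂ) * B ≠ 0 := by rwa [mul_comm (T : ℂ)]
  fin_cases k <;> fin_cases i <;> simp [wPoly, ww] <;> field_simp

/-- The numerators of the coefficients of `𝒞_j` for `S = 1`. -/
def coeffPoly (j : ℕ) (μ ν : Fin 4 → ℕ) : MvPolynomial (Fin 2) ℂ :=
  (C (C (1 / (j.factorial : ℂ))) * tauP vPoly wPoly ^ j).coeff (pairIdx μ ν)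

theorem map_tauP {R R' : Type*} [CommRing R] [CommRing R'] (f : R →+* R')
    (v w : Fin 2 → Fin 4 → R) :
    map f (tauP v w) = tauP (fun k i => f (v k i)) (fun k i => f (w k i)) := by
  simp [tauP, linForm]

/-- Clearing the denominator 1 - BT from both families of vectors costs (1 - BT)² in τ. This is
where the exponent 2j in the denominators of 𝒞_j comes from. -/
theorem tauP_smul {R : Type*} [CommRing R] (c : R) (v w : Fin 2 → Fin 4 → R) :
    tauP (fun k i => c * v k i) (fun k i => c * w k i) = C (c ^ 2) * tauP v w := by
  have h : ∀ (i : Fin 2) (u : Fin 4 → R), linForm i (fun k => c * u k) = C c * linForm i u := by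
    intro i u
    simp [linForm, Finset.mul_sum, mul_assoc]
  simp only [tauP, h]
  rw [mul_neg, Finset.mul_sum, map_pow]
  refine congrArg Neg.neg (Finset.sum_congr rfl fun k _ => ?_)
  ring

/-- The coefficients of `𝒞_j` for `S = 1`. -/
def cf (j : ℕ) (μ ν : Fin 4 → ℕ) (y : ℝ × ℝ) : ℂ :=
  eval ![(y.1 : ℂ), (y.2 : ℂ)] (coeffPoly j μ ν) / (1 - (y.1 : ℂ) * y.2) ^ (2 * j)

/-- The symbol is formed once over the ring of polynomials in B and T and then specialized;
evaluation commutes with the construction of τ, and `tauP_smul` restores the denominator. -/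
theorem coeff_cSym {B T : ℝ} (h : B * T ≠ 1) (j : ℕ) (μ ν : Fin 4 → ℕ) :
    (cSym B T 1 j).coeff (pairIdx μ ν) = cf j μ ν (B, T) := by
  have h' : 1 - (B : ℂ) * T ≠ 0 := by
    exact_mod_cast sub_ne_zero.2 h.symm
  have h1 : map (eval ![(B : ℂ), (T : ℂ)]) (C (C (1 / (j.factorial : ℂ))) * tauP vPoly wPoly ^ j)
      = C ((1 - (B : ℂ) * T) ^ (2 * j)) * cSym B T 1 j := by
    rw [map_mul, map_C, eval_C, map_pow, map_tauP]
    simp_rw [eval_vPoly h, eval_wPoly h]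
    rw [tauP_smul, cSym, starSym, mul_pow, ← map_pow, ← pow_mul]
    ring
  have h2 := congrArg (coeff (pairIdx μ ν)) h1
  rw [coeff_map, coeff_C_mul (pairIdx μ ν) ((1 - (B : ℂ) * T) ^ (2 * j))] at h2
  change eval _ (coeffPoly j μ ν) = _ at h2
  rw [cf, eq_div_iff (pow_ne_zero _ h'), h2, mul_comm]

theorem renCoeff_eq_bidiff {ħ B T : ℝ} (hħ : 0 < ħ) (h : B * T ≠ 1) (j : ℕ)
    {F G : Phase → ℂ} (hF : ContDiff ℝ ∞ F) (hG : ContDiff ℝ ∞ G) :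
    renCoeff ħ B T 1 j F G = bidiff j (fun μ ν => cf j μ ν (B, T)) F G := by
  funext x
  rw [renCoeff_eq_mop hħ one_pos h j hF hG, mop_cSym_eq_bidiff]
  simp_rw [coeff_cSym h]

/-- A quotient of polynomials whose denominator is 1 at the origin. -/
theorem analyticAt_cf (j : ℕ) (μ ν : Fin 4 → ℕ) : AnalyticAt ℝ (cf j μ ν) 0 := by
  have h1 : AnalyticAt ℝ (fun y : ℝ × ℝ => (y.1 : ℂ)) 0 :=
    (ofRealCLM.comp (ContinuousLinearMap.fst ℝ ℝ ℝ)).analyticAt 0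
  have h2 : AnalyticAt ℝ (fun y : ℝ × ℝ => (y.2 : ℂ)) 0 :=
    (ofRealCLM.comp (ContinuousLinearMap.snd ℝ ℝ ℝ)).analyticAt 0
  have h3 : AnalyticAt ℝ (fun y : ℝ × ℝ => aeval ![(y.1 : ℂ), (y.2 : ℂ)] (coeffPoly j μ ν)) 0 := by
    refine AnalyticAt.aeval_mvPolynomial (fun i => ?_) _
    fin_cases i
    exacts [h1, h2]
  refine AnalyticAt.div (f := fun y : ℝ × ℝ => eval ![(y.1 : ℂ), (y.2 : ℂ)] (coeffPoly j μ ν)) ?_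
    ((analyticAt_const.sub (h1.mul h2)).pow (2 * j)) (by simp)
  simpa [aeval_eq_eval] using h3

end Poly

/-! ### Taylor expansions in two real variables -/

/-- The terms of degree less than `n` of the formal power series with coefficients `c`. -/
def jet (c : ℕ → ℕ → ℂ) (n : ℕ) (y : ℝ × ℝ) : ℂ :=
  ∑ i ∈ Finset.range n, ∑ a ∈ Finset.HasAntidiagonal.antidiagonal i,
    (y.1 : ℂ) ^ a.1 * (y.2 : ℂ) ^ a.2 * c a.1 a.2

/-- `f` has the asymptotic expansion `c` at the origin. -/
def HasJet (f : ℝ × ℝ → ℂ) (c : ℕ → ℕ → ℂ) : Prop :=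
  ∀ n, (fun y => f y - jet c n y) =O[nhds 0] fun y => ‖y‖ ^ n

/-- The i-th term of the power series is a multilinear map evaluated at y = y₁e₁ + y₂e₂ in every
slot. Expanding over the set of slots that receive e₁, the sets with k elements together contribute
a constant times y₁^k y₂^(i-k). -/
theorem exists_hasJet {f : ℝ × ℝ → ℂ} (hf : AnalyticAt ℝ f 0) : ∃ c, HasJet f c := by
  obtain ⟨p, hp⟩ := hf
  let d : ℕ → ℕ → ℂ := fun i k => ∑ s ∈ Finset.powersetCard k (Finset.univ : Finset (Fin i)),
    p i (s.piecewise (fun _ => ((1 : ℝ), (0 : ℝ))) (fun _ => ((0 : ℝ), (1 : ℝ))))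
  refine ⟨fun k l => d (k + l) k, fun n => ?_⟩
  have h := hp.isBigO_sub_partialSum_pow n
  simp only [zero_add] at h
  refine h.congr_left fun y => ?_
  congr 1
  rw [FormalMultilinearSeries.partialSum, jet]
  refine Finset.sum_congr rfl fun i _ => ?_
  have hy : (fun _ : Fin i => y) = (fun _ => y.1 • ((1 : ℝ), (0 : ℝ)))
      + (fun _ => y.2 • ((0 : ℝ), (1 : ℝ))) := by
    funext _
    ext <;> simp
  rw [hy, ContinuousMultilinearMap.map_add_univ]
  rw [← Finset.powerset_univ, Finset.sum_powerset, Finset.card_univ, Fintype.card_fin,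
    Finset.Nat.sum_antidiagonal_eq_sum_range_succ_mk]
  refine Finset.sum_congr rfl fun k hk => ?_
  have hki : k + (i - k) = i := by
    have := Finset.mem_range.1 hk
    omega
  rw [hki, Finset.mul_sum]
  refine Finset.sum_congr rfl fun s hs => ?_
  have hs' := (Finset.mem_powersetCard.1 hs).2
  have e : s.piecewise (fun _ => y.1 • ((1 : ℝ), (0 : ℝ))) (fun _ => y.2 • ((0 : ℝ), (1 : ℝ)))
      = fun m => (s.piecewise (fun _ => y.1) (fun _ => y.2) : Fin i → ℝ) m
        • (s.piecewise (fun _ => ((1 : ℝ), (0 : ℝ))) (fun _ => ((0 : ℝ), (1 : ℝ))) :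
          Fin i → ℝ × ℝ) m := by
    funext m
    by_cases hm : m ∈ s <;> simp [hm]
  rw [e, ContinuousMultilinearMap.map_smul_univ, Finset.prod_piecewise, Finset.univ_inter,
    Finset.prod_const, Finset.prod_const, ← Finset.compl_eq_univ_sdiff, Finset.card_compl, hs',
    Fintype.card_fin, real_smul]
  push_cast
  rfl

theorem jet_sum {κ : Type*} (s : Finset κ) (c : κ → ℕ → ℕ → ℂ) (n : ℕ) (y : ℝ × ℝ) :
    jet (fun k l => ∑ i ∈ s, c i k l) n y = ∑ i ∈ s, jet (c i) n y := by
  simp only [jet, Finset.mul_sum]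
  rw [Finset.sum_comm (s := s)]
  exact Finset.sum_congr rfl fun i _ => Finset.sum_comm

theorem jet_mul_const (c : ℕ → ℕ → ℂ) (a : ℂ) (n : ℕ) (y : ℝ × ℝ) :
    jet (fun k l => c k l * a) n y = jet c n y * a := by
  simp only [jet, Finset.sum_mul, mul_assoc]

theorem HasJet.sum {κ : Type*} {s : Finset κ} {f : κ → ℝ × ℝ → ℂ} {c : κ → ℕ → ℕ → ℂ}
    (h : ∀ i ∈ s, HasJet (f i) (c i)) :
    HasJet (fun y => ∑ i ∈ s, f i y) (fun k l => ∑ i ∈ s, c i k l) := by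
  intro n
  simp_rw [jet_sum, ← Finset.sum_sub_distrib]
  exact Asymptotics.IsBigO.fun_sum fun i hi => h i hi n

theorem HasJet.mul_const {f : ℝ × ℝ → ℂ} {c : ℕ → ℕ → ℂ} (h : HasJet f c) (a : ℂ) :
    HasJet (fun y => f y * a) (fun k l => c k l * a) := by
  intro n
  simp_rw [jet_mul_const, ← sub_mul, mul_comm _ a]
  exact (h n).const_mul_left a

theorem hasJet_const (a : ℂ) :
    HasJet (fun _ => a) (fun k l => if k = 0 ∧ l = 0 then a else 0) := by
  intro n
  cases n with
  | zero =>
    simp only [jet, Finset.range_zero, Finset.sum_empty, sub_zero, pow_zero]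
    exact Asymptotics.isBigO_const_const a one_ne_zero _
  | succ n =>
    have h : ∀ y : ℝ × ℝ, jet (fun k l => if k = 0 ∧ l = 0 then a else 0) (n + 1) y = a := by
      intro y
      rw [jet, Finset.sum_range_succ', Finset.sum_eq_zero]
      · simp
      · intro i _
        refine Finset.sum_eq_zero fun b hb => ?_
        have := Finset.HasAntidiagonal.mem_antidiagonal.1 hb
        rw [if_neg (by omega), mul_zero]
    simp_rw [h, sub_self]
    exact Asymptotics.isBigO_zero _ _

/-- An eventual bound at the origin also holds at the origin, where the bound of order one is zero.
-/
theorem HasJet.coeff_zero_zero {f : ℝ × ℝ → ℂ} {c : ℕ → ℕ → ℂ} (h : HasJet f c) :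
    c 0 0 = f 0 := by
  obtain ⟨C, hC⟩ := (h 1).bound
  have h0 := hC.self_of_nhds
  simp [jet] at h0
  exact (sub_eq_zero.1 h0).symm

theorem jet_two (c : ℕ → ℕ → ℂ) (y : ℝ × ℝ) :
    jet c 2 y = c 0 0 + y.1 * c 1 0 + y.2 * c 0 1 := by
  simp [jet, Finset.sum_range_succ, Finset.Nat.antidiagonal_succ]
  ring

/-- Uniqueness of derivatives: on the first axis the jet of order two is affine, and the error O(t²)
is o(t). -/
theorem HasJet.coeff_one_zero {f : ℝ × ℝ → ℂ} {c : ℕ → ℕ → ℂ} (h : HasJet f c) {a : ℂ}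
    (hf : HasDerivAt (fun t : ℝ => f (t, 0)) a 0) : c 1 0 = a := by
  refine HasDerivAt.unique (?_ : HasDerivAt (fun t : ℝ => f (t, 0)) (c 1 0) 0) hf
  have h1 : Filter.Tendsto (fun t : ℝ => (t, (0 : ℝ))) (nhds 0) (nhds 0) := by
    have : Continuous (fun t : ℝ => (t, (0 : ℝ))) := by fun_prop
    exact this.tendsto' _ _ rfl
  have h2 := (h 2).comp_tendsto h1
  rw [hasDerivAt_iff_isLittleO]
  have h3 : (fun t : ℝ => t ^ 2) =o[nhds 0] fun t => t := by
    simpa using Asymptotics.isLittleO_pow_pow (𝕜 := ℝ) (show 1 < 2 by norm_num)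
  have h4 : ((fun y : ℝ × ℝ => ‖y‖ ^ 2) ∘ fun t : ℝ => (t, (0 : ℝ))) = fun t => t ^ 2 := by
    funext t
    simp [Prod.norm_def]
  rw [h4] at h2
  refine (h2.trans_isLittleO h3).congr (fun t => ?_) (fun t => by simp)
  have h0 : c 0 0 = f (0, 0) := h.coeff_zero_zero
  simp [jet_two, h0]
  ring

theorem HasJet.coeff_zero_one {f : ℝ × ℝ → ℂ} {c : ℕ → ℕ → ℂ} (h : HasJet f c) {a : ℂ}
    (hf : HasDerivAt (fun t : ℝ => f (0, t)) a 0) : c 0 1 = a := by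
  refine HasDerivAt.unique (?_ : HasDerivAt (fun t : ℝ => f (0, t)) (c 0 1) 0) hf
  have h1 : Filter.Tendsto (fun t : ℝ => ((0 : ℝ), t)) (nhds 0) (nhds 0) := by
    have : Continuous (fun t : ℝ => ((0 : ℝ), t)) := by fun_prop
    exact this.tendsto' _ _ rfl
  have h2 := (h 2).comp_tendsto h1
  rw [hasDerivAt_iff_isLittleO]
  have h3 : (fun t : ℝ => t ^ 2) =o[nhds 0] fun t => t := by
    simpa using Asymptotics.isLittleO_pow_pow (𝕜 := ℝ) (show 1 < 2 by norm_num)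
  have h4 : ((fun y : ℝ × ℝ => ‖y‖ ^ 2) ∘ fun t : ℝ => ((0 : ℝ), t)) = fun t => t ^ 2 := by
    funext t
    simp [Prod.norm_def]
  rw [h4] at h2
  refine (h2.trans_isLittleO h3).congr (fun t => ?_) (fun t => by simp)
  have h0 : c 0 0 = f (0, 0) := h.coeff_zero_zero
  simp [jet_two, h0]
  ring

/-! ### Jets of the coefficients of the 𝒞_j -/

theorem cf_zero_eq (μ ν : Fin 4 → ℕ) (y : ℝ × ℝ) : cf 0 μ ν y = cf 0 μ ν 0 := by
  simp only [cf, coeffPoly, pow_zero, mul_one, MvPolynomial.coeff_C, mul_zero, div_one]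
  split_ifs <;> simp

/-- Expansion coefficients of all the coefficients of the `𝒞_j`, `S = 1`. -/
theorem exists_hasJet_cf : ∃ c : ℕ → ℕ → ℕ → (Fin 4 → ℕ) → (Fin 4 → ℕ) → ℂ,
    (∀ j μ ν, HasJet (cf j μ ν) (fun k l => c j k l μ ν)) ∧
    ∀ k l μ ν, ¬(k = 0 ∧ l = 0) → c 0 k l μ ν = 0 := by
  have h : ∀ j μ ν, ∃ d : ℕ → ℕ → ℂ, HasJet (cf j μ ν) d ∧
      (j = 0 → ∀ k l, ¬(k = 0 ∧ l = 0) → d k l = 0) := by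
    intro j μ ν
    -- For j = 0 the constant jet is chosen by hand, so that the terms B^k T^l without a power of ħ
    -- vanish by construction and uniqueness of jets is not needed.
    by_cases hj : j = 0
    · subst hj
      refine ⟨fun k l => if k = 0 ∧ l = 0 then cf 0 μ ν 0 else 0, ?_, fun _ k l hkl => if_neg hkl⟩
      rw [show cf 0 μ ν = fun _ => cf 0 μ ν 0 from funext fun y => cf_zero_eq μ ν y]
      exact hasJet_const _
    · obtain ⟨d, hd⟩ := exists_hasJet (analyticAt_cf j μ ν)
      exact ⟨d, hd, fun h => absurd h hj⟩
  choose d hd hd0 using h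
  exact ⟨fun j k l μ ν => d j μ ν k l, hd, fun k l μ ν hkl => hd0 0 μ ν rfl k l hkl⟩

theorem hasJet_bidiff {c : ℕ → ℕ → ℕ → (Fin 4 → ℕ) → (Fin 4 → ℕ) → ℂ}
    (hc : ∀ j μ ν, HasJet (cf j μ ν) (fun k l => c j k l μ ν)) (F G : Phase → ℂ) (x : Phase)
    (j : ℕ) : HasJet (fun y => bidiff j (fun μ ν => cf j μ ν y) F G x)
      (fun k l => bidiff j (c j k l) F G x) := by
  unfold bidiff
  exact HasJet.sum fun μ _ => HasJet.sum fun ν _ =>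
    ((hc j μ ν).mul_const (partialD μ F x)).mul_const (partialD ν G x)

/-- Summation over the triples by the first index. -/
theorem sum_tripleIdx {E : Type*} [AddCommMonoid E] (f : ℕ → ℕ → ℕ → E) {N M : ℕ} (h : N ≤ M) :
    ∑ a ∈ tripleIdx N, f a.1 a.2.1 a.2.2
      = ∑ j ∈ Finset.range M, ∑ i ∈ Finset.range (N - j),
        ∑ b ∈ Finset.HasAntidiagonal.antidiagonal i, f j b.1 b.2 := by
  rw [← Finset.sum_fiberwise_of_maps_to (s := tripleIdx N) (t := Finset.range M)
    (g := fun a => a.1)]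
  · refine Finset.sum_congr rfl fun j _ => ?_
    rw [← Finset.sum_fiberwise_of_maps_to (t := Finset.range (N - j))
      (g := fun a : ℕ × ℕ × ℕ => a.2.1 + a.2.2)]
    · refine Finset.sum_congr rfl fun i hi => ?_
      have hi' := Finset.mem_range.1 hi
      refine Finset.sum_bij' (fun a _ => a.2) (fun b _ => (j, b)) ?_ ?_ ?_ ?_ ?_
      · rintro ⟨a, b⟩ hab
        simp only [Finset.mem_filter] at hab
        exact Finset.HasAntidiagonal.mem_antidiagonal.2 hab.2
      · rintro ⟨k, l⟩ hkl
        have hkl' : k + l = i := Finset.HasAntidiagonal.mem_antidiagonal.1 hkl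
        simp only [tripleIdx, Finset.mem_filter, Finset.mem_product, Finset.mem_range, hkl',
          and_true]
        omega
      · rintro ⟨a, b⟩ hab
        simp only [Finset.mem_filter] at hab
        rw [← hab.1.2]
      · rintro ⟨k, l⟩ _
        rfl
      · rintro ⟨a, b⟩ hab
        simp only [Finset.mem_filter] at hab
        rw [← hab.1.2]
    · rintro ⟨a, b⟩ hab
      simp only [tripleIdx, Finset.mem_filter, Finset.mem_product, Finset.mem_range] at hab ⊢
      omega
  · rintro ⟨a, b⟩ hab
    simp only [tripleIdx, Finset.mem_filter, Finset.mem_product, Finset.mem_range] at hab ⊢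
    omega

/-- At fixed j the condition j + k + l < N leaves the jet of length N - j. Truncated subtraction
makes it empty for j ≥ N, so any M ≥ N may bound the outer sum. -/
theorem sum_tripleIdx_eq_jet (d : ℕ → ℕ → ℕ → ℂ) {N M : ℕ} (h : N ≤ M) (ħ B T : ℝ) :
    ∑ a ∈ tripleIdx N, (ħ : ℂ) ^ a.1 * (B : ℂ) ^ a.2.1 * (T : ℂ) ^ a.2.2 * d a.1 a.2.1 a.2.2
      = ∑ j ∈ Finset.range M, (ħ : ℂ) ^ j * jet (d j) (N - j) (B, T) := by
  rw [sum_tripleIdx (fun j k l => (ħ : ℂ) ^ j * (B : ℂ) ^ k * (T : ℂ) ^ l * d j k l) h]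
  simp only [jet, Finset.mul_sum, mul_assoc]

theorem exists_norm_le_of_isSymbol {F : Phase → ℂ} (hF : IsSymbol F) : ∃ C, ∀ x, ‖F x‖ ≤ C := by
  obtain ⟨C, hC⟩ := hF.2.exists_bound_of_continuous hF.1.continuous
  exact ⟨C, hC⟩

/-- Parameters and point separate: the finitely many coefficients depend only on (B, T), and the
derivatives of test symbols are bounded. Hence the estimate is uniform in x. -/
theorem isBigO_bidiff_sub {c : ℕ → ℕ → ℕ → (Fin 4 → ℕ) → (Fin 4 → ℕ) → ℂ}
    (hc : ∀ j μ ν, HasJet (cf j μ ν) (fun k l => c j k l μ ν)) {F G : Phase → ℂ}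
    (hF : IsSymbol F) (hG : IsSymbol G) (j n : ℕ) :
    ∃ C : ℝ, 0 ≤ C ∧ ∀ᶠ y in nhds (0 : ℝ × ℝ), ∀ x,
      ‖bidiff j (fun μ ν => cf j μ ν y) F G x - jet (fun k l => bidiff j (c j k l) F G x) n y‖
        ≤ C * ‖y‖ ^ n := by
  choose a ha using fun μ => exists_norm_le_of_isSymbol (isSymbol_partialD hF μ)
  choose b hb using fun μ => exists_norm_le_of_isSymbol (isSymbol_partialD hG μ)
  choose C hC using fun μ ν => (hc j μ ν n).bound
  have ha0 : ∀ μ, 0 ≤ a μ := fun μ => (norm_nonneg _).trans (ha μ 0)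
  have hb0 : ∀ μ, 0 ≤ b μ := fun μ => (norm_nonneg _).trans (hb μ 0)
  refine ⟨∑ μ ∈ multiIdx j, ∑ ν ∈ multiIdx j, |C μ ν| * a μ * b ν,
    Finset.sum_nonneg fun μ _ => Finset.sum_nonneg fun ν _ =>
      mul_nonneg (mul_nonneg (abs_nonneg _) (ha0 μ)) (hb0 ν), ?_⟩
  have hev : ∀ᶠ y in nhds (0 : ℝ × ℝ), ∀ μ ∈ multiIdx j, ∀ ν ∈ multiIdx j,
      ‖cf j μ ν y - jet (fun k l => c j k l μ ν) n y‖ ≤ C μ ν * ‖(‖y‖ ^ n)‖ :=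
    (Filter.eventually_all_finset _).2 fun μ _ => (Filter.eventually_all_finset _).2 fun ν _ =>
      hC μ ν
  filter_upwards [hev] with y hy x
  have e : bidiff j (fun μ ν => cf j μ ν y) F G x - jet (fun k l => bidiff j (c j k l) F G x) n y
      = ∑ μ ∈ multiIdx j, ∑ ν ∈ multiIdx j,
        (cf j μ ν y - jet (fun k l => c j k l μ ν) n y) * partialD μ F x * partialD ν G x := by
    simp only [bidiff, jet_sum, jet_mul_const, ← Finset.sum_sub_distrib, sub_mul]
  rw [e, Finset.sum_mul]
  refine norm_sum_le_of_le _ fun μ hμ => ?_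
  rw [Finset.sum_mul]
  refine norm_sum_le_of_le _ fun ν hν => ?_
  have h1 : ‖cf j μ ν y - jet (fun k l => c j k l μ ν) n y‖ ≤ |C μ ν| * ‖y‖ ^ n := by
    refine (hy μ hμ ν hν).trans ?_
    rw [norm_pow, norm_norm]
    gcongr
    exact le_abs_self _
  rw [norm_mul, norm_mul]
  calc _ ≤ |C μ ν| * ‖y‖ ^ n * a μ * b ν := by
        have := ha0 μ
        gcongr
        · exact ha μ x
        · exact hb ν x
    _ = _ := by ring

/-! ### The terms of total order at most two, and the joint expansion -/

theorem dir_const_mul {H : Phase → ℂ} (hH : ContDiff ℝ ∞ H) (v : Fin 4 → ℂ) (a : ℂ) :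
    dir v (fun x => a * H x) = fun x => a * dir v H x := by
  funext x
  simp only [dir, Finset.mul_sum]
  refine Finset.sum_congr rfl fun k _ => ?_
  have h := congrFun (pd_sum {()} (fun _ => a) (G := fun _ => H) (fun _ => hH) k) x
  simp only [Finset.sum_singleton] at h
  rw [h]
  ring

theorem dQ_eq_pd (k : Fin 2) : dQ k = pd (![2, 3] k) := by
  fin_cases k <;> rfl

theorem dP_eq_pd (k : Fin 2) : dP k = pd (![0, 1] k) := by
  fin_cases k <;> rfl

theorem contDiff_dMinus {F : Phase → ℂ} (hF : ContDiff ℝ ∞ F) (k : Fin 2) :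
    ContDiff ℝ ∞ (dMinus k F) := by
  have : dMinus k F = fun x => pd (![0, 1] k) F x - I * pd (![2, 3] k) F x := by
    funext x
    rw [dMinus, dQ_eq_pd, dP_eq_pd]
  rw [this]
  exact (contDiff_pd hF _).sub (contDiff_const.mul (contDiff_pd hF _))

theorem contDiff_dPlus {F : Phase → ℂ} (hF : ContDiff ℝ ∞ F) (k : Fin 2) :
    ContDiff ℝ ∞ (dPlus k F) := by
  have : dPlus k F = fun x => pd (![0, 1] k) F x + I * pd (![2, 3] k) F x := by
    funext x
    rw [dPlus, dQ_eq_pd, dP_eq_pd]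
  rw [this]
  exact (contDiff_pd hF _).add (contDiff_const.mul (contDiff_pd hF _))

theorem dir_vv_zero (F : Phase → ℂ) (k : Fin 2) :
    dir (vv 0 0 1 k) F = fun x => ((√2 / 2 : ℝ) * I) * dMinus k F x := by
  funext x
  rw [dMinus, dQ_eq_pd, dP_eq_pd, dir, Fin.sum_univ_four]
  fin_cases k <;> simp [vv] <;> grind [I_sq]

theorem dir_ww_zero (F : Phase → ℂ) (k : Fin 2) :
    dir (ww 0 0 1 k) F = fun x => (-((√2 / 2 : ℝ) * I)) * dPlus k F x := by
  funext x
  rw [dPlus, dQ_eq_pd, dP_eq_pd, dir, Fin.sum_univ_four]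
  fin_cases k <;> simp [ww] <;> grind [I_sq]

theorem dir_vv_dir_vv_zero {F : Phase → ℂ} (hF : ContDiff ℝ ∞ F) (k l : Fin 2) :
    dir (vv 0 0 1 k) (dir (vv 0 0 1 l) F) = fun x => -(1 / 2) * dMinus k (dMinus l F) x := by
  have h2 : (√2 : ℂ) ^ 2 = 2 := by
    exact_mod_cast Real.sq_sqrt (show (0 : ℝ) ≤ 2 by norm_num)
  rw [dir_vv_zero F, dir_const_mul (contDiff_dMinus hF l), dir_vv_zero]
  funext x
  push_cast
  linear_combination ((√2 : ℂ) ^ 2 / 4 * dMinus k (dMinus l F) x) * I_sq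
    - dMinus k (dMinus l F) x / 4 * h2

theorem dir_ww_dir_ww_zero {F : Phase → ℂ} (hF : ContDiff ℝ ∞ F) (k l : Fin 2) :
    dir (ww 0 0 1 k) (dir (ww 0 0 1 l) F) = fun x => -(1 / 2) * dPlus k (dPlus l F) x := by
  have h2 : (√2 : ℂ) ^ 2 = 2 := by
    exact_mod_cast Real.sq_sqrt (show (0 : ℝ) ≤ 2 by norm_num)
  rw [dir_ww_zero F, dir_const_mul (contDiff_dPlus hF l), dir_ww_zero]
  funext x
  push_cast
  linear_combination ((√2 : ℂ) ^ 2 / 4 * dPlus k (dPlus l F) x) * I_sq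
    - dPlus k (dPlus l F) x / 4 * h2

/-- Each pair of derivatives in z or z̄ contributes -1/2, so the product contributes 1/4; the factor
1/α! is 1/2 for the pure terms and 1 for the mixed one. -/
theorem mop_cSym_two {F G : Phase → ℂ} (hF : ContDiff ℝ ∞ F) (hG : ContDiff ℝ ∞ G) (x : Phase) :
    mop ![F, G] x (cSym 0 0 1 2)
      = 1 / 8 * ((∑ k, dPlus k (dPlus k G) x * dMinus k (dMinus k F) x)
      + 2 * (dPlus 0 (dPlus 1 G) x * dMinus 0 (dMinus 1 F) x)) := by
  rw [cSym, ← sum_dir_eq_mop hF hG]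
  simp only [Finset.Nat.antidiagonal_succ, Finset.Nat.antidiagonal_zero, Finset.map_singleton,
    Finset.sum_cons, Finset.sum_singleton, Function.Embedding.coe_prodMap, Finset.map_cons,
    Function.Embedding.coeFn_mk, Function.Embedding.refl_apply, Prod.map,
    Function.iterate_zero_apply, Nat.factorial, Function.iterate_succ_apply,
    dir_vv_dir_vv_zero hF, dir_ww_dir_ww_zero hG, Fin.sum_univ_two]
  push_cast
  ring

theorem bidiff_cf_eq_mop {B T : ℝ} (h : B * T ≠ 1) (j : ℕ) (F G : Phase → ℂ) (x : Phase) :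
    bidiff j (fun μ ν => cf j μ ν (B, T)) F G x = mop ![F, G] x (cSym B T 1 j) := by
  rw [mop_cSym_eq_bidiff]
  simp_rw [coeff_cSym h]

/-- Besides the terms without ħ beyond FG, which vanish by the choice of the jets, five coefficients
matter: the values at the origin of 𝒞₀, 𝒞₁, 𝒞₂ and the two first derivatives of 𝒞₁. -/
theorem sum_tripleIdx_three {c : ℕ → ℕ → ℕ → (Fin 4 → ℕ) → (Fin 4 → ℕ) → ℂ}
    (hc : ∀ j μ ν, HasJet (cf j μ ν) (fun k l => c j k l μ ν))
    (hc0 : ∀ k l μ ν, ¬(k = 0 ∧ l = 0) → c 0 k l μ ν = 0)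
    {F G : Phase → ℂ} (hF : ContDiff ℝ ∞ F) (hG : ContDiff ℝ ∞ G) (ħ B T : ℝ) (x : Phase) :
    ∑ a ∈ tripleIdx 3, (ħ : ℂ) ^ a.1 * (B : ℂ) ^ a.2.1 * (T : ℂ) ^ a.2.2
        * bidiff a.1 (c a.1 a.2.1 a.2.2) F G x = starSecond ħ B T F G x := by
  have h0 : ∀ k l, ¬(k = 0 ∧ l = 0) → bidiff 0 (c 0 k l) F G x = 0 := by
    intro k l hkl
    refine Finset.sum_eq_zero fun μ _ => Finset.sum_eq_zero fun ν _ => ?_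
    rw [hc0 k l μ ν hkl, zero_mul, zero_mul]
  have h00 : (0 : ℝ) * 0 ≠ 1 := by norm_num
  have e0 : bidiff 0 (c 0 0 0) F G x = F x * G x := by
    rw [(hasJet_bidiff hc F G x 0).coeff_zero_zero]
    exact (bidiff_cf_eq_mop h00 0 F G x).trans (mop_cSym_zero _ _ _ F G x)
  have e2 : bidiff 2 (c 2 0 0) F G x
      = 1 / 8 * ((∑ k, dPlus k (dPlus k G) x * dMinus k (dMinus k F) x)
      + 2 * (dPlus 0 (dPlus 1 G) x * dMinus 0 (dMinus 1 F) x)) := by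
    rw [(hasJet_bidiff hc F G x 2).coeff_zero_zero]
    exact (bidiff_cf_eq_mop h00 2 F G x).trans (mop_cSym_two hF hG x)
  have f1 : ∀ {B T : ℝ}, B * T ≠ 1 → bidiff 1 (fun μ ν => cf 1 μ ν (B, T)) F G x
      = dotProduct (grad F x) (Matrix.mulVec (matRen B T (1 : ℝ)) (grad G x)) := by
    intro B T h
    rw [bidiff_cf_eq_mop h, mop_cSym_one one_ne_zero (sub_ne_zero.2 h.symm) hF hG]
  have e1 : bidiff 1 (c 1 0 0) F G x = -(1 / 2) * ∑ k, dMinus k F x * dPlus k G x := by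
    rw [(hasJet_bidiff hc F G x 1).coeff_zero_zero]
    refine (f1 h00).trans ?_
    simp [matRen, dotProduct, Matrix.mulVec, Fin.sum_univ_four, grad, dMinus, dPlus]
    grind [I_sq]
  -- On either axis BT = 0, so the matrix entries are polynomials of degree at most two in the
  -- remaining parameter, and the wanted derivative is the linear coefficient b.
  have q : ∀ a b d : ℂ, HasDerivAt (fun t : ℝ => a + t * b + (t : ℂ) ^ 2 * d) b 0 := by
    intro a b d
    have h1 : HasDerivAt (fun t : ℝ => (t : ℂ)) 1 0 := ofRealCLM.hasDerivAt
    have h2 := ((h1.mul_const b).const_add a).fun_add ((h1.pow 2).mul_const d)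
    simpa using h2
  have e10 : bidiff 1 (c 1 1 0) F G x
      = 1 / 2 * (I * dP 0 G x * dMinus 1 F x - I * dP 0 F x * dPlus 1 G x) := by
    refine (hasJet_bidiff hc F G x 1).coeff_one_zero ?_
    have := q (-(1 / 2) * ∑ k, dMinus k F x * dPlus k G x)
      (1 / 2 * (I * dP 0 G x * dMinus 1 F x - I * dP 0 F x * dPlus 1 G x))
      (-(1 / 2) * (dP 0 F x * dP 0 G x))
    refine this.congr_of_eventuallyEq (Filter.Eventually.of_forall fun t => ?_)
    refine (f1 (by simp)).trans ?_
    simp [matRen, dotProduct, Matrix.mulVec, Fin.sum_univ_four, grad, dMinus, dPlus]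
    grind [I_sq]
  have e01 : bidiff 1 (c 1 0 1) F G x
      = 1 / 2 * (dQ 1 F x * dPlus 0 G x + dQ 1 G x * dMinus 0 F x) := by
    refine (hasJet_bidiff hc F G x 1).coeff_zero_one ?_
    have := q (-(1 / 2) * ∑ k, dMinus k F x * dPlus k G x)
      (1 / 2 * (dQ 1 F x * dPlus 0 G x + dQ 1 G x * dMinus 0 F x))
      (-(1 / 2) * (dQ 1 F x * dQ 1 G x))
    refine this.congr_of_eventuallyEq (Filter.Eventually.of_forall fun t => ?_)
    refine (f1 (by simp)).trans ?_
    simp [matRen, dotProduct, Matrix.mulVec, Fin.sum_univ_four, grad, dMinus, dPlus]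
    grind [I_sq]
  rw [sum_tripleIdx_eq_jet (fun j k l => bidiff j (c j k l) F G x) le_rfl]
  simp only [Finset.sum_range_succ, Finset.range_zero, Finset.sum_empty, jet, Nat.sub_zero,
    Nat.reduceSub, Finset.Nat.antidiagonal_succ, Finset.Nat.antidiagonal_zero,
    Finset.map_singleton, Finset.sum_cons, Finset.sum_singleton, Function.Embedding.coe_prodMap,
    Finset.map_cons, Function.Embedding.coeFn_mk, Function.Embedding.refl_apply, Prod.map, e0, e1,
    e2, e10, e01, h0 0 1 (by simp), h0 1 0 (by simp), h0 0 2 (by simp), h0 1 1 (by simp),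
    h0 2 0 (by simp), starSecond, Nat.succ_eq_add_one, zero_add, one_add_one_eq_two]
  ring

theorem starSecond_sub (ħ B T : ℂ) (F G : Phase → ℂ) (x : Phase) :
    starSecond ħ B T F G x - starSecond ħ B T G F x = commSecond ħ B T F G x := by
  simp only [starSecond, commSecond, poisson, Fin.sum_univ_two]
  simp only [dMinus, dPlus]
  grind [I_sq]

/-- The joint expansion of the star product, uniformly in the point. -/
theorem joint_expansion {c : ℕ → ℕ → ℕ → (Fin 4 → ℕ) → (Fin 4 → ℕ) → ℂ}
    (hc : ∀ j μ ν, HasJet (cf j μ ν) (fun k l => c j k l μ ν)) {F G : Phase → ℂ}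
    (hF : IsSymbol F) (hG : IsSymbol G) {N M : ℕ} (hNM : N ≤ M) :
    ∃ C δ : ℝ, 0 < δ ∧ ∀ ħ B T : ℝ, 0 < ħ → ħ < δ → |B| < δ → |T| < δ → ∀ x,
      ‖∑ j ∈ Finset.range M, (ħ : ℂ) ^ j * renCoeff ħ B T 1 j F G x
        - ∑ a ∈ tripleIdx N, (ħ : ℂ) ^ a.1 * (B : ℂ) ^ a.2.1 * (T : ℂ) ^ a.2.2
          * bidiff a.1 (c a.1 a.2.1 a.2.2) F G x‖ ≤ C * (ħ + |B| + |T|) ^ N := by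
  -- A factor ħ^j already accounts for j orders, so the j-th coefficient is expanded only to order N
  -- - j.
  choose C hC0 hC using fun j => isBigO_bidiff_sub hc hF hG j (N - j)
  have hev := (Filter.eventually_all_finset (Finset.range M)).2 fun j _ => hC j
  obtain ⟨δ, hδ, hball⟩ := Metric.eventually_nhds_iff.1 hev
  -- The bound 1 serves twice: it keeps BT ≠ 1, and it gives ħ^j ≤ ħ^N for the indices j ≥ N.
  refine ⟨∑ j ∈ Finset.range M, C j, min δ 1, by positivity, fun ħ B T hħ hħδ hB hT x => ?_⟩
  have hB1 := hB.trans_le (min_le_right _ _)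
  have hT1 := hT.trans_le (min_le_right _ _)
  have hħ1 := hħδ.trans_le (min_le_right _ _)
  have hBT : B * T ≠ 1 := by
    intro h
    have h1 : |B| * |T| = 1 := by rw [← abs_mul, h, abs_one]
    nlinarith [abs_nonneg B, abs_nonneg T]
  have hy : ‖((B, T) : ℝ × ℝ)‖ ≤ |B| + |T| := by
    rw [Prod.norm_def]
    exact max_le (by simp [Real.norm_eq_abs]) (by simp [Real.norm_eq_abs])
  have hyδ : dist ((B, T) : ℝ × ℝ) 0 < δ := by
    rw [dist_zero_right, Prod.norm_def]
    exact max_lt (hB.trans_le (min_le_left _ _)) (hT.trans_le (min_le_left _ _))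
  have hb := hball hyδ
  simp_rw [renCoeff_eq_bidiff hħ hBT _ hF.1 hG.1]
  rw [sum_tripleIdx_eq_jet (fun j k l => bidiff j (c j k l) F G x) hNM, ← Finset.sum_sub_distrib,
    Finset.sum_mul]
  refine norm_sum_le_of_le _ fun j hj => ?_
  rw [← mul_sub, norm_mul, norm_pow, norm_real, Real.norm_of_nonneg hħ.le]
  have h1 : ħ ^ j * (|B| + |T|) ^ (N - j) ≤ (ħ + |B| + |T|) ^ N := by
    have hr : 0 ≤ |B| + |T| := by positivity
    rcases le_total j N with hjN | hjN
    · calc ħ ^ j * (|B| + |T|) ^ (N - j)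
          ≤ (ħ + |B| + |T|) ^ j * (ħ + |B| + |T|) ^ (N - j) := by
            gcongr <;> linarith
        _ = _ := by rw [← pow_add, Nat.add_sub_cancel' hjN]
    · rw [Nat.sub_eq_zero_of_le hjN, pow_zero, mul_one]
      calc ħ ^ j ≤ ħ ^ N := pow_le_pow_of_le_one hħ.le hħ1.le hjN
        _ ≤ _ := by gcongr; linarith
  calc _ ≤ ħ ^ j * (C j * (|B| + |T|) ^ (N - j)) := by
        gcongr
        refine (hb j hj x).trans ?_
        have := hC0 j
        gcongr
    _ = C j * (ħ ^ j * (|B| + |T|) ^ (N - j)) := by ring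
    _ ≤ _ := by
        have := hC0 j
        gcongr

theorem commutator_expansion {F G : Phase → ℂ} (hF : IsSymbol F) (hG : IsSymbol G) {M : ℕ}
    (hM : 3 ≤ M) :
    ∃ C δ : ℝ, 0 < δ ∧ ∀ ħ B T : ℝ, 0 < ħ → ħ < δ → |B| < δ → |T| < δ → ∀ x,
      ‖∑ j ∈ Finset.range M, (ħ : ℂ) ^ j
          * (renCoeff ħ B T 1 j F G x - renCoeff ħ B T 1 j G F x)
        - commSecond ħ B T F G x‖ ≤ C * (ħ + |B| + |T|) ^ 3 := by
  obtain ⟨c, hc, hc0⟩ := exists_hasJet_cf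
  obtain ⟨C, δ, hδ, h⟩ := joint_expansion hc hF hG hM
  obtain ⟨C', δ', hδ', h'⟩ := joint_expansion hc hG hF hM
  refine ⟨C + C', min δ δ', lt_min hδ hδ', fun ħ B T hħ hħδ hB hT x => ?_⟩
  have h1 := h ħ B T hħ (hħδ.trans_le (min_le_left _ _)) (hB.trans_le (min_le_left _ _))
    (hT.trans_le (min_le_left _ _)) x
  have h2 := h' ħ B T hħ (hħδ.trans_le (min_le_right _ _)) (hB.trans_le (min_le_right _ _))
    (hT.trans_le (min_le_right _ _)) x
  rw [sum_tripleIdx_three hc hc0 hF.1 hG.1] at h1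
  rw [sum_tripleIdx_three hc hc0 hG.1 hF.1] at h2
  rw [← starSecond_sub]
  simp_rw [mul_sub, Finset.sum_sub_distrib]
  rw [add_mul]
  refine le_trans (le_of_eq ?_) ((norm_sub_le _ _).trans (add_le_add h1 h2))
  congr 1
  ring

end

end NCToeplitz

namespace NCToeplitz

noncomputable section

/-! ### Fourier representation of symbols -/

/-- The pairing of frequencies (ordered as `p₁, p₂, q₁, q₂`) with the phase space. -/
def pairing (θ : Fin 4 → ℝ) (x : Phase) : ℝ :=
  θ 0 * x.2 0 + θ 1 * x.2 1 + θ 2 * x.1 0 + θ 3 * x.1 1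

/-- The character `x ↦ exp(i θ·x)`. -/
def echar (θ : Fin 4 → ℝ) (x : Phase) : ℂ := Complex.exp (I * (pairing θ x : ℝ))

theorem echar_add (θ θ' : Fin 4 → ℝ) (x : Phase) :
    echar (θ + θ') x = echar θ x * echar θ' x := by
  rw [echar, echar, echar, ← Complex.exp_add]
  congr 1
  simp only [pairing, Pi.add_apply]
  push_cast
  ring

theorem norm_echar (θ : Fin 4 → ℝ) (x : Phase) : ‖echar θ x‖ = 1 := by
  rw [echar, mul_comm, Complex.norm_exp_ofReal_mul_I]

theorem continuous_echar : Continuous (fun a : (Fin 4 → ℝ) × Phase => echar a.1 a.2) := by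
  unfold echar pairing
  fun_prop

/-- The frequency space as a Euclidean space. -/
abbrev Freq := EuclideanSpace ℝ (Fin 4)

/-- The identification of the Euclidean space with the phase space. -/
def freqEquiv : Freq ≃ₗ[ℝ] Phase where
  toFun v := (![v 2, v 3], ![v 0, v 1])
  invFun x := !₂[x.2 0, x.2 1, x.1 0, x.1 1]
  map_add' v w := by
    refine Prod.ext (funext fun k => ?_) (funext fun k => ?_) <;> fin_cases k <;> simp
  map_smul' c v := by
    refine Prod.ext (funext fun k => ?_) (funext fun k => ?_) <;> fin_cases k <;> simp
  left_inv v := by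
    ext k
    fin_cases k <;> simp
  right_inv x := by
    refine Prod.ext (funext fun k => ?_) (funext fun k => ?_) <;> fin_cases k <;> simp

/-- `2π` times the coordinates. -/
def freq (w : Freq) : Fin 4 → ℝ := fun i => 2 * Real.pi * w i

theorem continuous_freq : Continuous freq := by
  unfold freq
  fun_prop

theorem bvec_eq (k : Fin 4) : bvec k = freqEquiv (EuclideanSpace.single k 1) := by
  refine Prod.ext (funext fun l => ?_) (funext fun l => ?_) <;> fin_cases k <;> fin_cases l <;>
    simp [bvec, freqEquiv]

theorem isSymbol_comp_freqEquiv {F : Phase → ℂ} (hF : IsSymbol F) :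
    ContDiff ℝ ∞ (F ∘ freqEquiv) ∧ HasCompactSupport (F ∘ freqEquiv) :=
  ⟨hF.1.comp freqEquiv.toContinuousLinearEquiv.contDiff,
    hF.2.comp_homeomorph freqEquiv.toContinuousLinearEquiv.toHomeomorph⟩

/-- The Fourier transform of a symbol, in frequency coordinates. -/
def fhat (F : Phase → ℂ) : Freq → ℂ := FourierTransform.fourier (F ∘ freqEquiv)

/-- A symbol as a Schwartz function. -/
def schwartzOf {F : Phase → ℂ} (hF : IsSymbol F) : SchwartzMap Freq ℂ :=
  (isSymbol_comp_freqEquiv hF).2.toSchwartzMap (isSymbol_comp_freqEquiv hF).1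

theorem fhat_eq {F : Phase → ℂ} (hF : IsSymbol F) :
    fhat F = (FourierTransform.fourier (schwartzOf hF) : SchwartzMap Freq ℂ) := rfl

theorem integrable_pow_mul_fhat {F : Phase → ℂ} (hF : IsSymbol F) (n : ℕ) :
    Integrable (fun w => ‖w‖ ^ n * ‖fhat F w‖) := by
  rw [fhat_eq hF]
  exact SchwartzMap.integrable_pow_mul _ _ n

/-- The factor 2π of the Fourier convention is absorbed in `freq`, so ∂_k acts as multiplication by
i times the k-th frequency. -/
theorem fhat_pd {F : Phase → ℂ} (hF : IsSymbol F) (k : Fin 4) (w : Freq) :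
    fhat (pd k F) w = I * freq w k * fhat F w := by
  have h1 : (pd k F) ∘ freqEquiv = fun v => fderiv ℝ (F ∘ freqEquiv) v (EuclideanSpace.single k 1) := by
    funext v
    have h := (hF.1.differentiable (by simp) (freqEquiv v)).hasFDerivAt.comp v
      (freqEquiv.toContinuousLinearEquiv.hasFDerivAt (x := v))
    have h2 : fderiv ℝ (F ∘ freqEquiv) v = (fderiv ℝ F (freqEquiv v)).comp
      (freqEquiv.toContinuousLinearEquiv : Freq →L[ℝ] Phase) := h.fderiv
    rw [h2, Function.comp_apply, pd, bvec_eq]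
    rfl
  have h2 := congrArg (fun g : SchwartzMap Freq ℂ => g w)
    (SchwartzMap.fourier_lineDerivOp_eq (schwartzOf hF) (EuclideanSpace.single k 1))
  have h3 : (inner ℝ · (EuclideanSpace.single k 1 : Freq)).HasTemperateGrowth := by fun_prop
  simp only [smul_apply, SchwartzMap.smulLeftCLM_apply_apply h3] at h2
  have h4 : fhat (pd k F) w = FourierTransform.fourier
      (LineDeriv.lineDerivOp (EuclideanSpace.single k 1 : Freq) (schwartzOf hF)) w := by
    rw [fhat, h1]
    rfl
  rw [h4, h2, fhat_eq hF, EuclideanSpace.inner_single_right, freq]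
  simp
  ring

theorem fhat_pd_iterate {F : Phase → ℂ} (hF : IsSymbol F) (k : Fin 4) (n : ℕ) (w : Freq) :
    fhat ((pd k)^[n] F) w = (I * freq w k) ^ n * fhat F w := by
  induction n generalizing F with
  | zero => simp
  | succ n ih =>
    rw [Function.iterate_succ_apply, ih (isSymbol_pd hF k), fhat_pd hF]
    ring

theorem fhat_partialD {F : Phase → ℂ} (hF : IsSymbol F) (μ : Fin 4 → ℕ) (w : Freq) :
    fhat (partialD μ F) w = (∏ i, (I * freq w i) ^ μ i) * fhat F w := by
  have h3 := isSymbol_pd_iterate hF 3 (μ 3)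
  have h2 := isSymbol_pd_iterate h3 2 (μ 2)
  have h1 := isSymbol_pd_iterate h2 1 (μ 1)
  rw [partialD_eq, fhat_pd_iterate h1, fhat_pd_iterate h2, fhat_pd_iterate h3, fhat_pd_iterate hF,
    Fin.prod_univ_four]
  ring

/-- Fourier inversion for symbols. -/
theorem fourier_rep {F : Phase → ℂ} (hF : IsSymbol F) (x : Phase) :
    F x = ∫ w, fhat F w * echar (freq w) x := by
  have h1 : Integrable (F ∘ freqEquiv) := (schwartzOf hF).integrable
  have h2 : Integrable (FourierTransform.fourier (F ∘ freqEquiv)) :=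
    (FourierTransform.fourier (schwartzOf hF) : SchwartzMap Freq ℂ).integrable
  have h := congrFun ((isSymbol_comp_freqEquiv hF).1.continuous.fourierInv_fourier_eq h1 h2)
    (freqEquiv.symm x)
  rw [Function.comp_apply, LinearEquiv.apply_symm_apply, Real.fourierInv_eq'] at h
  rw [← h]
  refine integral_congr_ae (Filter.Eventually.of_forall fun w => ?_)
  simp only [smul_eq_mul]
  rw [mul_comm, fhat, echar, mul_comm I]
  congr 4
  simp [freqEquiv, pairing, freq, PiLp.inner_apply, Fin.sum_univ_four]
  ring

theorem partialD_rep {F : Phase → ℂ} (hF : IsSymbol F) (μ : Fin 4 → ℕ) (x : Phase) :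
    partialD μ F x = ∫ w, (∏ i, (I * freq w i) ^ μ i) * fhat F w * echar (freq w) x := by
  rw [fourier_rep (isSymbol_partialD hF μ) x]
  simp_rw [fhat_partialD hF]

theorem integrable_fhat {F : Phase → ℂ} (hF : IsSymbol F) : Integrable (fhat F) := by
  rw [fhat_eq hF]
  exact SchwartzMap.integrable _

/-- The value of a symbol polynomial at a pair of frequencies. -/
def symVal (p : MvPolynomial (Fin 2 × Fin 4) ℂ) (a : Freq × Freq) : ℂ :=
  MvPolynomial.eval (fun b : Fin 2 × Fin 4 => I * freq ((![a.1, a.2] : Fin 2 → Freq) b.1) b.2) p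

theorem symVal_monomial (m : Fin 2 × Fin 4 →₀ ℕ) (c : ℂ) (a : Freq × Freq) :
    symVal (MvPolynomial.monomial m c) a = c * ((∏ i, (I * freq a.1 i) ^ m (0, i))
      * ∏ i, (I * freq a.2 i) ^ m (1, i)) := by
  rw [symVal, MvPolynomial.eval_monomial, Finsupp.prod_fintype _ _ (by simp),
    Fintype.prod_prod_type, Fin.prod_univ_two]
  rfl

/-- For a monomial the integrand is a product of Fourier transforms of derivatives of F and G, which
are again test symbols. -/
theorem integrable_symVal {F G : Phase → ℂ} (hF : IsSymbol F) (hG : IsSymbol G)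
    (p : MvPolynomial (Fin 2 × Fin 4) ℂ) :
    Integrable (fun a : Freq × Freq => symVal p a * (fhat F a.1 * fhat G a.2)) := by
  induction p using MvPolynomial.induction_on' with
  | monomial m c =>
    have h1 := integrable_fhat (isSymbol_partialD hF fun k => m (0, k))
    have h2 := integrable_fhat (isSymbol_partialD hG fun k => m (1, k))
    refine ((h1.mul_prod h2).const_mul c).congr (Filter.Eventually.of_forall fun a => ?_)
    simp only [symVal_monomial, fhat_partialD hF, fhat_partialD hG]
    ring
  | add p q hp hq =>
    refine (hp.add hq).congr (Filter.Eventually.of_forall fun a => ?_)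
    simp only [symVal, map_add, Pi.add_apply]
    ring

/-- Fourier representation of a bidifferential operator applied to symbols. -/
theorem mop_rep {F G : Phase → ℂ} (hF : IsSymbol F) (hG : IsSymbol G)
    (p : MvPolynomial (Fin 2 × Fin 4) ℂ) (x : Phase) :
    mop ![F, G] x p = ∫ a : Freq × Freq, symVal p a * (fhat F a.1 * fhat G a.2)
      * echar (freq a.1 + freq a.2) x := by
  have hint : ∀ p, Integrable (fun a : Freq × Freq => symVal p a * (fhat F a.1 * fhat G a.2)
      * echar (freq a.1 + freq a.2) x) := by
    intro p
    refine (integrable_symVal hF hG p).mul_bdd (c := 1) ?_ ?_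
    · have : Continuous (fun a : Freq × Freq => echar (freq a.1 + freq a.2) x) := by
        have h1 : Continuous (fun a : Freq × Freq => (freq a.1 + freq a.2, x)) :=
          ((continuous_freq.comp continuous_fst).add
            (continuous_freq.comp continuous_snd)).prodMk continuous_const
        exact continuous_echar.comp h1
      exact this.aestronglyMeasurable
    · exact Filter.Eventually.of_forall fun a => (norm_echar _ _).le
  induction p using MvPolynomial.induction_on' with
  | monomial m c =>
    rw [mop_monomial, Fin.prod_univ_two]
    change c * (partialD (fun k => m (0, k)) F x * partialD (fun k => m (1, k)) G x) = _
    rw [partialD_rep hF, partialD_rep hG, ← integral_prod_mul, ← integral_const_mul]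
    refine integral_congr_ae (Filter.Eventually.of_forall fun a => ?_)
    simp only [symVal_monomial, echar_add]
    ring
  | add p q hp hq =>
    rw [map_add, hp, hq, ← integral_add (hint p) (hint q)]
    refine integral_congr_ae (Filter.Eventually.of_forall fun a => ?_)
    simp only [symVal, map_add]
    ring

end

end NCToeplitz

namespace NCToeplitz

noncomputable section

/-! ### Plancherel's theorem on the plane -/

section Plancherel

variable {V : Type*} [NormedAddCommGroup V] [InnerProductSpace ℝ V] [FiniteDimensional ℝ V]
  [MeasurableSpace V] [BorelSpace V]

theorem continuous_fourier_of_integrable {g : V → ℂ} (h : Integrable g) :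
    Continuous (FourierTransform.fourier g : V → ℂ) :=
  VectorFourier.fourierIntegral_continuous Real.continuous_fourierChar
    (by exact continuous_inner) h

/-- On `L¹ ∩ L²` the Fourier transform of `L²` is given by the integral. -/
theorem fourier_toLp_ae_eq {g : V → ℂ} (h1 : Integrable g) (h2 : MemLp g 2) :
    (FourierTransform.fourier (h2.toLp g) : Lp ℂ 2 (volume : Measure V))
      =ᵐ[volume] (FourierTransform.fourier g : V → ℂ) := by
  -- Both functions are tested against smooth compactly supported u. The transform is moved onto u
  -- by duality of tempered distributions on one side, and by Fubini for integrable functions on the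
  -- other.
  refine ae_eq_of_integral_contDiff_smul_eq ((Lp.memLp _).locallyIntegrable (by norm_num))
    (continuous_fourier_of_integrable h1).locallyIntegrable fun u hu huc => ?_
  have hu1 : HasCompactSupport (Complex.ofRealCLM ∘ u) := huc.comp_left rfl
  have hu2 : ContDiff ℝ ∞ (Complex.ofRealCLM ∘ u) := by fun_prop
  set h := hu1.toSchwartzMap hu2 with hh
  have e1 := congrArg (fun T => T h) (Lp.fourier_toTemperedDistribution_eq (h2.toLp g))
  simp only [TemperedDistribution.fourier_apply, Lp.toTemperedDistribution_apply] at e1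
  have e2 : ∫ x, (FourierTransform.fourier h : SchwartzMap V ℂ) x • (h2.toLp g) x
      = ∫ x, (FourierTransform.fourier (h : V → ℂ) : V → ℂ) x • g x := by
    refine integral_congr_ae ?_
    filter_upwards [h2.coeFn_toLp] with x hx
    rw [hx]
    rfl
  have e3 : ∫ x, (FourierTransform.fourier (h : V → ℂ) : V → ℂ) x • g x
      = ∫ x, h x • (FourierTransform.fourier g : V → ℂ) x := by
    have := VectorFourier.integral_fourierIntegral_smul_eq_flip (μ := volume) (ν := volume)
      (L := innerₗ V) Real.continuous_fourierChar (by exact continuous_inner) h.integrable h1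
    rw [flip_innerₗ] at this
    exact this
  rw [e2, e3] at e1
  exact e1.symm

theorem memLp_fourier {g : V → ℂ} (h1 : Integrable g) (h2 : MemLp g 2) :
    MemLp (FourierTransform.fourier g : V → ℂ) 2 :=
  (memLp_congr_ae (fourier_toLp_ae_eq h1 h2)).1 (Lp.memLp _)

theorem integral_conj_fourier_mul_fourier {g g' : V → ℂ} (h1 : Integrable g) (h2 : MemLp g 2)
    (h1' : Integrable g') (h2' : MemLp g' 2) :
    ∫ x, conj ((FourierTransform.fourier g : V → ℂ) x) * (FourierTransform.fourier g' : V → ℂ) x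
      = ∫ x, conj (g x) * g' x := by
  have h := Lp.inner_fourier_eq (h2.toLp g) (h2'.toLp g')
  rw [L2.inner_def, L2.inner_def] at h
  refine Eq.trans ?_ (h.trans ?_)
  · refine integral_congr_ae ?_
    filter_upwards [fourier_toLp_ae_eq h1 h2, fourier_toLp_ae_eq h1' h2'] with x hx hx'
    rw [hx, hx', RCLike.inner_apply, mul_comm]
  · refine integral_congr_ae ?_
    filter_upwards [h2.coeFn_toLp, h2'.coeFn_toLp] with x hx hx'
    rw [hx, hx', RCLike.inner_apply, mul_comm]

end Plancherel

/-- The Euclidean scalar product on the plane. -/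
def dot (a b : Plane) : ℝ := a 0 * b 0 + a 1 * b 1

/-- The Fourier transform on the plane with parameter `ħ`. -/
def ftP (ħ : ℝ) (g : Plane → ℂ) (P : Plane) : ℂ :=
  ∫ r, Complex.exp (-(I * (dot r P / ħ : ℝ))) * g r

/-- The identification of the plane with the Euclidean plane. -/
abbrev planeEquiv : Plane ≃ᵐ EuclideanSpace ℝ (Fin 2) := MeasurableEquiv.toLp 2 (Fin 2 → ℝ)

theorem planeEquiv_measurePreserving : MeasurePreserving planeEquiv volume volume :=
  PiLp.volume_preserving_toLp (Fin 2)

theorem ftP_eq {ħ : ℝ} (g : Plane → ℂ) (P : Plane) :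
    ftP ħ g P = (FourierTransform.fourier (g ∘ planeEquiv.symm) : EuclideanSpace ℝ (Fin 2) → ℂ)
      (planeEquiv ((2 * Real.pi * ħ)⁻¹ • P)) := by
  rw [Real.fourier_eq', ← planeEquiv_measurePreserving.integral_comp
    planeEquiv.measurableEmbedding, ftP]
  refine integral_congr_ae (Filter.Eventually.of_forall fun r => ?_)
  simp only [Function.comp_apply, MeasurableEquiv.symm_apply_apply, smul_eq_mul]
  congr 2
  rw [mul_comm I, ← neg_mul, ← ofReal_neg]
  congr 2
  simp [PiLp.inner_apply, Fin.sum_univ_two, dot]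
  have := Real.pi_ne_zero
  field_simp

theorem comp_planeEquiv_symm {g : Plane → ℂ} (h1 : Integrable g) (h2 : MemLp g 2) :
    Integrable (g ∘ planeEquiv.symm) ∧ MemLp (g ∘ planeEquiv.symm) 2 :=
  ⟨(planeEquiv_measurePreserving.symm planeEquiv).integrable_comp_of_integrable h1,
    h2.comp_measurePreserving (planeEquiv_measurePreserving.symm planeEquiv)⟩

theorem continuous_ftP {ħ : ℝ} {g : Plane → ℂ} (h1 : Integrable g) : Continuous (ftP ħ g) := by
  have h : Continuous planeEquiv := PiLp.continuous_toLp 2 _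
  have h1' := (planeEquiv_measurePreserving.symm planeEquiv).integrable_comp_of_integrable h1
  rw [show ftP ħ g = _ from funext fun P => ftP_eq g P]
  exact (continuous_fourier_of_integrable h1').comp (h.comp (by fun_prop))

theorem integral_ftP_scale {ħ : ℝ} (hħ : 0 < ħ) (f : EuclideanSpace ℝ (Fin 2) → ℂ) :
    ∫ P : Plane, f (planeEquiv ((2 * Real.pi * ħ)⁻¹ • P))
      = ((2 * Real.pi * ħ) ^ 2 : ℝ) * ∫ y, f y := by
  have h0 : 0 < 2 * Real.pi * ħ := by positivity
  rw [Measure.integral_comp_smul volume (fun P => f (planeEquiv P)),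
    planeEquiv_measurePreserving.integral_comp planeEquiv.measurableEmbedding, real_smul]
  congr 2
  rw [Module.finrank_fin_fun, inv_pow, inv_inv, abs_of_pos (by positivity)]

theorem memLp_ftP {ħ : ℝ} (hħ : 0 < ħ) {g : Plane → ℂ} (h1 : Integrable g) (h2 : MemLp g 2) :
    MemLp (ftP ħ g) 2 := by
  obtain ⟨h1', h2'⟩ := comp_planeEquiv_symm h1 h2
  have h := (memLp_two_iff_integrable_sq_norm
    (continuous_fourier_of_integrable h1').aestronglyMeasurable).1 (memLp_fourier h1' h2')
  rw [memLp_two_iff_integrable_sq_norm (continuous_ftP h1).aestronglyMeasurable]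
  simp_rw [ftP_eq]
  have h3 := planeEquiv_measurePreserving.integrable_comp_of_integrable h
  exact (integrable_comp_smul_iff volume _ (by positivity)).2 h3

/-- Plancherel's theorem on the plane. -/
theorem plancherel_ftP {ħ : ℝ} (hħ : 0 < ħ) {g g' : Plane → ℂ} (h1 : Integrable g)
    (h2 : MemLp g 2) (h1' : Integrable g') (h2' : MemLp g' 2) :
    ∫ P, conj (ftP ħ g P) * ftP ħ g' P
      = ((2 * Real.pi * ħ) ^ 2 : ℝ) * ∫ r, conj (g r) * g' r := by
  simp_rw [ftP_eq]
  obtain ⟨k1, k2⟩ := comp_planeEquiv_symm h1 h2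
  obtain ⟨k1', k2'⟩ := comp_planeEquiv_symm h1' h2'
  rw [integral_ftP_scale hħ (fun y => conj ((FourierTransform.fourier (g ∘ planeEquiv.symm) :
    EuclideanSpace ℝ (Fin 2) → ℂ) y) * (FourierTransform.fourier (g' ∘ planeEquiv.symm) :
    EuclideanSpace ℝ (Fin 2) → ℂ) y), integral_conj_fourier_mul_fourier k1 k2 k1' k2',
    ← planeEquiv_measurePreserving.integral_comp planeEquiv.measurableEmbedding]
  simp

/-- Translation becomes modulation, the ħ of the shift cancelling the 1/ħ of the kernel. This turns
a plane wave in p^NC into a translation of the wave function. -/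
theorem ftP_shift (ħ : ℝ) (hħ : ħ ≠ 0) (g : Plane → ℂ) (β P : Plane) :
    ftP ħ (fun r => g (r + ħ • β)) P = Complex.exp (I * (dot β P : ℝ)) * ftP ħ g P := by
  rw [ftP, ftP, ← integral_const_mul,
    ← integral_add_right_eq_self (fun r => Complex.exp (I * (dot β P : ℝ))
      * (Complex.exp (-(I * (dot r P / ħ : ℝ))) * g r)) (ħ • β)]
  refine integral_congr_ae (Filter.Eventually.of_forall fun r => ?_)
  simp only
  rw [← mul_assoc, ← Complex.exp_add]
  congr 2
  simp only [dot, Pi.add_apply, Pi.smul_apply, smul_eq_mul]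
  push_cast
  have : (ħ : ℂ) ≠ 0 := by exact_mod_cast hħ
  field_simp
  ring

end

end NCToeplitz

namespace NCToeplitz

noncomputable section

/-! ### The coherent state transform in the coordinates `(q^NC, p^NC)` -/

theorem continuous_ground (s : ℝ) : Continuous (ground s) := by
  unfold ground
  fun_prop

theorem ground_nonneg {s : ℝ} (hs : 0 < s) (r : Plane) : 0 ≤ ground s r := by
  unfold ground
  positivity

theorem ground_sq (s : ℝ) (r : Plane) : ground s r ^ 2
    = (1 / (√Real.pi * s)) ^ 2 * ∏ i, Real.exp (-(1 / s ^ 2) * r i ^ 2) := by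
  rw [ground, mul_pow, Fin.prod_univ_two, ← Real.exp_add, ← Real.exp_nat_mul]
  congr 2
  push_cast
  by_cases hs : s = 0
  · simp [hs]
  · field_simp
    ring

theorem integrable_ground_sq {s : ℝ} (hs : 0 < s) : Integrable (fun r => ground s r ^ 2) := by
  have hb : 0 < 1 / s ^ 2 := by positivity
  simp_rw [ground_sq]
  exact (Integrable.fintype_prod (f := fun (_ : Fin 2) (t : ℝ) => Real.exp (-(1 / s ^ 2) * t ^ 2))
    (fun _ => integrable_exp_neg_mul_sq hb)).const_mul _

theorem norm_ground_le {s : ℝ} (hs : 0 < s) (r : Plane) : ‖(ground s r : ℂ)‖ ≤ 1 / (√Real.pi * s) := by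
  rw [norm_real, Real.norm_of_nonneg (ground_nonneg hs r), ground]
  have h : Real.exp (-(1 / (2 * s ^ 2)) * (r 0 ^ 2 + r 1 ^ 2)) ≤ 1 := by
    rw [Real.exp_le_one_iff, neg_mul, neg_nonpos]
    positivity
  exact mul_le_of_le_one_right (by positivity) h

theorem memLp_ground_shift {s : ℝ} (hs : 0 < s) (Q : Plane) :
    MemLp (fun r => (ground s (r - Q) : ℂ)) 2 (volume : Measure Plane) := by
  have hc : Continuous (fun r => (ground s (r - Q) : ℂ)) :=
    continuous_ofReal.comp ((continuous_ground s).comp (by fun_prop))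
  rw [memLp_two_iff_integrable_sq_norm hc.aestronglyMeasurable]
  refine ((integrable_ground_sq hs).comp_sub_right Q).congr
    (Filter.Eventually.of_forall fun r => ?_)
  simp [sq_abs]

/-- `r ↦ η(r - Q) φ(r)`. -/
def win (s : ℝ) (φ : Plane → ℂ) (Q r : Plane) : ℂ := ground s (r - Q) * φ r

theorem integrable_win {s : ℝ} (hs : 0 < s) {φ : Plane → ℂ} (hφ : MemLp φ 2) (Q : Plane) :
    Integrable (win s φ Q) := (memLp_ground_shift hs Q).integrable_mul hφ

theorem memLp_win {s : ℝ} (hs : 0 < s) {φ : Plane → ℂ} (hφ : MemLp φ 2) (Q : Plane) :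
    MemLp (win s φ Q) 2 := by
  have hc : Continuous (fun r => (ground s (r - Q) : ℂ)) :=
    continuous_ofReal.comp ((continuous_ground s).comp (by fun_prop))
  have h : MemLp (fun r => (ground s (r - Q) : ℂ)) ∞ (volume : Measure Plane) :=
    memLp_top_of_bound hc.aestronglyMeasurable _
      (Filter.Eventually.of_forall fun r => norm_ground_le hs _)
  exact hφ.mul (r := 2) h

/-- With the window centre Q integrated first, translation invariance leaves the constant ∫η² times
|φ(r)|². The shift c covers the translated window of `integral_phase_wstd`. -/
theorem integrable_norm_sq_win_prod {s : ℝ} (hs : 0 < s) {φ : Plane → ℂ} (hφm : StronglyMeasurable φ)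
    (hφ : MemLp φ 2) (c : Plane) :
    Integrable (fun a : Plane × Plane => ‖(ground s (a.2 + c - a.1) : ℂ) * φ a.2‖ ^ 2)
      (volume.prod volume) := by
  have hm : AEStronglyMeasurable
      (fun a : Plane × Plane => ‖(ground s (a.2 + c - a.1) : ℂ) * φ a.2‖ ^ 2)
      (volume.prod volume) := by
    have hc : Continuous (fun a : Plane × Plane => (ground s (a.2 + c - a.1) : ℂ)) :=
      continuous_ofReal.comp ((continuous_ground s).comp (by fun_prop))
    exact ((hc.stronglyMeasurable.mul (hφm.comp_measurable measurable_snd)).norm.pow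
      2).aestronglyMeasurable
  have he : ∀ Q r : Plane, ‖(ground s (r + c - Q) : ℂ) * φ r‖ ^ 2
      = ground s (r + c - Q) ^ 2 * ‖φ r‖ ^ 2 := by
    intro Q r
    rw [norm_mul, mul_pow, norm_real, Real.norm_eq_abs, sq_abs]
  rw [integrable_prod_iff' hm]
  refine ⟨Filter.Eventually.of_forall fun r => ?_, ?_⟩
  · simp only [he]
    exact ((integrable_ground_sq hs).comp_sub_left (r + c)).mul_const _
  · have h2 : ∀ r : Plane, ∫ Q : Plane, ‖‖(ground s (r + c - Q) : ℂ) * φ r‖ ^ 2‖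
        = (∫ Q, ground s Q ^ 2) * ‖φ r‖ ^ 2 := by
      intro r
      simp only [norm_pow, norm_norm]
      simp only [he]
      rw [integral_mul_const, integral_sub_left_eq_self (fun Q => ground s Q ^ 2)]
    simp only [h2]
    exact ((memLp_two_iff_integrable_sq_norm hφ.1).1 hφ).const_mul _

theorem memLp_win_prod {s : ℝ} (hs : 0 < s) {φ : Plane → ℂ} (hφm : StronglyMeasurable φ)
    (hφ : MemLp φ 2) (c : Plane) :
    MemLp (fun a : Plane × Plane => (ground s (a.2 + c - a.1) : ℂ) * φ a.2) 2
      (volume.prod volume) := by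
  have hc : Continuous (fun a : Plane × Plane => (ground s (a.2 + c - a.1) : ℂ)) :=
    continuous_ofReal.comp ((continuous_ground s).comp (by fun_prop))
  refine (memLp_two_iff_integrable_sq_norm
    (hc.stronglyMeasurable.mul (hφm.comp_measurable measurable_snd)).aestronglyMeasurable).2 ?_
  exact integrable_norm_sq_win_prod hs hφm hφ c

/-- The coherent state transform in the coordinates `(q^NC, p^NC)`. -/
def wstd (ħ s : ℝ) (φ : Plane → ℂ) (a : Plane × Plane) : ℂ :=
  Complex.exp (I * (dot a.1 a.2 / (2 * ħ) : ℝ)) * ftP ħ (win s φ a.1) a.2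

theorem stronglyMeasurable_wstd (ħ s : ℝ) {φ : Plane → ℂ} (hφm : StronglyMeasurable φ) :
    StronglyMeasurable (wstd ħ s φ) := by
  have h1 : Continuous (fun a : Plane × Plane => Complex.exp (I * (dot a.1 a.2 / (2 * ħ) : ℝ))) := by
    unfold dot
    fun_prop
  refine h1.stronglyMeasurable.mul ?_
  have h2 : Continuous (fun b : (Plane × Plane) × Plane =>
      Complex.exp (-(I * (dot b.2 b.1.2 / ħ : ℝ))) * (ground s (b.2 - b.1.1) : ℂ)) := by
    refine Continuous.mul ?_ (continuous_ofReal.comp ((continuous_ground s).comp (by fun_prop)))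
    unfold dot
    fun_prop
  have h3 : StronglyMeasurable (fun b : (Plane × Plane) × Plane =>
      Complex.exp (-(I * (dot b.2 b.1.2 / ħ : ℝ))) * win s φ b.1.1 b.2) := by
    have h4 := h2.stronglyMeasurable.mul (hφm.comp_measurable measurable_snd)
    convert h4 using 1
    funext b
    simp only [win, Pi.mul_apply, Function.comp_apply]
    ring
  exact h3.integral_prod_right'

theorem norm_wstd (ħ s : ℝ) (φ : Plane → ℂ) (a : Plane × Plane) :
    ‖wstd ħ s φ a‖ = ‖ftP ħ (win s φ a.1) a.2‖ := by
  rw [wstd, norm_mul, mul_comm I, Complex.norm_exp_ofReal_mul_I, one_mul]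

/-- Plancherel in the momentum at fixed Q reduces the claim to the square integrability of the
windowed function in (Q, r). -/
theorem memLp_wstd {ħ s : ℝ} (hħ : 0 < ħ) (hs : 0 < s) {φ : Plane → ℂ} (hφm : StronglyMeasurable φ)
    (hφ : MemLp φ 2) : MemLp (wstd ħ s φ) 2 (volume.prod volume) := by
  have hm := stronglyMeasurable_wstd ħ s hφm
  rw [memLp_two_iff_integrable_sq_norm hm.aestronglyMeasurable]
  refine (integrable_prod_iff (hm.norm.pow 2).aestronglyMeasurable).2 ?_
  simp only [Pi.pow_apply, norm_wstd, norm_pow, norm_norm]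
  refine ⟨Filter.Eventually.of_forall fun Q => ?_, ?_⟩
  · have h := memLp_ftP hħ (integrable_win hs hφ Q) (memLp_win hs hφ Q)
    exact (memLp_two_iff_integrable_sq_norm h.1).1 h
  · have h1 : ∀ Q, ∫ P, ‖ftP ħ (win s φ Q) P‖ ^ 2
        = (2 * Real.pi * ħ) ^ 2 * ∫ r, ‖win s φ Q r‖ ^ 2 := by
      intro Q
      have h := plancherel_ftP hħ (integrable_win hs hφ Q) (memLp_win hs hφ Q)
        (integrable_win hs hφ Q) (memLp_win hs hφ Q)
      simp_rw [conj_mul'] at h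
      have h2 : ∀ f : Plane → ℂ, ∫ P, (‖f P‖ : ℂ) ^ 2 = ((∫ P, ‖f P‖ ^ 2 : ℝ) : ℂ) := by
        intro f
        rw [← integral_complex_ofReal]
        push_cast
        rfl
      rw [h2, h2] at h
      exact_mod_cast h
    simp only [h1]
    refine Integrable.const_mul ?_ _
    have h := (integrable_norm_sq_win_prod hs hφm hφ 0).integral_prod_left
    simpa [win] using h

/-- The Gaussian factor of the Weyl operator with parameters `(α, β)`. -/
def gam (ħ s : ℝ) (α β : Plane) : ℝ :=
  Real.exp (-(ħ ^ 2 * dot β β) / (4 * s ^ 2) - s ^ 2 * dot α α / 4)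

/-- About the midpoint r + c/2 the product of the two Gaussians is exp(-|c|²/4s²) times a single
Gaussian in Q, whose Fourier transform at α gives the factor exp(-s²|α|²/4). -/
theorem gaussian_integral {s : ℝ} (hs : 0 < s) (α r c : Plane) :
    ∫ Q : Plane, Complex.exp (I * (dot α Q : ℝ)) * ((ground s (r - Q) : ℂ) * ground s (r + c - Q))
      = Complex.exp (I * (dot α (r + (1 / 2 : ℝ) • c) : ℝ))
        * Real.exp (-(dot c c) / (4 * s ^ 2) - s ^ 2 * dot α α / 4) := by
  have hb : 0 < ((1 / s ^ 2 : ℝ) : ℂ).re := by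
    rw [ofReal_re]
    positivity
  have hsc : (s : ℂ) ≠ 0 := by exact_mod_cast hs.ne'
  have hpi : (√Real.pi : ℂ) ^ 2 = Real.pi := by
    exact_mod_cast Real.sq_sqrt Real.pi_pos.le
  have hpi0 : (Real.pi : ℂ) ≠ 0 := by exact_mod_cast Real.pi_ne_zero
  have h := GaussianFourier.integral_cexp_neg_mul_sum_add (ι := Fin 2) hb
    (fun i => -(I * (α i : ℂ)))
  rw [← integral_sub_left_eq_self _ volume (r + (1 / 2 : ℝ) • c)]
  have e : ∀ u : Plane, Complex.exp (I * (dot α (r + (1 / 2 : ℝ) • c - u) : ℝ))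
      * ((ground s (r - (r + (1 / 2 : ℝ) • c - u)) : ℂ)
        * ground s (r + c - (r + (1 / 2 : ℝ) • c - u)))
      = (Complex.exp (I * (dot α (r + (1 / 2 : ℝ) • c) : ℝ)) * ((1 / (√Real.pi * s) : ℝ) : ℂ) ^ 2
        * Complex.exp (-(dot c c) / (4 * s ^ 2) : ℝ))
        * Complex.exp (-((1 / s ^ 2 : ℝ) : ℂ) * ∑ i, (u i : ℂ) ^ 2
          + ∑ i, -(I * (α i : ℂ)) * u i) := by
    intro u
    simp only [ground, ofReal_mul, ofReal_exp]
    have key : ∀ A B C D E G k : ℂ, A + B + C = D + E + G →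
        cexp A * (k * cexp B * (k * cexp C)) = cexp D * k ^ 2 * cexp E * cexp G := by
      intro A B C D E G k hk
      have h1 := congrArg cexp hk
      simp only [Complex.exp_add] at h1
      linear_combination k ^ 2 * h1
    refine key _ _ _ _ _ _ _ ?_
    simp only [dot, Fin.sum_univ_two, Pi.sub_apply, Pi.add_apply, Pi.smul_apply, smul_eq_mul]
    push_cast
    field_simp
    ring
  simp_rw [e]
  rw [integral_const_mul, h]
  have e2 : ((Real.pi : ℂ) / ((1 / s ^ 2 : ℝ) : ℂ)) ^ ((Fintype.card (Fin 2) : ℂ) / 2)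
      = Real.pi * s ^ 2 := by
    rw [Fintype.card_fin]
    push_cast
    rw [div_self two_ne_zero, cpow_one]
    field_simp
  rw [e2, sub_eq_add_neg, Real.exp_add]
  push_cast
  have e3 : (∑ i, (-(I * (α i : ℂ))) ^ 2) / (4 * (1 / (s : ℂ) ^ 2)) = -((s : ℂ) ^ 2 * dot α α / 4) := by
    simp only [Fin.sum_univ_two, dot]
    push_cast
    field_simp
    linear_combination (((α 0 : ℂ)) ^ 2 + (α 1 : ℂ) ^ 2) * I_sq
  rw [e3]
  field_simp
  rw [hpi]

end

end NCToeplitz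

namespace NCToeplitz

noncomputable section

/-! ### The Weyl operators -/

theorem norm_exp_I_mul (t : ℝ) : ‖Complex.exp (I * (t : ℝ))‖ = 1 := by
  rw [mul_comm, Complex.norm_exp_ofReal_mul_I]

theorem MemLp.integrable_phase_mul {α : Type*} [MeasurableSpace α] {μ : Measure α}
    {f g : α → ℂ} (hf : MemLp f 2 μ) (hg : MemLp g 2 μ) {e : α → ℝ} (he : AEStronglyMeasurable e μ) :
    Integrable (fun a => Complex.exp (I * (e a : ℝ)) * (conj (f a) * g a)) μ := by
  refine (hf.star.integrable_mul hg).bdd_mul (c := 1) ?_ ?_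
  · exact (by fun_prop : Continuous fun t : ℝ => Complex.exp (I * (t : ℝ))).comp_aestronglyMeasurable he
  · exact Filter.Eventually.of_forall fun a => (norm_exp_I_mul _).le

/-- The matrix elements of a plane wave in the coherent state representation. -/
theorem integral_phase_wstd {ħ s : ℝ} (hħ : 0 < ħ) (hs : 0 < s) (α β : Plane) {φ ψ : Plane → ℂ}
    (hφm : StronglyMeasurable φ) (hφ : MemLp φ 2) (hψm : StronglyMeasurable ψ) (hψ : MemLp ψ 2) :
    ∫ a : Plane × Plane, Complex.exp (I * (dot α a.1 + dot β a.2 : ℝ))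
        * (conj (wstd ħ s φ a) * wstd ħ s ψ a) ∂(volume.prod volume)
      = ((2 * Real.pi * ħ) ^ 2 : ℝ) * (gam ħ s α β * ∫ r, conj (φ r)
        * (Complex.exp (I * (dot α (r + (ħ / 2) • β) : ℝ)) * ψ (r + ħ • β))) := by
  have hmp := measurePreserving_add_right (volume : Measure Plane) (ħ • β)
  have hψ' : MemLp (fun r => ψ (r + ħ • β)) 2 := hψ.comp_measurePreserving hmp
  have hψm' : StronglyMeasurable (fun r => ψ (r + ħ • β)) := hψm.comp_measurable (by fun_prop)
  have hdot : ∀ v : Plane, Continuous (fun r => dot v r) := by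
    intro v
    unfold dot
    fun_prop
  have hc1 : Continuous (fun a : Plane × Plane => dot α a.1 + dot β a.2) :=
    ((hdot α).comp continuous_fst).add ((hdot β).comp continuous_snd)
  rw [integral_prod _ (MemLp.integrable_phase_mul (memLp_wstd hħ hs hφm hφ)
    (memLp_wstd hħ hs hψm hψ) hc1.aestronglyMeasurable)]
  -- At fixed Q the factor exp(iβ·P) is a translation by ħβ before the Fourier transform, and the
  -- phases exp(iQ·P/2ħ) cancel; Plancherel then replaces the integral over P by one over r. The
  -- summand 0 brings the first factor to the shape of `memLp_win_prod`.
  have h1 : ∀ Q : Plane, ∫ P : Plane, Complex.exp (I * (dot α Q + dot β P : ℝ))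
        * (conj (wstd ħ s φ (Q, P)) * wstd ħ s ψ (Q, P))
      = ((2 * Real.pi * ħ) ^ 2 : ℝ) * ∫ r : Plane, Complex.exp (I * (dot α Q : ℝ))
        * (conj ((ground s (r + 0 - Q) : ℂ) * φ r)
          * ((ground s (r + ħ • β - Q) : ℂ) * ψ (r + ħ • β))) := by
    intro Q
    have h2 : Integrable (fun r => win s ψ Q (r + ħ • β)) :=
      hmp.integrable_comp_of_integrable (integrable_win hs hψ Q)
    have h3 : MemLp (fun r => win s ψ Q (r + ħ • β)) 2 :=
      (memLp_win hs hψ Q).comp_measurePreserving hmp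
    have h4 := plancherel_ftP hħ (integrable_win hs hφ Q) (memLp_win hs hφ Q) h2 h3
    simp_rw [ftP_shift ħ hħ.ne' (win s ψ Q)] at h4
    rw [integral_const_mul, mul_left_comm]
    have h5 : ∀ r, win s φ Q r = (ground s (r + 0 - Q) : ℂ) * φ r := by simp [win]
    simp_rw [h5] at h4
    refine Eq.trans ?_ (congrArg (fun z => Complex.exp (I * (dot α Q : ℝ)) * z) h4)
    rw [← integral_const_mul]
    refine integral_congr_ae (Filter.Eventually.of_forall fun P => ?_)
    have h6 : ∀ z : ℂ, conj (Complex.exp (I * (dot Q P / (2 * ħ) : ℝ))) * Complex.exp (I * (dot Q P / (2 * ħ) : ℝ)) * z = z := by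
      intro z
      rw [conj_mul', norm_exp_I_mul]
      simp
    simp only [wstd, map_mul]
    rw [ofReal_add, mul_add, Complex.exp_add]
    linear_combination h6 (cexp (I * (dot α Q : ℝ)) * cexp (I * (dot β P : ℝ))
      * (conj (ftP ħ (win s φ Q) P) * ftP ħ (win s ψ Q) P))
  simp_rw [h1]
  rw [integral_const_mul]
  congr 1
  -- Joint integrability in (Q, r) permits integrating over Q first, which leaves the Gaussian
  -- integral with c = ħβ.
  have hint := MemLp.integrable_phase_mul (memLp_win_prod hs hφm hφ 0)
    (memLp_win_prod hs hψm' hψ' (ħ • β))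
    ((hdot α).comp continuous_fst).aestronglyMeasurable
  rw [integral_integral_swap hint, ← integral_const_mul]
  refine integral_congr_ae (Filter.Eventually.of_forall fun r => ?_)
  have h8 := gaussian_integral hs α r (ħ • β)
  have h9 : (1 / 2 : ℝ) • ħ • β = (ħ / 2) • β := by
    rw [smul_smul]
    congr 1
    ring
  have h10 : dot (ħ • β) (ħ • β) = ħ ^ 2 * dot β β := by
    simp only [dot, Pi.smul_apply, smul_eq_mul]
    ring
  rw [h9, h10] at h8
  simp only [add_zero, map_mul, conj_ofReal]
  have h11 : ∀ Q : Plane, cexp (I * (dot α Q : ℝ)) * ((ground s (r - Q) : ℂ) * conj (φ r)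
      * ((ground s (r + ħ • β - Q) : ℂ) * ψ (r + ħ • β)))
      = cexp (I * (dot α Q : ℝ)) * ((ground s (r - Q) : ℂ) * ground s (r + ħ • β - Q))
        * (conj (φ r) * ψ (r + ħ • β)) := by
    intro Q
    ring
  simp_rw [h11]
  rw [integral_mul_const, h8, gam]
  ring

end

end NCToeplitz

namespace NCToeplitz

noncomputable section

/-! ### The coherent state transform as an isometry -/

/-- The map `(q, p) ↦ (q^NC, p^NC)`. -/
def ncMap (ħ ϑ 𝓑 : ℝ) : Phase →ₗ[ℝ] Phase where
  toFun x := (qNC ħ ϑ x, pNC ħ 𝓑 x)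
  map_add' x y := by
    refine Prod.ext (funext fun k => ?_) (funext fun k => ?_) <;> fin_cases k <;>
      simp [qNC, pNC] <;> ring
  map_smul' c x := by
    refine Prod.ext (funext fun k => ?_) (funext fun k => ?_) <;> fin_cases k <;>
      simp [qNC, pNC] <;> ring

theorem ncMap_apply (ħ ϑ 𝓑 : ℝ) (x : Phase) : ncMap ħ ϑ 𝓑 x = (qNC ħ ϑ x, pNC ħ 𝓑 x) := rfl

theorem det_ncMap (ħ ϑ 𝓑 : ℝ) : LinearMap.det (ncMap ħ ϑ 𝓑) = 1 - 𝓑 / ħ * (ϑ / ħ) := by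
  let b := (Pi.basisFun ℝ (Fin 2)).prod (Pi.basisFun ℝ (Fin 2))
  have h : LinearMap.toMatrix b b (ncMap ħ ϑ 𝓑)
      = Matrix.fromBlocks 1 !![0, 0; ϑ / ħ, 0] !![0, 𝓑 / ħ; 0, 0] 1 := by
    ext i j
    rw [LinearMap.toMatrix_apply]
    rcases i with i | i <;> rcases j with j | j <;> fin_cases i <;> fin_cases j <;>
      simp [b, ncMap_apply, qNC, pNC]
  rw [← LinearMap.det_toMatrix b, h, Matrix.det_fromBlocks_one₁₁, Matrix.det_fin_two]
  simp

/-- The Jacobian |1 - BT| cancels against the density of ν. The remaining (2πħ)⁻² will cancel the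
constant in Plancherel's formula. -/
theorem measurePreserving_ncMap {ħ ϑ 𝓑 : ℝ} (hħ : 0 < ħ) (h : ħ ^ 2 - 𝓑 * ϑ ≠ 0) :
    MeasurePreserving (ncMap ħ ϑ 𝓑) (nu ħ ϑ 𝓑)
      (ENNReal.ofReal (((2 * Real.pi * ħ) ^ 2)⁻¹) • volume.prod volume) := by
  have h' := one_sub_ne_zero hħ h
  refine ⟨(ncMap ħ ϑ 𝓑).continuous_of_finiteDimensional.measurable, ?_⟩
  have : (volume : Measure Phase).IsAddHaarMeasure :=
    Measure.prod.instIsAddHaarMeasure (volume : Measure Plane) (volume : Measure Plane)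
  have h1 := Measure.map_linearMap_addHaar_eq_smul_addHaar (volume : Measure Phase)
    (f := ncMap ħ ϑ 𝓑) (by rw [det_ncMap]; exact h')
  rw [nu, Measure.map_smul, h1, det_ncMap, smul_smul, ← ENNReal.ofReal_mul (by positivity),
    ← Measure.volume_eq_prod]
  congr 2
  have e : ħ ^ 2 - 𝓑 * ϑ = ħ ^ 2 * (1 - 𝓑 / ħ * (ϑ / ħ)) := by
    field_simp
  have h2 : |1 - 𝓑 / ħ * (ϑ / ħ)| ≠ 0 := abs_ne_zero.2 h'
  rw [e, abs_mul, abs_inv, abs_of_pos (by positivity : (0 : ℝ) < ħ ^ 2)]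
  have := Real.pi_ne_zero
  field_simp
  ring

/-- With Q = q^NC and P = p^NC the phase of the coherent state is just (r - Q/2)·P/ħ: the terms in ϑ
and 𝓑 are exactly those produced by the substitution, and the window is centred at Q. -/
theorem cohTransform_eq_wstd {ħ : ℝ} (hħ : 0 < ħ) (ϑ 𝓑 s : ℝ) (φ : Lp ℂ 2 (volume : Measure Plane))
    (x : Phase) : cohTransform ħ ϑ 𝓑 s φ x = wstd ħ s φ (ncMap ħ ϑ 𝓑 x) := by
  rw [cohTransform, wstd, ftP, ← integral_const_mul]
  refine integral_congr_ae (Filter.Eventually.of_forall fun r => ?_)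
  have e : (![r 0 - x.1 0, r 1 - x.1 1 - ϑ / ħ * x.2 0] : Plane) = r - (ncMap ħ ϑ 𝓑 x).1 := by
    funext k
    fin_cases k <;> simp [ncMap_apply, qNC]
    ring
  have hħ' : (ħ : ℂ) ≠ 0 := by exact_mod_cast hħ.ne'
  have key : ∀ {A B C k f : ℂ}, A = B + C → cexp A * k * f = cexp B * (cexp C * (k * f)) := by
    intro A B C k f hA
    rw [hA, Complex.exp_add]
    ring
  simp only [cohState, win, map_mul, conj_ofReal, ← exp_conj, e, conj_I]
  refine key ?_
  simp only [ncMap_apply, dot, qNC, pNC, Matrix.cons_val_zero, Matrix.cons_val_one]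
  push_cast
  field_simp
  ring

theorem memLp_cohTransform {ħ ϑ 𝓑 s : ℝ} (hħ : 0 < ħ) (hs : 0 < s) (h : ħ ^ 2 - 𝓑 * ϑ ≠ 0)
    (φ : Lp ℂ 2 (volume : Measure Plane)) : MemLp (cohTransform ħ ϑ 𝓑 s φ) 2 (nu ħ ϑ 𝓑) := by
  have h1 := (memLp_wstd hħ hs (Lp.stronglyMeasurable φ) (Lp.memLp φ)).smul_measure
    (c := ENNReal.ofReal (((2 * Real.pi * ħ) ^ 2)⁻¹)) ENNReal.ofReal_ne_top
  have h2 := h1.comp_measurePreserving (measurePreserving_ncMap hħ h)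
  exact (memLp_congr_ae (Filter.Eventually.of_forall fun x =>
    cohTransform_eq_wstd hħ ϑ 𝓑 s φ x)).2 h2

/-- The frequency dual to `q^NC`. -/
def dualQ (B T : ℝ) (θ : Fin 4 → ℝ) : Plane := ![θ 2, (θ 3 - B * θ 0) / (1 - B * T)]

/-- The frequency dual to `p^NC`. -/
def dualP (B T : ℝ) (θ : Fin 4 → ℝ) : Plane := ![(θ 0 - T * θ 3) / (1 - B * T), θ 1]

/-- The dual frequencies are the image of θ under the inverse transpose of `ncMap`. -/
theorem pairing_eq {ħ ϑ 𝓑 : ℝ} (hħ : 0 < ħ) (h : ħ ^ 2 - 𝓑 * ϑ ≠ 0) (θ : Fin 4 → ℝ) (x : Phase) :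
    pairing θ x = dot (dualQ (𝓑 / ħ) (ϑ / ħ) θ) (ncMap ħ ϑ 𝓑 x).1
      + dot (dualP (𝓑 / ħ) (ϑ / ħ) θ) (ncMap ħ ϑ 𝓑 x).2 := by
  have h' := one_sub_ne_zero hħ h
  simp only [pairing, dot, dualQ, dualP, ncMap_apply, qNC, pNC, Matrix.cons_val_zero,
    Matrix.cons_val_one]
  field_simp [h']
  ring

theorem weyl_memLp (ħ : ℝ) (α β : Plane) (ψ : Lp ℂ 2 (volume : Measure Plane)) :
    MemLp (fun r => Complex.exp (I * (dot α (r + (ħ / 2) • β) : ℝ)) * ψ (r + ħ • β)) 2 := by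
  have h1 : MemLp (fun r => ψ (r + ħ • β)) 2 :=
    (Lp.memLp ψ).comp_measurePreserving (measurePreserving_add_right volume (ħ • β))
  have hc : Continuous (fun r => Complex.exp (I * (dot α (r + (ħ / 2) • β) : ℝ))) := by
    unfold dot
    fun_prop
  exact h1.mul (memLp_top_of_bound hc.aestronglyMeasurable 1
    (Filter.Eventually.of_forall fun r => (norm_exp_I_mul _).le))

/-- The Weyl operator `(Uψ)(r) = exp(i α·(r + ħβ/2)) ψ(r + ħβ)`. -/
def weyl (ħ : ℝ) (α β : Plane) (ψ : Lp ℂ 2 (volume : Measure Plane)) :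
    Lp ℂ 2 (volume : Measure Plane) := (weyl_memLp ħ α β ψ).toLp _

theorem weyl_ae (ħ : ℝ) (α β : Plane) (ψ : Lp ℂ 2 (volume : Measure Plane)) :
    weyl ħ α β ψ =ᵐ[volume]
      fun r => Complex.exp (I * (dot α (r + (ħ / 2) • β) : ℝ)) * ψ (r + ħ • β) :=
  MemLp.coeFn_toLp _

theorem weyl_zero (ħ : ℝ) (ψ : Lp ℂ 2 (volume : Measure Plane)) : weyl ħ 0 0 ψ = ψ := by
  refine Lp.ext ?_
  filter_upwards [weyl_ae ħ 0 0 ψ] with r hr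
  rw [hr]
  simp [dot]

theorem weyl_weyl (ħ : ℝ) (α β α' β' : Plane) (ψ : Lp ℂ 2 (volume : Measure Plane)) :
    weyl ħ α β (weyl ħ α' β' ψ)
      = Complex.exp (I * (ħ / 2 * (dot α' β - dot α β') : ℝ)) • weyl ħ (α + α') (β + β') ψ := by
  refine Lp.ext ?_
  -- The almost everywhere formula for the inner operator is needed at r + ħβ; translations preserve
  -- null sets.
  have h1 := (measurePreserving_add_right (volume : Measure Plane)
    (ħ • β)).quasiMeasurePreserving.ae (weyl_ae ħ α' β' ψ)
  filter_upwards [weyl_ae ħ α β (weyl ħ α' β' ψ), weyl_ae ħ (α + α') (β + β') ψ, h1,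
    Lp.coeFn_smul (Complex.exp (I * (ħ / 2 * (dot α' β - dot α β') : ℝ)))
      (weyl ħ (α + α') (β + β') ψ)] with r hr1 hr2 hr3 hr4
  rw [hr1, hr4, Pi.smul_apply, hr2, hr3, smul_eq_mul, smul_add ħ, ← add_assoc, ← mul_assoc,
    ← mul_assoc, ← Complex.exp_add, ← Complex.exp_add]
  congr 2
  simp only [dot, Pi.add_apply, Pi.smul_apply, smul_eq_mul]
  push_cast
  ring

/-- `W` with values in `L²(ℝ⁴, dν)`. -/
def cohVec {ħ ϑ 𝓑 s : ℝ} (hħ : 0 < ħ) (hs : 0 < s) (h : ħ ^ 2 - 𝓑 * ϑ ≠ 0)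
    (φ : Lp ℂ 2 (volume : Measure Plane)) : Lp ℂ 2 (nu ħ ϑ 𝓑) :=
  (memLp_cohTransform hħ hs h φ).toLp _

section Weyl

variable {ħ ϑ 𝓑 s : ℝ} (hħ : 0 < ħ) (hs : 0 < s) (h : ħ ^ 2 - 𝓑 * ϑ ≠ 0)

theorem cohVec_ae (φ : Lp ℂ 2 (volume : Measure Plane)) :
    cohVec hħ hs h φ =ᵐ[nu ħ ϑ 𝓑] cohTransform ħ ϑ 𝓑 s φ := MemLp.coeFn_toLp _

/-- `integral_phase_wstd` transported by `ncMap`, the two powers of 2πħ cancelling. These are all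
the matrix elements of the Toeplitz operator of a plane wave. -/
theorem integral_echar_cohVec (θ : Fin 4 → ℝ) (φ ψ : Lp ℂ 2 (volume : Measure Plane)) :
    ∫ x, conj (cohVec hħ hs h φ x) * (echar θ x * cohVec hħ hs h ψ x) ∂(nu ħ ϑ 𝓑)
      = gam ħ s (dualQ (𝓑 / ħ) (ϑ / ħ) θ) (dualP (𝓑 / ħ) (ϑ / ħ) θ)
        * inner ℂ φ (weyl ħ (dualQ (𝓑 / ħ) (ϑ / ħ) θ) (dualP (𝓑 / ħ) (ϑ / ħ) θ) ψ) := by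
  set α := dualQ (𝓑 / ħ) (ϑ / ħ) θ with hα
  set β := dualP (𝓑 / ħ) (ϑ / ħ) θ with hβ
  have h1 := integral_phase_wstd hħ hs α β (Lp.stronglyMeasurable φ) (Lp.memLp φ)
    (Lp.stronglyMeasurable ψ) (Lp.memLp ψ)
  have hmp := measurePreserving_ncMap hħ h
  set g : Phase → ℂ := fun a => Complex.exp (I * (dot α a.1 + dot β a.2 : ℝ))
        * (conj (wstd ħ s φ a) * wstd ħ s ψ a) with hg
  have hgm : StronglyMeasurable g := by
    refine StronglyMeasurable.mul ?_ ((continuous_conj.comp_stronglyMeasurable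
      (stronglyMeasurable_wstd ħ s (Lp.stronglyMeasurable φ))).mul
      (stronglyMeasurable_wstd ħ s (Lp.stronglyMeasurable ψ)))
    refine Continuous.stronglyMeasurable ?_
    unfold dot
    fun_prop
  have h2 : ∫ x, conj (cohVec hħ hs h φ x) * (echar θ x * cohVec hħ hs h ψ x) ∂(nu ħ ϑ 𝓑)
      = ∫ x, g (ncMap ħ ϑ 𝓑 x) ∂(nu ħ ϑ 𝓑) := by
    refine integral_congr_ae ?_
    filter_upwards [cohVec_ae hħ hs h φ, cohVec_ae hħ hs h ψ] with x hx hx'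
    rw [hx, hx', cohTransform_eq_wstd hħ, cohTransform_eq_wstd hħ, echar, pairing_eq hħ h]
    simp only [hg]
    ring
  have h3 : ∫ x, g (ncMap ħ ϑ 𝓑 x) ∂(nu ħ ϑ 𝓑)
      = ∫ a, g a ∂(ENNReal.ofReal (((2 * Real.pi * ħ) ^ 2)⁻¹) • volume.prod volume) := by
    rw [← hmp.map_eq, integral_map hmp.aemeasurable hgm.aestronglyMeasurable]
  have hpos : (0 : ℝ) < (2 * Real.pi * ħ) ^ 2 := by positivity
  rw [h2, h3, integral_smul_measure, h1, ENNReal.toReal_ofReal (by positivity), real_smul,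
    ← mul_assoc, ← ofReal_mul, inv_mul_cancel₀ hpos.ne', ofReal_one, one_mul, L2.inner_def]
  congr 1
  refine integral_congr_ae ?_
  filter_upwards [weyl_ae ħ α β ψ] with r hr
  rw [hr, RCLike.inner_apply, mul_comm]

/-- The case θ = 0, where both the Gaussian factor and the Weyl operator are trivial. -/
theorem inner_cohVec (φ ψ : Lp ℂ 2 (volume : Measure Plane)) :
    inner ℂ (cohVec hħ hs h φ) (cohVec hħ hs h ψ) = inner ℂ φ ψ := by
  have h1 := integral_echar_cohVec hħ hs h 0 φ ψ
  have e1 : ∀ B T, dualQ B T 0 = 0 := fun B T => by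
    funext k
    fin_cases k <;> simp [dualQ]
  have e2 : ∀ B T, dualP B T 0 = 0 := fun B T => by
    funext k
    fin_cases k <;> simp [dualP]
  rw [e1, e2, weyl_zero, gam] at h1
  simp only [dot, Pi.zero_apply, mul_zero, add_zero, neg_zero, zero_div, sub_zero, Real.exp_zero,
    ofReal_one, one_mul] at h1
  rw [← h1, L2.inner_def]
  refine integral_congr_ae (Filter.Eventually.of_forall fun x => ?_)
  simp only [RCLike.inner_apply, echar, pairing, Pi.zero_apply, zero_mul, add_zero, ofReal_zero,
    mul_zero, Complex.exp_zero, one_mul]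
  ring

theorem cohVec_add (φ ψ : Lp ℂ 2 (volume : Measure Plane)) :
    cohVec hħ hs h (φ + ψ) = cohVec hħ hs h φ + cohVec hħ hs h ψ := by
  refine Lp.ext ?_
  filter_upwards [cohVec_ae hħ hs h φ, cohVec_ae hħ hs h ψ, cohVec_ae hħ hs h (φ + ψ),
    Lp.coeFn_add (cohVec hħ hs h φ) (cohVec hħ hs h ψ)] with x h1 h2 h3 h4
  rw [h3, h4, Pi.add_apply, h1, h2]
  unfold cohTransform
  rw [← integral_add (integrable_cohState_mul' ħ ϑ 𝓑 s x φ) (integrable_cohState_mul' ħ ϑ 𝓑 s x ψ)]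
  refine integral_congr_ae ?_
  filter_upwards [Lp.coeFn_add φ ψ] with r hr
  rw [hr, Pi.add_apply, mul_add]

theorem cohVec_smul (c : ℂ) (φ : Lp ℂ 2 (volume : Measure Plane)) :
    cohVec hħ hs h (c • φ) = c • cohVec hħ hs h φ := by
  refine Lp.ext ?_
  filter_upwards [cohVec_ae hħ hs h φ, cohVec_ae hħ hs h (c • φ),
    Lp.coeFn_smul c (cohVec hħ hs h φ)] with x h1 h2 h3
  rw [h2, h3, Pi.smul_apply, h1]
  unfold cohTransform
  rw [← integral_smul]
  refine integral_congr_ae ?_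
  filter_upwards [Lp.coeFn_smul c φ] with r hr
  simp only [hr, Pi.smul_apply, smul_eq_mul]
  ring

/-- `W` as a linear isometry. -/
def cohIsometry : Lp ℂ 2 (volume : Measure Plane) →ₗᵢ[ℂ] Lp ℂ 2 (nu ħ ϑ 𝓑) :=
  LinearMap.isometryOfInner
    { toFun := cohVec hħ hs h
      map_add' := cohVec_add hħ hs h
      map_smul' := cohVec_smul hħ hs h } (inner_cohVec hħ hs h)

theorem mem_cohRange_iff (u : Lp ℂ 2 (nu ħ ϑ 𝓑)) :
    u ∈ cohRange ħ ϑ 𝓑 s ↔ ∃ φ, cohVec hħ hs h φ = u := by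
  constructor
  · rintro ⟨φ, hφ⟩
    exact ⟨φ, Lp.ext ((cohVec_ae hħ hs h φ).trans hφ.symm)⟩
  · rintro ⟨φ, rfl⟩
    exact ⟨φ, cohVec_ae hħ hs h φ⟩

-- An isometry defined on a complete space has closed range.
include hħ hs h in
theorem isClosed_cohRange : IsClosed (cohRange ħ ϑ 𝓑 s : Set (Lp ℂ 2 (nu ħ ϑ 𝓑))) := by
  have h1 := (cohIsometry hħ hs h).isometry.isClosedEmbedding.isClosed_range
  have h2 : (cohRange ħ ϑ 𝓑 s : Set (Lp ℂ 2 (nu ħ ϑ 𝓑))) = Set.range (cohIsometry hħ hs h) := by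
    ext u
    exact mem_cohRange_iff hħ hs h u
  rw [h2]
  exact h1

theorem mem_cohSpace_iff (u : Lp ℂ 2 (nu ħ ϑ 𝓑)) :
    u ∈ cohSpace ħ ϑ 𝓑 s ↔ ∃ φ, cohVec hħ hs h φ = u := by
  rw [cohSpace, (isClosed_cohRange hħ hs h).submodule_topologicalClosure_eq,
    mem_cohRange_iff hħ hs h]

end Weyl

end

end NCToeplitz

namespace NCToeplitz

noncomputable section

/-! ### Toeplitz operators -/

section Toeplitz

variable {ħ ϑ 𝓑 s : ℝ}

theorem mulOp_ae {F : Phase → ℂ} (hF : MemLp F ∞ (nu ħ ϑ 𝓑)) (u : Lp ℂ 2 (nu ħ ϑ 𝓑)) :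
    mulOp ħ ϑ 𝓑 F u =ᵐ[nu ħ ϑ 𝓑] fun x => F x * u x := by
  rw [mulOp, dif_pos hF]
  filter_upwards [(ContinuousLinearMap.mul ℂ ℂ).coeFn_holder (r := 2) (hF.toLp F) u,
    hF.coeFn_toLp] with x h1 h2
  rw [ContinuousLinearMap.holderL_apply_apply, h1, h2, ContinuousLinearMap.mul_apply']

/-- Tested against vectors of 𝒲 the projection drops out, so Toeplitz operators can be handled
through integrals over the phase space. -/
theorem inner_toeplitz {F : Phase → ℂ} (hF : MemLp F ∞ (nu ħ ϑ 𝓑)) (u v : cohSpace ħ ϑ 𝓑 s) :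
    inner ℂ u (toeplitz ħ ϑ 𝓑 s F v)
      = ∫ x, conj ((u : Lp ℂ 2 (nu ħ ϑ 𝓑)) x) * (F x * (v : Lp ℂ 2 (nu ħ ϑ 𝓑)) x) ∂(nu ħ ϑ 𝓑) := by
  rw [toeplitz, ContinuousLinearMap.comp_apply,
    Submodule.inner_orthogonalProjectionOnto_eq_of_mem_left, L2.inner_def]
  refine integral_congr_ae ?_
  filter_upwards [mulOp_ae hF (v : Lp ℂ 2 (nu ħ ϑ 𝓑))] with x hx
  rw [ContinuousLinearMap.comp_apply, Submodule.subtypeL_apply, hx, RCLike.inner_apply, mul_comm]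

theorem memLp_top_of_continuous {F : Phase → ℂ} (hF : Continuous F) {C : ℝ} (hC : ∀ x, ‖F x‖ ≤ C) :
    MemLp F ∞ (nu ħ ϑ 𝓑) :=
  memLp_top_of_bound hF.aestronglyMeasurable C (Filter.Eventually.of_forall hC)

theorem memLp_top_of_isSymbol {F : Phase → ℂ} (hF : IsSymbol F) : MemLp F ∞ (nu ħ ϑ 𝓑) := by
  obtain ⟨C, hC⟩ := hF.2.exists_bound_of_continuous hF.1.continuous
  exact memLp_top_of_continuous hF.1.continuous hC

theorem memLp_top_echar (θ : Fin 4 → ℝ) : MemLp (echar θ) ∞ (nu ħ ϑ 𝓑) :=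
  memLp_top_of_continuous (continuous_echar.comp (continuous_const.prodMk continuous_id))
    fun x => (norm_echar θ x).le

theorem norm_toeplitz_le {F : Phase → ℂ} (hF : MemLp F ∞ (nu ħ ϑ 𝓑)) {C : ℝ} (hC0 : 0 ≤ C)
    (hC : ∀ x, ‖F x‖ ≤ C) : ‖toeplitz ħ ϑ 𝓑 s F‖ ≤ C := by
  refine ContinuousLinearMap.opNorm_le_bound _ hC0 fun v => ?_
  rw [toeplitz, ContinuousLinearMap.comp_apply]
  refine ((cohSpace ħ ϑ 𝓑 s).orthogonalProjectionOnto.le_opNorm _).trans ?_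
  refine (mul_le_of_le_one_left (norm_nonneg _)
    (cohSpace ħ ϑ 𝓑 s).orthogonalProjectionOnto_norm_le).trans ?_
  refine Lp.norm_le_mul_norm_of_ae_le_mul ?_
  filter_upwards [mulOp_ae hF (v : Lp ℂ 2 (nu ħ ϑ 𝓑))] with x hx
  rw [ContinuousLinearMap.comp_apply, Submodule.subtypeL_apply, hx, norm_mul]
  exact mul_le_mul_of_nonneg_right (hC x) (norm_nonneg _)

theorem norm_toeplitz_echar_le (θ : Fin 4 → ℝ) : ‖toeplitz ħ ϑ 𝓑 s (echar θ)‖ ≤ 1 :=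
  norm_toeplitz_le (memLp_top_echar θ) zero_le_one fun x => (norm_echar θ x).le

theorem mulOp_sum {ι : Type*} (A : Finset ι) (c : ι → ℂ) {F : ι → Phase → ℂ}
    (hF : ∀ i ∈ A, MemLp (F i) ∞ (nu ħ ϑ 𝓑)) :
    mulOp ħ ϑ 𝓑 (fun x => ∑ i ∈ A, c i * F i x) = ∑ i ∈ A, c i • mulOp ħ ϑ 𝓑 (F i) := by
  have hs : ∀ A' ⊆ A, MemLp (fun x => ∑ i ∈ A', c i * F i x) ∞ (nu ħ ϑ 𝓑) := fun A' hA' =>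
    memLp_finsetSum A' fun i hi => (hF i (hA' hi)).const_mul (c i)
  classical
  induction A using Finset.induction_on with
  | empty =>
    ext1 u
    refine Lp.ext ?_
    filter_upwards [mulOp_ae (hs ∅ (Finset.Subset.refl _)) u,
      Lp.coeFn_zero ℂ 2 (nu ħ ϑ 𝓑)] with x h1 h2
    rw [h1, Finset.sum_empty, Finset.sum_empty, zero_mul]
    exact h2.symm
  | insert i A hi ih =>
    rw [Finset.sum_insert hi, ← ih (fun j hj => hF j (Finset.mem_insert_of_mem hj))
      (fun A' hA' => hs A' (hA'.trans (Finset.subset_insert i A)))]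
    ext1 u
    refine Lp.ext ?_
    rw [add_apply, smul_apply]
    filter_upwards [mulOp_ae (hs _ (Finset.Subset.refl _)) u,
      mulOp_ae (hs A (Finset.subset_insert i A)) u,
      mulOp_ae (hF i (Finset.mem_insert_self i A)) u,
      Lp.coeFn_add (c i • mulOp ħ ϑ 𝓑 (F i) u) (mulOp ħ ϑ 𝓑 (fun x => ∑ i ∈ A, c i * F i x) u),
      Lp.coeFn_smul (c i) (mulOp ħ ϑ 𝓑 (F i) u)] with x h1 h2 h3 h4 h5
    rw [h1, h4, Pi.add_apply, h2, h5, Pi.smul_apply, h3, Finset.sum_insert hi, smul_eq_mul]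
    ring

theorem toeplitz_sum {ι : Type*} (A : Finset ι) (c : ι → ℂ) {F : ι → Phase → ℂ}
    (hF : ∀ i ∈ A, MemLp (F i) ∞ (nu ħ ϑ 𝓑)) :
    toeplitz ħ ϑ 𝓑 s (fun x => ∑ i ∈ A, c i * F i x) = ∑ i ∈ A, c i • toeplitz ħ ϑ 𝓑 s (F i) := by
  ext1 v
  simp only [toeplitz, mulOp_sum A c hF, ContinuousLinearMap.comp_apply,
    sum_apply, smul_apply, map_sum, map_smul]

variable (hħ : 0 < ħ) (hs : 0 < s) (h : ħ ^ 2 - 𝓑 * ϑ ≠ 0)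

/-- The coherent state transform of `φ` as an element of `𝒲`. -/
def cohElem (φ : Lp ℂ 2 (volume : Measure Plane)) : cohSpace ħ ϑ 𝓑 s :=
  ⟨cohVec hħ hs h φ, (mem_cohSpace_iff hħ hs h _).2 ⟨φ, rfl⟩⟩

theorem exists_cohElem (v : cohSpace ħ ϑ 𝓑 s) : ∃ φ, cohElem hħ hs h φ = v := by
  obtain ⟨φ, hφ⟩ := (mem_cohSpace_iff hħ hs h _).1 v.2
  exact ⟨φ, Subtype.ext hφ⟩

/-- Every vector of 𝒲 is a transform, and W preserves inner products, so the matrix elements found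
in `integral_echar_cohVec` determine the operator. -/
theorem toeplitz_echar_cohElem (θ : Fin 4 → ℝ) (ψ : Lp ℂ 2 (volume : Measure Plane)) :
    toeplitz ħ ϑ 𝓑 s (echar θ) (cohElem hħ hs h ψ)
      = (gam ħ s (dualQ (𝓑 / ħ) (ϑ / ħ) θ) (dualP (𝓑 / ħ) (ϑ / ħ) θ) : ℂ)
        • cohElem hħ hs h (weyl ħ (dualQ (𝓑 / ħ) (ϑ / ħ) θ) (dualP (𝓑 / ħ) (ϑ / ħ) θ) ψ) := by
  refine ext_inner_left ℂ fun u => ?_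
  obtain ⟨φ, rfl⟩ := exists_cohElem hħ hs h u
  rw [inner_toeplitz (memLp_top_echar θ)]
  have e := inner_smul_right (𝕜 := ℂ) (cohElem hħ hs h φ)
    (cohElem hħ hs h (weyl ħ (dualQ (𝓑 / ħ) (ϑ / ħ) θ) (dualP (𝓑 / ħ) (ϑ / ħ) θ) ψ))
    (gam ħ s (dualQ (𝓑 / ħ) (ϑ / ħ) θ) (dualP (𝓑 / ħ) (ϑ / ħ) θ) : ℂ)
  refine (integral_echar_cohVec hħ hs h θ φ ψ).trans (Eq.trans ?_ e.symm)
  congr 1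
  exact (inner_cohVec hħ hs h _ _).symm

/-- The exponent in the composition law of the Weyl operators. -/
def twist (ħ s : ℝ) (α β α' β' : Plane) : ℂ :=
  (ħ ^ 2 * dot β β' / (2 * s ^ 2) + s ^ 2 * dot α α' / 2 : ℝ)
    + I * (ħ / 2 * (dot α' β - dot α β') : ℝ)

/-- The Gaussian factor of a sum differs from the product of the Gaussian factors by the cross terms
of a quadratic form. They are the real part of the twist; the Weyl phase is its imaginary part. -/
theorem gam_mul_gam (ħ s : ℝ) (α β α' β' : Plane) :
    (gam ħ s α' β' : ℂ) * gam ħ s α β * Complex.exp (I * (ħ / 2 * (dot α' β - dot α β') : ℝ))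
      = Complex.exp (twist ħ s α β α' β') * gam ħ s (α + α') (β + β') := by
  unfold gam twist
  rw [ofReal_exp, ofReal_exp, ofReal_exp, ← Complex.exp_add, ← Complex.exp_add, ← Complex.exp_add]
  congr 1
  simp only [dot, Pi.add_apply]
  push_cast
  ring

theorem dualQ_add (B T : ℝ) (θ θ' : Fin 4 → ℝ) :
    dualQ B T (θ + θ') = dualQ B T θ + dualQ B T θ' := by
  funext k
  fin_cases k <;> simp [dualQ]
  ring

theorem dualP_add (B T : ℝ) (θ θ' : Fin 4 → ℝ) :
    dualP B T (θ + θ') = dualP B T θ + dualP B T θ' := by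
  funext k
  fin_cases k <;> simp [dualP]
  ring

include hħ hs h in
theorem toeplitz_echar_comp (θ θ' : Fin 4 → ℝ) :
    toeplitz ħ ϑ 𝓑 s (echar θ) ∘L toeplitz ħ ϑ 𝓑 s (echar θ')
      = Complex.exp (twist ħ s (dualQ (𝓑 / ħ) (ϑ / ħ) θ) (dualP (𝓑 / ħ) (ϑ / ħ) θ)
          (dualQ (𝓑 / ħ) (ϑ / ħ) θ') (dualP (𝓑 / ħ) (ϑ / ħ) θ'))
        • toeplitz ħ ϑ 𝓑 s (echar (θ + θ')) := by
  ext1 v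
  obtain ⟨ψ, rfl⟩ := exists_cohElem hħ hs h v
  have hsm : ∀ (c : ℂ) φ, cohElem hħ hs h (c • φ) = c • cohElem hħ hs h φ := fun c φ =>
    Subtype.ext (cohVec_smul hħ hs h c φ)
  rw [ContinuousLinearMap.comp_apply, smul_apply, toeplitz_echar_cohElem,
    toeplitz_echar_cohElem, map_smul, toeplitz_echar_cohElem, weyl_weyl, hsm, smul_smul, smul_smul,
    smul_smul, dualQ_add, dualP_add, gam_mul_gam]

/-- The composition law of the Toeplitz operators of plane waves in terms of the symbol of the
star product. -/
theorem twist_eq_symVal {B T S : ℝ} (hħ : 0 < ħ) (hS : 0 < S) (hBT : 1 - B * T ≠ 0)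
    (a : Freq × Freq) :
    twist ħ (√ħ * S) (dualQ B T (freq a.1)) (dualP B T (freq a.1)) (dualQ B T (freq a.2))
        (dualP B T (freq a.2))
      = ħ * symVal (tauP (vv B T S) (ww B T S)) a := by
  have hS' : (S : ℂ) ≠ 0 := by exact_mod_cast hS.ne'
  have hħ' : (ħ : ℂ) ≠ 0 := by exact_mod_cast hħ.ne'
  have h' : 1 - (B : ℂ) * T ≠ 0 := by exact_mod_cast hBT
  have h2 : (√2 : ℂ) ^ 2 = 2 := by
    exact_mod_cast Real.sq_sqrt (show (0 : ℝ) ≤ 2 by norm_num)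
  have h3 : (√ħ : ℂ) ^ 2 = ħ := by exact_mod_cast Real.sq_sqrt hħ.le
  -- Symbols are evaluated at i times the frequencies, and i² cancels the minus sign in τ.
  have e : symVal (tauP (vv B T S) (ww B T S)) a
      = ∑ k, (∑ i, vv B T S k i * freq a.1 i) * ∑ i, ww B T S k i * freq a.2 i := by
    simp only [symVal, tauP, linForm, map_neg, map_sum, map_mul, MvPolynomial.eval_C,
      MvPolynomial.eval_X, Matrix.cons_val_zero, Matrix.cons_val_one]
    rw [← Finset.sum_neg_distrib]
    refine Finset.sum_congr rfl fun k _ => ?_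
    simp only [mul_left_comm _ I, ← Finset.mul_sum]
    linear_combination (-(∑ i, vv B T S k i * freq a.1 i) * ∑ i, ww B T S k i * freq a.2 i) * I_sq
  rw [e]
  generalize freq a.1 = θ
  generalize freq a.2 = θ'
  -- In terms of the dual frequencies the linear forms are (Sα_k ± iβ_k/S)/√2; their product has the
  -- scalar products of the twist as real part and its antisymmetric form as imaginary part.
  have e2 : ∀ (k : Fin 2) (θ : Fin 4 → ℝ), ∑ i, vv B T S k i * θ i
      = (√2 / 2) * (S * dualQ B T θ k + I / S * dualP B T θ k) := by
    intro k θ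
    fin_cases k <;> simp [vv, dualQ, dualP, Fin.sum_univ_four] <;> field_simp <;> ring
  have e3 : ∀ (k : Fin 2) (θ : Fin 4 → ℝ), ∑ i, ww B T S k i * θ i
      = (√2 / 2) * (S * dualQ B T θ k - I / S * dualP B T θ k) := by
    intro k θ
    fin_cases k <;> simp [ww, dualQ, dualP, Fin.sum_univ_four] <;> field_simp <;> ring
  simp only [e2, e3, Fin.sum_univ_two, twist, dot]
  generalize dualQ B T θ = α
  generalize dualQ B T θ' = α'
  generalize dualP B T θ = β
  generalize dualP B T θ' = β'
  push_cast
  rw [mul_pow, h3]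
  field_simp
  ring_nf
  simp only [h2, I_sq]
  ring

end Toeplitz

end

end NCToeplitz

namespace NCToeplitz

noncomputable section

/-! ### The remainder of the exponential series -/

/-- The derivative of t ↦ R_{N+1}(tz) is z R_N(tz), and |e^{tz}| ≤ max(1, |e^z|) for 0 ≤ t ≤ 1
because Re(tz) lies between 0 and Re z. It matters that |e^z| appears and not e^{|z|}: only the
former is compensated by the operators. -/
theorem norm_exp_sub_sum_le (N : ℕ) (z : ℂ) :
    ‖Complex.exp z - ∑ j ∈ Finset.range N, z ^ j / (j.factorial : ℂ)‖
      ≤ ‖z‖ ^ N * max 1 ‖Complex.exp z‖ := by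
  induction N generalizing z with
  | zero => simp
  | succ N ih =>
    set f : ℝ → ℂ := fun t => Complex.exp (t * z)
      - ∑ j ∈ Finset.range (N + 1), (t * z) ^ j / (j.factorial : ℂ) with hf
    set f' : ℝ → ℂ := fun t => z * (Complex.exp (t * z)
      - ∑ j ∈ Finset.range N, (t * z) ^ j / (j.factorial : ℂ)) with hf'
    have hlin : ∀ t : ℝ, HasDerivAt (fun t : ℝ => (t : ℂ) * z) z t := fun t => by
      simpa using (Complex.ofRealCLM.hasDerivAt (x := t)).mul_const z
    have hd : ∀ t : ℝ, HasDerivAt f (f' t) t := by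
      intro t
      have h1 := (hlin t).cexp
      have h2 : ∀ j ∈ Finset.range N, HasDerivAt
          (fun t : ℝ => ((t : ℂ) * z) ^ (j + 1) / ((j + 1).factorial : ℂ))
          (z * ((t * z) ^ j / (j.factorial : ℂ))) t := by
        intro j _
        have h3 := ((hlin t).fun_pow (j + 1)).div_const ((j + 1).factorial : ℂ)
        refine h3.congr_deriv ?_
        have h4 : (j.factorial : ℂ) ≠ 0 := by exact_mod_cast j.factorial_ne_zero
        have h5 : (j : ℂ) + 1 ≠ 0 := by exact_mod_cast j.succ_ne_zero
        rw [Nat.factorial_succ]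
        push_cast
        field_simp
      have h6 := ((h1.fun_sub (HasDerivAt.fun_sum h2)).sub_const 1).congr_deriv (g' := f' t) (by
        simp only [hf', ← Finset.mul_sum]
        ring)
      refine h6.congr_of_eventuallyEq (Filter.Eventually.of_forall fun t => ?_)
      simp only [hf, Finset.sum_range_succ', pow_zero, Nat.factorial_zero, Nat.cast_one, div_one]
      ring
    have hb : ∀ t ∈ Set.Ico (0 : ℝ) 1, ‖f' t‖ ≤ ‖z‖ ^ (N + 1) * max 1 ‖Complex.exp z‖ := by
      intro t ht
      have h1 := ih (t * z)
      have h2 : ‖(t : ℂ) * z‖ ≤ ‖z‖ := by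
        rw [norm_mul, norm_real, Real.norm_of_nonneg ht.1]
        exact mul_le_of_le_one_left (norm_nonneg _) ht.2.le
      have h3 : ‖Complex.exp (t * z)‖ ≤ max 1 ‖Complex.exp z‖ := by
        rw [Complex.norm_exp, Complex.norm_exp, re_ofReal_mul]
        rcases le_total z.re 0 with hz | hz
        · exact le_max_of_le_left (Real.exp_le_one_iff.2 (mul_nonpos_of_nonneg_of_nonpos ht.1 hz))
        · exact le_max_of_le_right (Real.exp_le_exp.2 (mul_le_of_le_one_left hz ht.2.le))
      have h4 : max 1 ‖Complex.exp (t * z)‖ ≤ max 1 ‖Complex.exp z‖ :=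
        max_le (le_max_left _ _) h3
      rw [hf', norm_mul, pow_succ', mul_assoc]
      refine mul_le_mul_of_nonneg_left (h1.trans ?_) (norm_nonneg _)
      gcongr
    have h := norm_image_sub_le_of_norm_deriv_le_segment_01'
      (fun t _ => (hd t).hasDerivWithinAt) hb
    have h0 : f 0 = 0 := by
      simp [hf, Finset.sum_range_succ']
    rw [h0, sub_zero] at h
    simpa [hf] using h

/-! ### Superposition of plane waves -/

section Superposition

variable {ħ ϑ 𝓑 s : ℝ}

instance : SFinite (nu ħ ϑ 𝓑) := by
  unfold nu
  infer_instance

/-- Dominated convergence. It supplies the measurability of the matrix elements as functions of the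
frequency. -/
theorem continuous_inner_toeplitz_echar (u v : cohSpace ħ ϑ 𝓑 s) :
    Continuous (fun θ : Fin 4 → ℝ => inner ℂ u (toeplitz ħ ϑ 𝓑 s (echar θ) v)) := by
  simp_rw [inner_toeplitz (memLp_top_echar _)]
  have hu := Lp.memLp (u : Lp ℂ 2 (nu ħ ϑ 𝓑))
  have hv := Lp.memLp (v : Lp ℂ 2 (nu ħ ϑ 𝓑))
  have hc : ∀ θ, Continuous (echar θ) := fun θ =>
    continuous_echar.comp (continuous_const.prodMk continuous_id)
  refine continuous_of_dominated (bound := fun x => ‖conj ((u : Lp ℂ 2 (nu ħ ϑ 𝓑)) x)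
    * (v : Lp ℂ 2 (nu ħ ϑ 𝓑)) x‖) (fun θ => ?_) (fun θ => ?_) ?_ ?_
  · exact hu.star.1.mul ((hc θ).aestronglyMeasurable.mul hv.1)
  · refine Filter.Eventually.of_forall fun x => ?_
    simp only [norm_mul, norm_echar, one_mul, le_refl]
  · exact (hu.star.integrable_mul hv).norm
  · refine Filter.Eventually.of_forall fun x => ?_
    exact continuous_const.mul
      ((continuous_echar.comp (continuous_id.prodMk continuous_const)).mul continuous_const)

theorem inner_smul_cohSpace (c : ℂ) (u v : cohSpace ħ ϑ 𝓑 s) :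
    inner ℂ u (c • v) = c * inner ℂ u v := inner_smul_right (𝕜 := ℂ) u v c

theorem norm_toeplitz_echar_apply_le (θ : Fin 4 → ℝ) (v : cohSpace ħ ϑ 𝓑 s) :
    ‖toeplitz ħ ϑ 𝓑 s (echar θ) v‖ ≤ ‖v‖ :=
  ((toeplitz ħ ϑ 𝓑 s (echar θ)).le_opNorm v).trans
    (mul_le_of_le_one_left (norm_nonneg v) (norm_toeplitz_echar_le θ))

theorem norm_inner_toeplitz_echar_le (θ : Fin 4 → ℝ) (u v : cohSpace ħ ϑ 𝓑 s) :
    ‖inner ℂ u (toeplitz ħ ϑ 𝓑 s (echar θ) v)‖ ≤ ‖u‖ * ‖v‖ := by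
  exact (norm_inner_le_norm u _).trans
    (mul_le_mul_of_nonneg_left (norm_toeplitz_echar_apply_le θ v) (norm_nonneg u))

/-- The Toeplitz operator of a superposition of plane waves. -/
theorem inner_toeplitz_superposition {Ω : Type*} [TopologicalSpace Ω] [SecondCountableTopology Ω]
    [MeasurableSpace Ω] [BorelSpace Ω] {μ : Measure Ω} [SFinite μ] {f : Ω → ℂ} (hf : Integrable f μ)
    {κ : Ω → Fin 4 → ℝ} (hκ : Continuous κ) {H : Phase → ℂ} (hH : MemLp H ∞ (nu ħ ϑ 𝓑))
    (hrep : ∀ x, H x = ∫ y, f y * echar (κ y) x ∂μ) (u v : cohSpace ħ ϑ 𝓑 s) :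
    inner ℂ u (toeplitz ħ ϑ 𝓑 s H v)
      = ∫ y, f y * inner ℂ u (toeplitz ħ ϑ 𝓑 s (echar (κ y)) v) ∂μ := by
  simp_rw [inner_toeplitz (memLp_top_echar _)]
  rw [inner_toeplitz hH]
  have hu := Lp.memLp (u : Lp ℂ 2 (nu ħ ϑ 𝓑))
  have hv := Lp.memLp (v : Lp ℂ 2 (nu ħ ϑ 𝓑))
  have hint : Integrable (fun a : Phase × Ω => conj ((u : Lp ℂ 2 (nu ħ ϑ 𝓑)) a.1)
      * (v : Lp ℂ 2 (nu ħ ϑ 𝓑)) a.1 * f a.2 * echar (κ a.2) a.1) ((nu ħ ϑ 𝓑).prod μ) := by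
    refine ((hu.star.integrable_mul hv).mul_prod hf).mul_bdd (c := 1) ?_ ?_
    · have hc : Continuous (fun a : Phase × Ω => echar (κ a.2) a.1) :=
        continuous_echar.comp ((hκ.comp continuous_snd).prodMk continuous_fst)
      exact hc.aestronglyMeasurable
    · exact Filter.Eventually.of_forall fun a => (norm_echar _ _).le
  have e1 : ∀ x, conj ((u : Lp ℂ 2 (nu ħ ϑ 𝓑)) x) * (H x * (v : Lp ℂ 2 (nu ħ ϑ 𝓑)) x)
      = ∫ y, conj ((u : Lp ℂ 2 (nu ħ ϑ 𝓑)) x) * (v : Lp ℂ 2 (nu ħ ϑ 𝓑)) x * f y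
        * echar (κ y) x ∂μ := by
    intro x
    rw [hrep, mul_left_comm, mul_comm, ← integral_const_mul]
    refine integral_congr_ae (Filter.Eventually.of_forall fun y => ?_)
    simp only
    ring
  simp_rw [e1]
  rw [integral_integral_swap hint]
  refine integral_congr_ae (Filter.Eventually.of_forall fun y => ?_)
  simp only
  rw [← integral_const_mul]
  refine integral_congr_ae (Filter.Eventually.of_forall fun x => ?_)
  simp only
  ring

end Superposition

theorem opNorm_le_of_inner {E : Type*} [NormedAddCommGroup E] [InnerProductSpace ℂ E]
    (A : E →L[ℂ] E) {C : ℝ} (hC : 0 ≤ C) (h : ∀ u v, ‖inner ℂ u (A v)‖ ≤ C * (‖u‖ * ‖v‖)) :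
    ‖A‖ ≤ C := by
  refine A.opNorm_le_bound hC fun v => ?_
  have h1 := h (A v) v
  rw [inner_self_eq_norm_sq_to_K, norm_pow, norm_algebraMap', norm_norm] at h1
  rcases (norm_nonneg (A v)).eq_or_lt with h0 | h0
  · rw [← h0]
    positivity
  · refine le_of_mul_le_mul_left ?_ h0
    linarith

/-! ### The asymptotic expansion of the product of Toeplitz operators -/

section Expansion

variable {ħ B T S : ℝ}

theorem symVal_cSym (B T S : ℝ) (j : ℕ) (a : Freq × Freq) :
    symVal (cSym B T S j) a
      = symVal (tauP (vv B T S) (ww B T S)) a ^ j / (j.factorial : ℂ) := by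
  simp only [symVal, cSym, starSym, map_mul, map_pow, MvPolynomial.eval_C]
  ring

theorem renToeplitz_echar_comp (hħ : 0 < ħ) (hS : 0 < S) (h : B * T ≠ 1) (a : Freq × Freq) :
    renToeplitz ħ B T S (echar (freq a.1)) ∘L renToeplitz ħ B T S (echar (freq a.2))
      = Complex.exp (ħ * symVal (tauP (vv B T S) (ww B T S)) a)
        • renToeplitz ħ B T S (echar (freq a.1 + freq a.2)) := by
  have h1 := toeplitz_echar_comp hħ (s := √ħ * S) (by positivity) (sq_sub_ne_zero hħ h)
    (freq a.1) (freq a.2)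
  rw [mul_div_cancel_left₀ _ hħ.ne', mul_div_cancel_left₀ _ hħ.ne',
    twist_eq_symVal hħ hS (sub_ne_zero.2 (Ne.symm h))] at h1
  exact h1

/-- The exponential times the plane wave operator is a product of two Toeplitz operators of
unimodular functions, hence of two contractions. This replaces an upper bound on the real part of τ,
which does not exist. -/
theorem norm_exp_mul_inner_le (hħ : 0 < ħ) (hS : 0 < S) (h : B * T ≠ 1) (a : Freq × Freq)
    (u v : renSpace ħ B T S) :
    ‖Complex.exp (ħ * symVal (tauP (vv B T S) (ww B T S)) a)‖
      * ‖inner ℂ u (renToeplitz ħ B T S (echar (freq a.1 + freq a.2)) v)‖ ≤ ‖u‖ * ‖v‖ := by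
  rw [← norm_mul, ← inner_smul_cohSpace, ← smul_apply, ← renToeplitz_echar_comp hħ hS h,
    ContinuousLinearMap.comp_apply]
  exact (norm_inner_toeplitz_echar_le _ _ _).trans
    (mul_le_mul_of_nonneg_left (norm_toeplitz_echar_apply_le _ v) (norm_nonneg u))

theorem continuous_symVal (p : MvPolynomial (Fin 2 × Fin 4) ℂ) : Continuous (symVal p) := by
  unfold symVal
  refine (MvPolynomial.continuous_eval p).comp (continuous_pi fun b => ?_)
  have h : ∀ i : Fin 2, Continuous (fun a : Freq × Freq => (![a.1, a.2] : Fin 2 → Freq) i) := by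
    intro i
    fin_cases i
    · exact continuous_fst
    · exact continuous_snd
  exact continuous_const.mul (continuous_ofReal.comp
    ((continuous_apply b.2).comp (continuous_freq.comp (h b.1))))

theorem continuous_freq_add : Continuous (fun a : Freq × Freq => freq a.1 + freq a.2) :=
  (continuous_freq.comp continuous_fst).add (continuous_freq.comp continuous_snd)

theorem integrable_fhat_mul {F G : Phase → ℂ} (hF : IsSymbol F) (hG : IsSymbol G) {k : Freq × Freq → ℂ}
    (hk : Continuous k) {C : ℝ} (hC : ∀ a, ‖k a‖ ≤ C) :
    Integrable (fun a : Freq × Freq => fhat F a.1 * fhat G a.2 * k a) :=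
  ((integrable_fhat hF).mul_prod (integrable_fhat hG)).mul_bdd (c := C) hk.aestronglyMeasurable
    (Filter.Eventually.of_forall hC)

/-- Fourier inversion is used for F and then for G, the adjoint of the first plane wave operator
being moved onto u in between. Integrability over pairs of frequencies rests on
`norm_exp_mul_inner_le`. -/
theorem inner_renToeplitz_comp (hħ : 0 < ħ) (hS : 0 < S) (h : B * T ≠ 1) {F G : Phase → ℂ}
    (hF : IsSymbol F) (hG : IsSymbol G) (u v : renSpace ħ B T S) :
    inner ℂ u ((renToeplitz ħ B T S F ∘L renToeplitz ħ B T S G) v)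
      = ∫ a : Freq × Freq, fhat F a.1 * fhat G a.2
        * (Complex.exp (ħ * symVal (tauP (vv B T S) (ww B T S)) a)
          * inner ℂ u (renToeplitz ħ B T S (echar (freq a.1 + freq a.2)) v)) := by
  have hc : Continuous (fun a : Freq × Freq =>
      Complex.exp (ħ * symVal (tauP (vv B T S) (ww B T S)) a)
          * inner ℂ u (renToeplitz ħ B T S (echar (freq a.1 + freq a.2)) v)) :=
    (Complex.continuous_exp.comp (continuous_const.mul (continuous_symVal _))).mul
      ((continuous_inner_toeplitz_echar u v).comp continuous_freq_add)
  have hint := integrable_fhat_mul hF hG hc (fun a => by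
    rw [norm_mul]
    exact norm_exp_mul_inner_le hħ hS h a u v)
  rw [Measure.volume_eq_prod, integral_prod _ hint, ContinuousLinearMap.comp_apply]
  refine (inner_toeplitz_superposition (integrable_fhat hF) continuous_freq
    (memLp_top_of_isSymbol hF) (fourier_rep hF) u (renToeplitz ħ B T S G v)).trans ?_
  refine integral_congr_ae (Filter.Eventually.of_forall fun w => ?_)
  simp only
  rw [← ContinuousLinearMap.adjoint_inner_left]
  refine (congrArg (fun z => fhat F w * z) (inner_toeplitz_superposition (integrable_fhat hG)
    continuous_freq (memLp_top_of_isSymbol hG) (fourier_rep hG) _ v)).trans ?_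
  rw [← integral_const_mul]
  refine integral_congr_ae (Filter.Eventually.of_forall fun w' => ?_)
  simp only
  rw [ContinuousLinearMap.adjoint_inner_left, ← mul_assoc]
  exact congrArg (fun z => fhat F w * fhat G w' * z)
    ((congrArg (fun A => inner ℂ u (A v)) (renToeplitz_echar_comp hħ hS h (w, w'))).trans
      (inner_smul_cohSpace _ _ _))

theorem inner_renToeplitz_renCoeff (hħ : 0 < ħ) (hS : 0 < S) (h : B * T ≠ 1) (j : ℕ)
    {F G : Phase → ℂ} (hF : IsSymbol F) (hG : IsSymbol G) (u v : renSpace ħ B T S) :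
    inner ℂ u (renToeplitz ħ B T S (renCoeff ħ B T S j F G) v)
      = ∫ a : Freq × Freq, symVal (cSym B T S j) a * (fhat F a.1 * fhat G a.2)
          * inner ℂ u (renToeplitz ħ B T S (echar (freq a.1 + freq a.2)) v) := by
  have hsym : IsSymbol (renCoeff ħ B T S j F G) :=
    isSymbol_starCoeff hħ (by positivity) (sq_sub_ne_zero hħ h) j hF hG
  refine inner_toeplitz_superposition (integrable_symVal hF hG _) continuous_freq_add
    (memLp_top_of_isSymbol hsym) (fun x => ?_) u v
  rw [renCoeff_eq_mop hħ hS h j hF.1 hG.1, mop_rep hF hG]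

/-- A bound for the symbol of the star product. -/
def symBound (B T S : ℝ) : ℝ := (2 * Real.pi) ^ 2 * ∑ k, (∑ i, ‖vv B T S k i‖) ^ 2

theorem norm_symVal_tauP_le (B T S : ℝ) (a : Freq × Freq) :
    ‖symVal (tauP (vv B T S) (ww B T S)) a‖ ≤ symBound B T S * (‖a.1‖ * ‖a.2‖) := by
  have hfreq : ∀ (w : Freq) i, ‖I * (freq w i : ℂ)‖ ≤ 2 * Real.pi * ‖w‖ := by
    intro w i
    rw [norm_mul, norm_I, one_mul, norm_real, freq, norm_mul,
      Real.norm_of_nonneg (by positivity : 0 ≤ 2 * Real.pi)]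
    exact mul_le_mul_of_nonneg_left (PiLp.norm_apply_le w i) (by positivity)
  have hlin : ∀ (c : Fin 4 → ℂ) (w : Freq), ‖∑ i, c i * (I * (freq w i : ℂ))‖
      ≤ (∑ i, ‖c i‖) * (2 * Real.pi * ‖w‖) := by
    intro c w
    rw [Finset.sum_mul]
    refine norm_sum_le_of_le _ fun i _ => ?_
    rw [norm_mul]
    exact mul_le_mul_of_nonneg_left (hfreq w i) (norm_nonneg _)
  simp only [symVal, tauP, linForm, map_neg, map_sum, map_mul, MvPolynomial.eval_C,
    MvPolynomial.eval_X, Matrix.cons_val_zero, Matrix.cons_val_one, norm_neg]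
  rw [symBound, Finset.mul_sum, Finset.sum_mul]
  refine norm_sum_le_of_le _ fun k _ => ?_
  rw [norm_mul]
  have h2 : ∑ i, ‖ww B T S k i‖ = ∑ i, ‖vv B T S k i‖ :=
    Finset.sum_congr rfl fun i _ => by rw [ww_eq_conj, norm_conj]
  refine (mul_le_mul (hlin _ _) (hlin _ _) (norm_nonneg _) (by positivity)).trans (le_of_eq ?_)
  rw [h2]
  ring

theorem symBound_nonneg (B T S : ℝ) : 0 ≤ symBound B T S := by
  unfold symBound
  positivity

/-- The product of two Toeplitz operators, with an explicit bound for the remainder. -/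
theorem norm_renToeplitz_comp_sub_le (hħ : 0 < ħ) (hS : 0 < S) (h : B * T ≠ 1) {F G : Phase → ℂ}
    (hF : IsSymbol F) (hG : IsSymbol G) (N : ℕ) :
    ‖renToeplitz ħ B T S F ∘L renToeplitz ħ B T S G
        - ∑ j ∈ Finset.range N, (ħ : ℂ) ^ j • renToeplitz ħ B T S (renCoeff ħ B T S j F G)‖
      ≤ symBound B T S ^ N * ((∫ w, ‖w‖ ^ N * ‖fhat F w‖) * ∫ w, ‖w‖ ^ N * ‖fhat G w‖) * ħ ^ N := by
  have hFi : 0 ≤ ∫ w, ‖w‖ ^ N * ‖fhat F w‖ := integral_nonneg fun w => by positivity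
  have hGi : 0 ≤ ∫ w, ‖w‖ ^ N * ‖fhat G w‖ := integral_nonneg fun w => by positivity
  have hL := symBound_nonneg B T S
  refine opNorm_le_of_inner _ (by positivity) fun u v => ?_
  set t := symVal (tauP (vv B T S) (ww B T S)) with ht
  set m : Freq × Freq → ℂ := fun a =>
    inner ℂ u (renToeplitz ħ B T S (echar (freq a.1 + freq a.2)) v) with hm
  have hmc : Continuous m := (continuous_inner_toeplitz_echar u v).comp continuous_freq_add
  have hmb : ∀ a, ‖m a‖ ≤ ‖u‖ * ‖v‖ := fun a => norm_inner_toeplitz_echar_le _ _ _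
  have hmb' : ∀ a, ‖Complex.exp (ħ * t a)‖ * ‖m a‖ ≤ ‖u‖ * ‖v‖ := fun a =>
    norm_exp_mul_inner_le hħ hS h a u v
  have hint : ∀ j, Integrable (fun a : Freq × Freq =>
      symVal (cSym B T S j) a * (fhat F a.1 * fhat G a.2) * m a) := fun j =>
    (integrable_symVal hF hG _).mul_bdd (c := ‖u‖ * ‖v‖) hmc.aestronglyMeasurable
      (Filter.Eventually.of_forall hmb)
  have hint0 : Integrable (fun a : Freq × Freq => fhat F a.1 * fhat G a.2
      * (Complex.exp (ħ * t a) * m a)) :=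
    integrable_fhat_mul hF hG ((Complex.continuous_exp.comp
      (continuous_const.mul (continuous_symVal _))).mul hmc) (C := ‖u‖ * ‖v‖) (fun a => by
        rw [norm_mul]
        exact hmb' a)
  -- The product and each term of the expansion are integrals over the same pairs of frequencies, so
  -- their difference carries the remainder of the exponential series at ħτ.
  have key : inner ℂ u ((renToeplitz ħ B T S F ∘L renToeplitz ħ B T S G
        - ∑ j ∈ Finset.range N, (ħ : ℂ) ^ j • renToeplitz ħ B T S (renCoeff ħ B T S j F G)) v)
      = ∫ a : Freq × Freq, fhat F a.1 * fhat G a.2 * (Complex.exp (ħ * t a)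
          - ∑ j ∈ Finset.range N, (ħ * t a) ^ j / (j.factorial : ℂ)) * m a := by
    rw [sub_apply, inner_sub_right, inner_renToeplitz_comp hħ hS h hF hG, sum_apply, inner_sum]
    simp_rw [smul_apply, inner_smul_cohSpace, inner_renToeplitz_renCoeff hħ hS h _ hF hG,
      ← integral_const_mul]
    rw [← integral_finsetSum _ (fun j _ => (hint j).const_mul _),
      ← integral_sub hint0 (integrable_finsetSum _ fun j _ => (hint j).const_mul _)]
    refine integral_congr_ae (Filter.Eventually.of_forall fun a => ?_)
    simp only [symVal_cSym, mul_sub, sub_mul, Finset.mul_sum, Finset.sum_mul, mul_pow]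
    congr 1
    · ring
    · refine Finset.sum_congr rfl fun j _ => ?_
      ring
  rw [key]
  have hint2 : Integrable (fun a : Freq × Freq => (‖a.1‖ ^ N * ‖fhat F a.1‖)
      * (‖a.2‖ ^ N * ‖fhat G a.2‖)) :=
    (integrable_pow_mul_fhat hF N).mul_prod (integrable_pow_mul_fhat hG N)
  have hbound := norm_integral_le_of_norm_le (hint2.const_mul
    ((symBound B T S * ħ) ^ N * (‖u‖ * ‖v‖))) (f := fun a : Freq × Freq =>
      fhat F a.1 * fhat G a.2 * (Complex.exp (ħ * t a)
          - ∑ j ∈ Finset.range N, (ħ * t a) ^ j / (j.factorial : ℂ)) * m a)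
    (Filter.Eventually.of_forall fun a => by
      have h1 := norm_exp_sub_sum_le N (ħ * t a)
      -- Both alternatives of the maximum are bounded by contractivity: of one plane wave operator,
      -- or of the product of two.
      have h2 : max 1 ‖Complex.exp (ħ * t a)‖ * ‖m a‖ ≤ ‖u‖ * ‖v‖ := by
        rcases max_cases 1 ‖Complex.exp (ħ * t a)‖ with hx | hx
        · rw [hx.1, one_mul]
          exact hmb a
        · rw [hx.1]
          exact hmb' a
      have h3 : ‖(ħ : ℂ) * t a‖ ≤ symBound B T S * ħ * (‖a.1‖ * ‖a.2‖) := by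
        rw [norm_mul, norm_real, Real.norm_of_nonneg hħ.le]
        have := mul_le_mul_of_nonneg_left (norm_symVal_tauP_le B T S a) hħ.le
        linarith
      have h4 := pow_le_pow_left₀ (norm_nonneg _) h3 N
      rw [norm_mul, norm_mul, norm_mul]
      calc _ ≤ ‖fhat F a.1‖ * ‖fhat G a.2‖ * (‖(ħ : ℂ) * t a‖ ^ N
            * max 1 ‖Complex.exp (ħ * t a)‖) * ‖m a‖ := by gcongr
        _ = ‖fhat F a.1‖ * ‖fhat G a.2‖ * (‖(ħ : ℂ) * t a‖ ^ N
            * (max 1 ‖Complex.exp (ħ * t a)‖ * ‖m a‖)) := by ring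
        _ ≤ ‖fhat F a.1‖ * ‖fhat G a.2‖ * ((symBound B T S * ħ * (‖a.1‖ * ‖a.2‖)) ^ N
            * (‖u‖ * ‖v‖)) := by gcongr
        _ = _ := by ring)
  refine hbound.trans (le_of_eq ?_)
  rw [integral_const_mul, Measure.volume_eq_prod,
    integral_prod_mul (fun w => ‖w‖ ^ N * ‖fhat F w‖) (fun w => ‖w‖ ^ N * ‖fhat G w‖)]
  ring

end Expansion

end

end NCToeplitz

namespace NCToeplitz

noncomputable section

/-! ### Uniform estimates -/

/-- On a compact set of admissible parameters this bounds the constant of the remainder, hence the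
local uniformity. -/
theorem continuousOn_symBound {K : Set (ℝ × ℝ × ℝ)}
    (hK : ∀ b ∈ K, b.1 * b.2.1 ≠ 1 ∧ 0 < b.2.2) :
    ContinuousOn (fun b : ℝ × ℝ × ℝ => symBound b.1 b.2.1 b.2.2) K := by
  have hS : ∀ b ∈ K, (b.2.2 : ℂ) ≠ 0 := fun b hb => by exact_mod_cast (hK b hb).2.ne'
  have hd : ∀ b ∈ K, (1 : ℂ) - b.1 * b.2.1 ≠ 0 := fun b hb => by
    exact_mod_cast sub_ne_zero.2 (hK b hb).1.symm
  have hv : ∀ k i, ContinuousOn (fun b : ℝ × ℝ × ℝ => vv b.1 b.2.1 b.2.2 k i) K := by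
    have c1 : ContinuousOn (fun b : ℝ × ℝ × ℝ => (b.1 : ℂ)) K := by fun_prop
    have c2 : ContinuousOn (fun b : ℝ × ℝ × ℝ => (b.2.1 : ℂ)) K := by fun_prop
    have c3 : ContinuousOn (fun b : ℝ × ℝ × ℝ => (b.2.2 : ℂ)) K := by fun_prop
    have cd : ContinuousOn (fun b : ℝ × ℝ × ℝ => (1 : ℂ) - b.1 * b.2.1) K :=
      continuousOn_const.sub (c1.mul c2)
    have c0 : ∀ z : ℂ, ContinuousOn (fun _ : ℝ × ℝ × ℝ => z) K := fun z => continuousOn_const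
    intro k i
    fin_cases k <;> fin_cases i
    · exact ((c0 _).div c3 hS).div cd hd
    · exact c0 _
    · exact (c0 _).mul c3
    · exact (((c0 _).mul c2).neg.div c3 hS).div cd hd
    · exact (((c0 _).mul c3).mul c1).neg.div cd hd
    · exact (c0 _).div c3 hS
    · exact c0 _
    · exact ((c0 _).mul c3).div cd hd
  unfold symBound
  exact continuousOn_const.mul (continuousOn_finsetSum _ fun k _ =>
    (continuousOn_finsetSum _ fun i _ => (hv k i).norm).pow 2)

theorem exists_norm_renToeplitz_comp_sub_le {F G : Phase → ℂ} (hF : IsSymbol F) (hG : IsSymbol G)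
    {K : Set (ℝ × ℝ × ℝ)} (hKc : IsCompact K) (hK : ∀ b ∈ K, b.1 * b.2.1 ≠ 1 ∧ 0 < b.2.2) (N : ℕ) :
    ∃ C : ℝ, 0 ≤ C ∧ ∀ ħ B T S : ℝ, 0 < ħ → (B, T, S) ∈ K →
      ‖renToeplitz ħ B T S F ∘L renToeplitz ħ B T S G
        - ∑ j ∈ Finset.range N, (ħ : ℂ) ^ j • renToeplitz ħ B T S (renCoeff ħ B T S j F G)‖
        ≤ C * ħ ^ N := by
  obtain ⟨M, hM⟩ := hKc.exists_bound_of_continuousOn (continuousOn_symBound hK)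
  have hFi : 0 ≤ ∫ w, ‖w‖ ^ N * ‖fhat F w‖ := integral_nonneg fun w => by positivity
  have hGi : 0 ≤ ∫ w, ‖w‖ ^ N * ‖fhat G w‖ := integral_nonneg fun w => by positivity
  refine ⟨|M| ^ N * ((∫ w, ‖w‖ ^ N * ‖fhat F w‖) * ∫ w, ‖w‖ ^ N * ‖fhat G w‖), by positivity,
    fun ħ B T S hħ hb => ?_⟩
  refine (norm_renToeplitz_comp_sub_le hħ (hK _ hb).2 (hK _ hb).1 hF hG N).trans ?_
  have h1 : symBound B T S ≤ |M| := (le_abs_self _).trans ((hM _ hb).trans (le_abs_self _))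
  have h2 := symBound_nonneg B T S
  gcongr

/-- A compact neighbourhood of the origin in the parameters `(B, T)`, with `S = 1`. -/
def smallSet : Set (ℝ × ℝ × ℝ) :=
  Set.Icc (-(1 / 2)) (1 / 2) ×ˢ Set.Icc (-(1 / 2)) (1 / 2) ×ˢ {1}

theorem isCompact_smallSet : IsCompact smallSet :=
  isCompact_Icc.prod (isCompact_Icc.prod isCompact_singleton)

theorem mul_le_quarter {B T : ℝ} (hB : |B| ≤ 1 / 2) (hT : |T| ≤ 1 / 2) : |B * T| ≤ 1 / 4 := by
  rw [abs_mul]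
  nlinarith [abs_nonneg B, abs_nonneg T]

theorem mul_ne_one_of_abs_le {B T : ℝ} (hB : |B| ≤ 1 / 2) (hT : |T| ≤ 1 / 2) : B * T ≠ 1 := by
  intro h
  have := mul_le_quarter hB hT
  rw [h, abs_one] at this
  norm_num at this

theorem smallSet_spec : ∀ b ∈ smallSet, b.1 * b.2.1 ≠ 1 ∧ 0 < b.2.2 := by
  rintro ⟨B, T, S⟩ ⟨hB, hT, hS⟩
  refine ⟨mul_ne_one_of_abs_le (abs_le.2 hB) (abs_le.2 hT), ?_⟩
  rw [Set.mem_singleton_iff.1 hS]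
  exact one_pos

theorem mem_smallSet {B T : ℝ} (hB : |B| ≤ 1 / 2) (hT : |T| ≤ 1 / 2) : (B, T, (1 : ℝ)) ∈ smallSet :=
  ⟨abs_le.1 hB, abs_le.1 hT, rfl⟩

theorem toeplitz_sub {ħ ϑ 𝓑 s : ℝ} {F G : Phase → ℂ} (hF : MemLp F ∞ (nu ħ ϑ 𝓑))
    (hG : MemLp G ∞ (nu ħ ϑ 𝓑)) :
    toeplitz ħ ϑ 𝓑 s (fun x => F x - G x) = toeplitz ħ ϑ 𝓑 s F - toeplitz ħ ϑ 𝓑 s G := by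
  have h := toeplitz_sum (s := s) (Finset.univ : Finset (Fin 2)) ![1, -1] (F := ![F, G])
    (ħ := ħ) (ϑ := ϑ) (𝓑 := 𝓑) (by
      intro i _
      fin_cases i
      · exact hF
      · exact hG)
  have e : (-1 : ℂ) • toeplitz ħ ϑ 𝓑 s G = -toeplitz ħ ϑ 𝓑 s G :=
    neg_one_smul ℂ (toeplitz ħ ϑ 𝓑 s G)
  simp only [Fin.sum_univ_two, Matrix.cons_val_zero, Matrix.cons_val_one, one_mul, neg_mul,
    one_smul, e, ← sub_eq_add_neg] at h
  exact h

theorem toeplitz_const_mul {ħ ϑ 𝓑 s : ℝ} {F : Phase → ℂ} (hF : MemLp F ∞ (nu ħ ϑ 𝓑)) (c : ℂ) :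
    toeplitz ħ ϑ 𝓑 s (fun x => c * F x) = c • toeplitz ħ ϑ 𝓑 s F := by
  have h := toeplitz_sum (s := s) (Finset.univ : Finset (Fin 1)) ![c] (F := ![F])
    (ħ := ħ) (ϑ := ϑ) (𝓑 := 𝓑) (by
      intro i _
      fin_cases i
      exact hF)
  simpa using h

theorem norm_renToeplitz_sub_le {ħ B T S : ℝ} {F G : Phase → ℂ} (hF : IsSymbol F) (hG : IsSymbol G)
    {C : ℝ} (hC0 : 0 ≤ C) (hC : ∀ x, ‖F x - G x‖ ≤ C) :
    ‖renToeplitz ħ B T S F - renToeplitz ħ B T S G‖ ≤ C := by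
  have h1 : MemLp F ∞ (nu ħ (ħ * T) (ħ * B)) := memLp_top_of_isSymbol hF
  have h2 : MemLp G ∞ (nu ħ (ħ * T) (ħ * B)) := memLp_top_of_isSymbol hG
  have h := norm_toeplitz_le (s := √ħ * S) (F := fun x => F x - G x) (h1.sub h2) hC0 hC
  rw [toeplitz_sub h1 h2] at h
  exact h

theorem norm_renSpace_sub_le {ħ B T S : ℝ} (X Y Z : renSpace ħ B T S →L[ℂ] renSpace ħ B T S)
    {a b c : ℝ} (h1 : ‖X - Y‖ ≤ a) (h2 : ‖Y - Z‖ ≤ b) (h : a + b ≤ c) : ‖X - Z‖ ≤ c :=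
  (norm_sub_le_norm_sub_add_norm_sub X Y Z).trans ((add_le_add h1 h2).trans h)

theorem isSymbol_renCoeff {ħ B T S : ℝ} (hħ : 0 < ħ) (hS : 0 < S) (h : B * T ≠ 1) (j : ℕ)
    {F G : Phase → ℂ} (hF : IsSymbol F) (hG : IsSymbol G) : IsSymbol (renCoeff ħ B T S j F G) :=
  isSymbol_starCoeff hħ (by positivity) (sq_sub_ne_zero hħ h) j hF hG

theorem renToeplitz_sum {ħ B T S : ℝ} {ι : Type*} (A : Finset ι) (c : ι → ℂ) {F : ι → Phase → ℂ}
    (hF : ∀ i ∈ A, IsSymbol (F i)) :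
    renToeplitz ħ B T S (fun x => ∑ i ∈ A, c i * F i x) = ∑ i ∈ A, c i • renToeplitz ħ B T S (F i) :=
  toeplitz_sum A c fun i hi => memLp_top_of_isSymbol (hF i hi)

/-- Linearity in the symbol and ‖𝒯_H‖ ≤ sup |H| turn a uniform estimate on the phase space into an
operator estimate with the same constant. -/
theorem norm_sum_renToeplitz_sub_le {ħ B T S : ℝ} {ι κ : Type*} (A : Finset ι) (c : ι → ℂ)
    {F : ι → Phase → ℂ} (hF : ∀ i ∈ A, IsSymbol (F i)) (A' : Finset κ) (c' : κ → ℂ)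
    {F' : κ → Phase → ℂ} (hF' : ∀ i ∈ A', IsSymbol (F' i)) {C : ℝ} (hC0 : 0 ≤ C)
    (hC : ∀ x, ‖∑ i ∈ A, c i * F i x - ∑ i ∈ A', c' i * F' i x‖ ≤ C) :
    ‖∑ i ∈ A, c i • renToeplitz ħ B T S (F i) - ∑ i ∈ A', c' i • renToeplitz ħ B T S (F' i)‖
      ≤ C := by
  rw [← renToeplitz_sum A c hF, ← renToeplitz_sum A' c' hF']
  exact norm_renToeplitz_sub_le (isSymbol_sum _ fun i hi => isSymbol_const_mul (hF i hi) _)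
    (isSymbol_sum _ fun i hi => isSymbol_const_mul (hF' i hi) _) hC0 hC

/-- Cutting the expansion in ħ at N costs O(ħ^N). The finite sum that remains is a Toeplitz
operator, and its symbol is replaced by means of `joint_expansion` with M = N. -/
theorem joint_operator_expansion {c : ℕ → ℕ → ℕ → (Fin 4 → ℕ) → (Fin 4 → ℕ) → ℂ}
    (hc : ∀ j μ ν, HasJet (cf j μ ν) (fun k l => c j k l μ ν)) {F G : Phase → ℂ}
    (hF : IsSymbol F) (hG : IsSymbol G) (N : ℕ) :
    ∃ C δ : ℝ, 0 < δ ∧ ∀ ħ B T : ℝ, 0 < ħ → ħ < δ → |B| < δ → |T| < δ →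
      ‖renToeplitz ħ B T 1 F ∘L renToeplitz ħ B T 1 G
        - ∑ a ∈ tripleIdx N, ((ħ : ℂ) ^ a.1 * (B : ℂ) ^ a.2.1 * (T : ℂ) ^ a.2.2)
            • renToeplitz ħ B T 1 (bidiff a.1 (c a.1 a.2.1 a.2.2) F G)‖
        ≤ C * (ħ + |B| + |T|) ^ N := by
  obtain ⟨C, hC0, hC⟩ := exists_norm_renToeplitz_comp_sub_le hF hG isCompact_smallSet smallSet_spec N
  obtain ⟨C', δ, hδ, hC'⟩ := joint_expansion hc hF hG (le_refl N)
  refine ⟨C + |C'|, min δ (1 / 2), by positivity, fun ħ B T hħ h1 h2 h3 => ?_⟩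
  have hB : |B| ≤ 1 / 2 := h2.le.trans (min_le_right _ _)
  have hT : |T| ≤ 1 / 2 := h3.le.trans (min_le_right _ _)
  have hBT := mul_ne_one_of_abs_le hB hT
  have hε : 0 ≤ ħ + |B| + |T| := by positivity
  have e2 := hC' ħ B T hħ (h1.trans_le (min_le_left _ _)) (h2.trans_le (min_le_left _ _))
    (h3.trans_le (min_le_left _ _))
  have e3 := norm_sum_renToeplitz_sub_le (ħ := ħ) (B := B) (T := T) (S := 1) (Finset.range N)
    (fun j => (ħ : ℂ) ^ j) (fun j _ => isSymbol_renCoeff hħ one_pos hBT j hF hG) (tripleIdx N)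
    (fun a => (ħ : ℂ) ^ a.1 * (B : ℂ) ^ a.2.1 * (T : ℂ) ^ a.2.2)
    (fun a _ => isSymbol_bidiff hF hG a.1 (c a.1 a.2.1 a.2.2))
    (C := |C'| * (ħ + |B| + |T|) ^ N) (by positivity)
    (fun x => (e2 x).trans (mul_le_mul_of_nonneg_right (le_abs_self _) (pow_nonneg hε N)))
  have e4 : ħ ^ N ≤ (ħ + |B| + |T|) ^ N :=
    pow_le_pow_left₀ hħ.le (by linarith [abs_nonneg B, abs_nonneg T]) N
  have e5 := mul_le_mul_of_nonneg_left e4 hC0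
  exact norm_renSpace_sub_le _ _ _ (hC ħ B T 1 hħ (mem_smallSet hB hT)) e3 (by linarith)

/-! ### The commutator -/

/-- The minors of the Jacobian of the pair `(F, G)`. -/
def jacMinor (k l : Fin 4) (F G : Phase → ℂ) (x : Phase) : ℂ :=
  pd k F x * pd l G x - pd l F x * pd k G x

theorem isSymbol_jacMinor {F G : Phase → ℂ} (hF : IsSymbol F) (hG : IsSymbol G) (k l : Fin 4) :
    IsSymbol (jacMinor k l F G) :=
  ⟨((isSymbol_pd hF k).1.mul (isSymbol_pd hG l).1).sub
      ((isSymbol_pd hF l).1.mul (isSymbol_pd hG k).1),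
    ((isSymbol_pd hF k).2.mul_right).sub ((isSymbol_pd hF l).2.mul_right)⟩

theorem poisson_eq (F G : Phase → ℂ) (x : Phase) :
    poisson F G x = jacMinor 2 0 F G x + jacMinor 3 1 F G x := by
  rw [poisson, Fin.sum_univ_two]
  rfl

theorem isSymbol_poisson {F G : Phase → ℂ} (hF : IsSymbol F) (hG : IsSymbol G) :
    IsSymbol (poisson F G) := by
  rw [show poisson F G = _ from funext fun x => poisson_eq F G x]
  exact ⟨(isSymbol_jacMinor hF hG 2 0).1.add (isSymbol_jacMinor hF hG 3 1).1,
    (isSymbol_jacMinor hF hG 2 0).2.add (isSymbol_jacMinor hF hG 3 1).2⟩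

/-- The symmetric part of the matrix of 𝒞₁ cancels. In the antisymmetric part the Poisson bracket
has the factor 1/(1 - BT), which differs from 1 by BT/(1 - BT); the other terms carry B or T. -/
theorem renCoeff_one_sub {ħ B T : ℝ} (hħ : 0 < ħ) (h : B * T ≠ 1) {F G : Phase → ℂ}
    (hF : ContDiff ℝ ∞ F) (hG : ContDiff ℝ ∞ G) (x : Phase) :
    renCoeff ħ B T 1 1 F G x - renCoeff ħ B T 1 1 G F x - I * poisson F G x
      = (1 - (B : ℂ) * T)⁻¹ * (I * ((B * T) * poisson F G x - B * jacMinor 0 1 F G x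
        - T * jacMinor 2 3 F G x)) := by
  have h' : 1 - (B : ℂ) * T ≠ 0 := by exact_mod_cast sub_ne_zero.2 h.symm
  have h1 : 1 - B * T ≠ 0 := sub_ne_zero.2 h.symm
  rw [renCoeff_eq_mop hħ one_pos h 1 hF hG, renCoeff_eq_mop hħ one_pos h 1 hG hF,
    mop_cSym_one one_ne_zero h1 hF hG, mop_cSym_one one_ne_zero h1 hG hF, poisson_eq]
  simp only [dotProduct, Matrix.mulVec, grad, matRen, Fin.sum_univ_four, jacMinor, dP_zero_eq_pd,
    dP_one_eq_pd, dQ_zero_eq_pd, dQ_one_eq_pd]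
  simp
  field_simp
  ring

theorem renCoeff_zero {ħ B T : ℝ} (hħ : 0 < ħ) (h : B * T ≠ 1) {F G : Phase → ℂ}
    (hF : ContDiff ℝ ∞ F) (hG : ContDiff ℝ ∞ G) :
    renCoeff ħ B T 1 0 F G = renCoeff ħ B T 1 0 G F := by
  funext x
  rw [renCoeff_eq_mop hħ one_pos h 0 hF hG, renCoeff_eq_mop hħ one_pos h 0 hG hF, mop_cSym_zero,
    mop_cSym_zero, mul_comm]

theorem exists_norm_renCoeff_one_sub_le {F G : Phase → ℂ} (hF : IsSymbol F) (hG : IsSymbol G) :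
    ∃ C : ℝ, 0 ≤ C ∧ ∀ ħ B T : ℝ, 0 < ħ → |B| ≤ 1 / 2 → |T| ≤ 1 / 2 → ∀ x,
      ‖renCoeff ħ B T 1 1 F G x - renCoeff ħ B T 1 1 G F x - I * poisson F G x‖
        ≤ C * (|B| + |T|) := by
  obtain ⟨C0, h0⟩ := exists_norm_le_of_isSymbol (isSymbol_poisson hF hG)
  obtain ⟨C1, h1⟩ := exists_norm_le_of_isSymbol (isSymbol_jacMinor hF hG 0 1)
  obtain ⟨C2, h2⟩ := exists_norm_le_of_isSymbol (isSymbol_jacMinor hF hG 2 3)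
  have p0 : 0 ≤ C0 := (norm_nonneg _).trans (h0 0)
  have p1 : 0 ≤ C1 := (norm_nonneg _).trans (h1 0)
  have p2 : 0 ≤ C2 := (norm_nonneg _).trans (h2 0)
  refine ⟨2 * (C0 + C1 + C2), by positivity, fun ħ B T hħ hB hT x => ?_⟩
  rw [renCoeff_one_sub hħ (mul_ne_one_of_abs_le hB hT) hF.1 hG.1, norm_mul, norm_inv, norm_mul,
    norm_I, one_mul]
  have hq := mul_le_quarter hB hT
  have e1 : (1 / 2 : ℝ) ≤ ‖1 - (B : ℂ) * T‖ := by
    rw [← ofReal_mul, ← ofReal_one, ← ofReal_sub, norm_real, Real.norm_eq_abs]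
    have := (abs_le.1 hq).2
    exact le_trans (by linarith) (le_abs_self _)
  have e2 : ‖1 - (B : ℂ) * T‖⁻¹ ≤ 2 := by
    rw [show (2 : ℝ) = (1 / 2)⁻¹ by norm_num]
    exact inv_anti₀ (by norm_num) e1
  have e3 : ‖(B * T : ℂ) * poisson F G x - B * jacMinor 0 1 F G x - T * jacMinor 2 3 F G x‖
      ≤ |B| * C0 + |B| * C1 + |T| * C2 := by
    refine (norm_sub_le _ _).trans (add_le_add ((norm_sub_le _ _).trans (add_le_add ?_ ?_)) ?_)
    · rw [norm_mul, norm_mul, norm_real, norm_real, Real.norm_eq_abs, Real.norm_eq_abs]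
      have : |B| * |T| ≤ |B| := mul_le_of_le_one_right (abs_nonneg _) (by linarith)
      exact mul_le_mul this (h0 x) (norm_nonneg _) (abs_nonneg _)
    · rw [norm_mul, norm_real, Real.norm_eq_abs]
      exact mul_le_mul_of_nonneg_left (h1 x) (abs_nonneg _)
    · rw [norm_mul, norm_real, Real.norm_eq_abs]
      exact mul_le_mul_of_nonneg_left (h2 x) (abs_nonneg _)
  have e4 : |B| * C0 + |B| * C1 + |T| * C2 ≤ (C0 + C1 + C2) * (|B| + |T|) := by
    have := abs_nonneg B
    have := abs_nonneg T
    nlinarith [mul_nonneg ‹0 ≤ |B|› p2, mul_nonneg ‹0 ≤ |T|› p0, mul_nonneg ‹0 ≤ |T|› p1]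
  calc _ ≤ 2 * ((C0 + C1 + C2) * (|B| + |T|)) :=
        mul_le_mul e2 (e3.trans e4) (norm_nonneg _) (by norm_num)
    _ = _ := by ring

theorem norm_commutator_le {E : Type*} [SeminormedAddCommGroup E] [NormedSpace ℂ E]
    (X Y X' Y' Z P : E) {ħ a b c : ℝ} (hħ : 0 < ħ) (h1 : ‖X - (Z + (ħ : ℂ) • X')‖ ≤ a)
    (h2 : ‖Y - (Z + (ħ : ℂ) • Y')‖ ≤ b) (h3 : ‖X' - Y' - I • P‖ ≤ c) :
    ‖X - Y - (I * ħ) • P‖ ≤ a + b + ħ * c := by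
  have e1 : X - Y - (I * ħ) • P
      = (X - (Z + (ħ : ℂ) • X')) - (Y - (Z + (ħ : ℂ) • Y')) + (ħ : ℂ) • (X' - Y' - I • P) := by
    rw [smul_sub, smul_sub, smul_smul, mul_comm I]
    abel
  have e2 : ‖(ħ : ℂ) • (X' - Y' - I • P)‖ ≤ ħ * c := by
    rw [norm_smul, norm_real, Real.norm_of_nonneg hħ.le]
    exact mul_le_mul_of_nonneg_left h3 hħ.le
  rw [e1]
  exact (norm_add_le _ _).trans (add_le_add ((norm_sub_le _ _).trans (add_le_add h1 h2)) e2)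

theorem norm_renSpace_commutator_le {ħ B T S : ℝ}
    (X Y X' Y' Z P : renSpace ħ B T S →L[ℂ] renSpace ħ B T S) {a b c : ℝ} (hħ : 0 < ħ)
    (h1 : ‖X - (Z + (ħ : ℂ) • X')‖ ≤ a) (h2 : ‖Y - (Z + (ħ : ℂ) • Y')‖ ≤ b)
    (h3 : ‖X' - Y' - I • P‖ ≤ c) : ‖X - Y - (I * ħ) • P‖ ≤ a + b + ħ * c :=
  norm_commutator_le X Y X' Y' Z P hħ h1 h2 h3

theorem norm_renToeplitz_renCoeff_one_sub_le {ħ B T : ℝ} (hħ : 0 < ħ) (h : B * T ≠ 1)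
    {F G : Phase → ℂ} (hF : IsSymbol F) (hG : IsSymbol G) {C : ℝ} (hC0 : 0 ≤ C)
    (hC : ∀ x, ‖renCoeff ħ B T 1 1 F G x - renCoeff ħ B T 1 1 G F x - I * poisson F G x‖ ≤ C) :
    ‖renToeplitz ħ B T 1 (renCoeff ħ B T 1 1 F G) - renToeplitz ħ B T 1 (renCoeff ħ B T 1 1 G F)
      - I • renToeplitz ħ B T 1 (poisson F G)‖ ≤ C := by
  have s1 := isSymbol_renCoeff hħ one_pos h 1 hF hG
  have s2 := isSymbol_renCoeff hħ one_pos h 1 hG hF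
  have s3 := isSymbol_poisson hF hG
  have m1 : MemLp (renCoeff ħ B T 1 1 F G) ∞ (nu ħ (ħ * T) (ħ * B)) := memLp_top_of_isSymbol s1
  have m2 : MemLp (renCoeff ħ B T 1 1 G F) ∞ (nu ħ (ħ * T) (ħ * B)) := memLp_top_of_isSymbol s2
  have m3 : MemLp (poisson F G) ∞ (nu ħ (ħ * T) (ħ * B)) := memLp_top_of_isSymbol s3
  have s4 : IsSymbol (fun x => renCoeff ħ B T 1 1 F G x - renCoeff ħ B T 1 1 G F x) :=
    ⟨s1.1.sub s2.1, s1.2.sub s2.2⟩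
  have e := norm_renToeplitz_sub_le (ħ := ħ) (B := B) (T := T) (S := 1) s4
    (isSymbol_const_mul s3 I) hC0 hC
  unfold renToeplitz at e ⊢
  rw [toeplitz_sub m1 m2, toeplitz_const_mul m3] at e
  exact e

/-- The expansion to N = 2 is used for both products. The terms of order zero agree and cancel, so
every error has a factor ħ: the remainders are O(ħ²), and the first order term is off by ħ O(|B| +
|T|). -/
theorem commutator_operator_bound {F G : Phase → ℂ} (hF : IsSymbol F) (hG : IsSymbol G) :
    ∃ C δ : ℝ, 0 < δ ∧ ∀ ħ B T : ℝ, 0 < ħ → ħ < δ → |B| < δ → |T| < δ →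
      ‖renToeplitz ħ B T 1 F ∘L renToeplitz ħ B T 1 G
          - renToeplitz ħ B T 1 G ∘L renToeplitz ħ B T 1 F
          - (I * ħ) • renToeplitz ħ B T 1 (poisson F G)‖ ≤ C * (ħ * (ħ + |B| + |T|)) := by
  obtain ⟨C, hC0, hC⟩ := exists_norm_renToeplitz_comp_sub_le hF hG isCompact_smallSet smallSet_spec 2
  obtain ⟨C', hC0', hC'⟩ :=
    exists_norm_renToeplitz_comp_sub_le hG hF isCompact_smallSet smallSet_spec 2
  obtain ⟨D, hD0, hD⟩ := exists_norm_renCoeff_one_sub_le hF hG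
  refine ⟨C + C' + D, 1 / 2, by norm_num, fun ħ B T hħ _ h2 h3 => ?_⟩
  have hBT := mul_ne_one_of_abs_le h2.le h3.le
  have e1 := hC ħ B T 1 hħ (mem_smallSet h2.le h3.le)
  have e2 := hC' ħ B T 1 hħ (mem_smallSet h2.le h3.le)
  simp only [Finset.sum_range_succ, Finset.sum_range_zero, zero_add, pow_zero, one_smul,
    pow_one] at e1 e2
  rw [renCoeff_zero hħ hBT hG.1 hF.1] at e2
  have e3 := norm_renToeplitz_renCoeff_one_sub_le hħ hBT hF hG (by positivity)
    (hD ħ B T hħ h2.le h3.le)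
  refine (norm_renSpace_commutator_le _ _ _ _ _ _ hħ e1 e2 e3).trans ?_
  have hB := abs_nonneg B
  have hT := abs_nonneg T
  -- These two products are exactly the slack between the sum of the three errors and the claimed
  -- bound.
  have e4 : 0 ≤ (C + C') * (ħ * (|B| + |T|)) := by positivity
  have e5 : 0 ≤ D * ħ ^ 2 := by positivity
  linarith

/-! ### Independence of ħ at fixed (B, T, S) -/

theorem iota_ren {ħ B T S : ℝ} (hħ : 0 < ħ) (hS : 0 < S) (h : B * T ≠ 1) :
    iota ħ (ħ * T) (ħ * B) (√ħ * S) = iotaR B T S := by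
  have h1 : √ħ ≠ 0 := by positivity
  rw [iota_eq hħ (by positivity) (sq_sub_ne_zero hħ h), mul_div_cancel_left₀ _ hħ.ne',
    mul_div_cancel_left₀ _ hħ.ne', mul_div_cancel_left₀ _ h1]

/-- The coordinate map is the inverse of ι, so it is free of ħ because ι is. This argument needs no
smoothness of F and G. -/
theorem renCoeff_eq_renCoeff {ħ ħ' B T S : ℝ} (hħ : 0 < ħ) (hħ' : 0 < ħ') (hS : 0 < S)
    (h : B * T ≠ 1) (j : ℕ) (F G : Phase → ℂ) :
    renCoeff ħ B T S j F G = renCoeff ħ' B T S j F G := by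
  have hz : zNC ħ (ħ * T) (ħ * B) (√ħ * S) = zNC ħ' (ħ' * T) (ħ' * B) (√ħ' * S) := by
    have h1 := rightInverse_iota hħ (s := √ħ * S) (by positivity) (sq_sub_ne_zero hħ h)
    have h2 := leftInverse_iota hħ' (s := √ħ' * S) (by positivity) (sq_sub_ne_zero hħ' h)
    rw [iota_ren hħ hS h] at h1
    rw [iota_ren hħ' hS h] at h2
    funext x
    rw [← h1 (zNC ħ' (ħ' * T) (ħ' * B) (√ħ' * S) x), h2 x]
  unfold renCoeff starCoeff
  rw [iota_ren hħ hS h, iota_ren hħ' hS h, hz]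

end

end NCToeplitz

/-! ### The theorem -/

theorem mainTheorem6 :
    -- the setting: `𝒲` is closed, `ι` inverts the coordinate map, and symbols give symbols
    (∀ ħ ϑ 𝓑 s : ℝ, 0 < ħ → 0 < s → ħ ^ 2 - 𝓑 * ϑ ≠ 0 →
      IsClosed (cohRange ħ ϑ 𝓑 s : Set (Lp ℂ 2 (nu ħ ϑ 𝓑))) ∧
      Function.LeftInverse (iota ħ ϑ 𝓑 s) (zNC ħ ϑ 𝓑 s) ∧
      Function.RightInverse (iota ħ ϑ 𝓑 s) (zNC ħ ϑ 𝓑 s) ∧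
      ∀ j F G, IsSymbol F → IsSymbol G → IsSymbol (starCoeff ħ ϑ 𝓑 s j F G)) ∧
    -- `ι` and all `𝒞_j` depend only on `B`, `T`, `S`
    (∀ ħ ħ' B T S : ℝ, 0 < ħ → 0 < ħ' → 0 < S → B * T ≠ 1 →
      iota ħ (ħ * T) (ħ * B) (√ħ * S) = iota ħ' (ħ' * T) (ħ' * B) (√ħ' * S) ∧
      ∀ j F G, renCoeff ħ B T S j F G = renCoeff ħ' B T S j F G) ∧
    -- the asymptotic expansion in operator norm as `ħ ↘ 0`, locally uniformly in `B`, `T`, `S`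
    (∀ F G : Phase → ℂ, IsSymbol F → IsSymbol G →
      ∀ K : Set (ℝ × ℝ × ℝ), IsCompact K →
        (∀ b ∈ K, b.1 * b.2.1 ≠ 1 ∧ 0 < b.2.2) →
      ∀ N : ℕ, ∃ C : ℝ, ∀ ħ B T S : ℝ, 0 < ħ → ħ ≤ 1 → (B, T, S) ∈ K →
        ‖renToeplitz ħ B T S F ∘L renToeplitz ħ B T S G
          - ∑ j ∈ Finset.range N, (ħ : ℂ) ^ j • renToeplitz ħ B T S (renCoeff ħ B T S j F G)‖
          ≤ C * ħ ^ N) ∧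
    -- the star product, and its first two coefficients
    (∀ ħ ϑ 𝓑 s : ℝ, 0 < ħ → 0 < s → ħ ^ 2 - 𝓑 * ϑ ≠ 0 →
      IsStarProduct (starCoeff ħ ϑ 𝓑 s) ∧
      (∀ F G : Phase → ℂ, ContDiff ℝ ∞ F → ContDiff ℝ ∞ G → ∀ x,
        starCoeff ħ ϑ 𝓑 s 0 F G x = F x * G x ∧
        starCoeff ħ ϑ 𝓑 s 1 F G x
          = dotProduct (grad F x) (Matrix.mulVec (matA ħ ϑ 𝓑 s) (grad G x))) ∧
      matA ħ ϑ 𝓑 s = matRen (𝓑 / ħ : ℝ) (ϑ / ħ : ℝ) (s / √ħ : ℝ)) ∧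
    -- for `S = 1`: coefficients rational in `B`, `T` with powers of `1 - BT` as denominators
    (∃ P : ℕ → (Fin 4 → ℕ) → (Fin 4 → ℕ) → MvPolynomial (Fin 2) ℂ,
      ∀ (j : ℕ) (ħ B T : ℝ), 0 < ħ → B * T ≠ 1 →
      ∀ F G : Phase → ℂ, ContDiff ℝ ∞ F → ContDiff ℝ ∞ G →
        renCoeff ħ B T 1 j F G
          = bidiff j (fun μ ν => MvPolynomial.eval ![(B : ℂ), (T : ℂ)] (P j μ ν)
              / (1 - (B : ℂ) * T) ^ (2 * j)) F G) ∧
    -- for `S = 1`: the joint expansion as `(ħ, B, T) → (0, 0, 0)`, to all orders, for the star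
    -- product and for the operators, and its terms up to the second order
    (∃ c : ℕ → ℕ → ℕ → (Fin 4 → ℕ) → (Fin 4 → ℕ) → ℂ,
      (∀ F G : Phase → ℂ, IsSymbol F → IsSymbol G → ∀ N M : ℕ, N ≤ M →
        ∃ C δ : ℝ, 0 < δ ∧ ∀ ħ B T : ℝ, 0 < ħ → ħ < δ → |B| < δ → |T| < δ →
          (∀ x, ‖∑ j ∈ Finset.range M, (ħ : ℂ) ^ j * renCoeff ħ B T 1 j F G x
            - ∑ a ∈ tripleIdx N, (ħ : ℂ) ^ a.1 * (B : ℂ) ^ a.2.1 * (T : ℂ) ^ a.2.2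
                * bidiff a.1 (c a.1 a.2.1 a.2.2) F G x‖ ≤ C * (ħ + |B| + |T|) ^ N) ∧
          ‖renToeplitz ħ B T 1 F ∘L renToeplitz ħ B T 1 G
            - ∑ a ∈ tripleIdx N, ((ħ : ℂ) ^ a.1 * (B : ℂ) ^ a.2.1 * (T : ℂ) ^ a.2.2)
                • renToeplitz ħ B T 1 (bidiff a.1 (c a.1 a.2.1 a.2.2) F G)‖
            ≤ C * (ħ + |B| + |T|) ^ N) ∧
      (∀ F G : Phase → ℂ, ContDiff ℝ ∞ F → ContDiff ℝ ∞ G → ∀ (ħ B T : ℝ) (x : Phase),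
        ∑ a ∈ tripleIdx 3, (ħ : ℂ) ^ a.1 * (B : ℂ) ^ a.2.1 * (T : ℂ) ^ a.2.2
            * bidiff a.1 (c a.1 a.2.1 a.2.2) F G x
          = starSecond ħ B T F G x)) ∧
    -- for `S = 1`: the commutator up to the second order, and its leading term `iħ{F,G}`
    (∀ F G : Phase → ℂ, IsSymbol F → IsSymbol G →
      (∀ M : ℕ, 3 ≤ M → ∃ C δ : ℝ, 0 < δ ∧
        ∀ ħ B T : ℝ, 0 < ħ → ħ < δ → |B| < δ → |T| < δ → ∀ x,
          ‖∑ j ∈ Finset.range M, (ħ : ℂ) ^ j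
              * (renCoeff ħ B T 1 j F G x - renCoeff ħ B T 1 j G F x)
            - commSecond ħ B T F G x‖ ≤ C * (ħ + |B| + |T|) ^ 3) ∧
      (∃ C δ : ℝ, 0 < δ ∧
        ∀ ħ B T : ℝ, 0 < ħ → ħ < δ → |B| < δ → |T| < δ →
          ‖renToeplitz ħ B T 1 F ∘L renToeplitz ħ B T 1 G
              - renToeplitz ħ B T 1 G ∘L renToeplitz ħ B T 1 F
            - (I * ħ) • renToeplitz ħ B T 1 (poisson F G)‖
            ≤ C * (ħ * (ħ + |B| + |T|)))) := by
  refine ⟨fun ħ ϑ 𝓑 s hħ hs h => ⟨isClosed_cohRange hħ hs h, leftInverse_iota hħ hs h,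
    rightInverse_iota hħ hs h, fun j F G hF hG => isSymbol_starCoeff hħ hs h j hF hG⟩,
    fun ħ ħ' B T S hħ hħ' hS h => ⟨?_, renCoeff_eq_renCoeff hħ hħ' hS h⟩,
    fun F G hF hG K hKc hK N => ?_,
    fun ħ ϑ 𝓑 s hħ hs h => ⟨isStarProduct_starCoeff hħ hs h, fun F G hF hG x => ⟨?_, ?_⟩,
      matA_eq_matRen hħ hs h⟩,
    ⟨coeffPoly, fun j ħ B T hħ h F G hF hG => renCoeff_eq_bidiff hħ h j hF hG⟩, ?_,
    fun F G hF hG => ⟨fun M hM => commutator_expansion hF hG hM, commutator_operator_bound hF hG⟩⟩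
  · rw [iota_ren hħ hS h, iota_ren hħ' hS h]
  · obtain ⟨C, _, hC⟩ := exists_norm_renToeplitz_comp_sub_le hF hG hKc hK N
    exact ⟨C, fun ħ B T S hħ _ hb => hC ħ B T S hħ hb⟩
  · rw [starCoeff_eq_mop hħ hs h 0 hF hG, mop_cSym_zero]
  · have hS : s / √ħ ≠ 0 := by positivity
    rw [starCoeff_eq_mop hħ hs h 1 hF hG, mop_cSym_one hS (one_sub_ne_zero hħ h) hF hG,
      matA_eq_matRen hħ hs h]
  -- One family of jets, chosen before F and G, provides the operators D_{jkl} for both expansions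
  -- and for the explicit terms.
  · obtain ⟨c, hc, hc0⟩ := exists_hasJet_cf
    refine ⟨c, fun F G hF hG N M hNM => ?_, fun F G hF hG ħ B T x =>
      sum_tripleIdx_three hc hc0 hF hG ħ B T x⟩
    obtain ⟨C, δ, hδ, hC⟩ := joint_expansion hc hF hG hNM
    obtain ⟨C', δ', hδ', hC'⟩ := joint_operator_expansion hc hF hG N
    refine ⟨max C C', min δ δ', lt_min hδ hδ', fun ħ B T hħ h1 h2 h3 => ?_⟩
    have hε : 0 ≤ (ħ + |B| + |T|) ^ N := by positivity
    exact ⟨fun x => (hC ħ B T hħ (h1.trans_le (min_le_left _ _)) (h2.trans_le (min_le_left _ _))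
        (h3.trans_le (min_le_left _ _)) x).trans
          (mul_le_mul_of_nonneg_right (le_max_left _ _) hε),
      (hC' ħ B T hħ (h1.trans_le (min_le_right _ _)) (h2.trans_le (min_le_right _ _))
        (h3.trans_le (min_le_right _ _))).trans
          (mul_le_mul_of_nonneg_right (le_max_right _ _) hε)⟩
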